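/- Let $\mathbb{T}^3=\mathbb{R}^3/\mathbb{Z}^3$ be the unit flat torus. For $E\subset\mathbb{T}^3$ let $J(E)$ be the perimeter $$J(E)=\sup\Big\{\int_E \operatorname{div}\varphi\,dx:\ \varphi\in C^1(\mathbb{T}^3;\mathbb{R}^3),\ \|\varphi\|_\infty\le 1\Big\}.$$ For a smooth set $E$ let $\nu$ be its outer unit normal, $D_\tau$ and $\Delta_\tau$ the tangential gradient and the Laplace–Beltrami operator on $\partial E$, $H$ the mean curvature (the sum of the principal curvatures, $H=\operatorname{div}_\tau\nu$), $B[\xi]=(D_\tau\nu\,\xi)\cdot\xi$ the second fundamental form, $|B|^2$ the sum of the squares of the principal curvatures, and $$\partial^2J(E)[\varphi]=\int_{\partial E}|D_\tau\varphi|^2\,d\mathcal{H}^2-\int_{\partial E}|B|^2\varphi^2\,d\mathcal{H}^2 .$$ Let $(E_t)_{t\in(0,T)}$ be a smooth flow of subsets of $\mathbb{T}^3$, that is, $E_t=\Psi_t(F)$ for a smooth set $F\subset\mathbb{T}^3$ and a map $\Psi\in C^\infty(\mathbb{T}^3\times(0,T);\mathbb{T}^3)$ such that every $\Psi_t=\Psi(\cdot,t)$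 is a smooth diffeomorphism of $\mathbb{T}^3$. Suppose that it solves the surface diffusion equation $$V_t=\Delta_\tau H_t\quad\text{on }\partial E_t\ \text{ for all }t\in(0,T),$$ where $V_t=\big((\partial_t\Psi_t)\circ\Psi_t^{-1}\big)\cdot\nu_t$ is the outer normal velocity of $\partial E_t$ and the subscript $t$ refers to the set $E_t$. Then, for every $t\in(0,T)$, $J(E_t)$ is finite, the integrals below converge absolutely, the derivatives below exist, and $$\frac{d}{dt}J(E_t)=-\int_{\partial E_t}|D_\tau H_t|^2\,d\mathcal{H}^2,$$ $$\frac{d}{dt}\Big(\frac12\int_{\partial E_t}|D_\tau H_t|^2\,d\mathcal{H}^2\Big)=-\partial^2J(E_t)[\Delta_\tau H_t]-\int_{\partial E_t}B_t[D_\tau H_t]\,\Delta_\tau H_t\,d\mathcal{H}^2+\frac12\int_{\partial E_t}H_t\,|D_\tau H_t|^2\,\Delta_\tau H_t\,d\mathcal{H}^2 .$$ -/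

import Mathlib

open Set MeasureTheory
open scoped ContDiff ENNReal Topology

noncomputable section

namespace SurfaceDiffusion

/-! The flat torus `𝕋³ = ℝ³ / ℤ³` is handled through its universal cover: subsets of `𝕋³` are
`ℤ³`-periodic subsets of `ℝ³`, functions on `𝕋³` are `ℤ³`-periodic functions on `ℝ³`, self-maps
of `𝕋³` are represented by their lifts to `ℝ³`, and integrals are taken over a unit cell. -/

/-- Euclidean three-space. -/
abbrev R3 : Type := EuclideanSpace ℝ (Fin 3)

/-- The point of the lattice `ℤ³ ⊆ ℝ³` with coordinates `m`. -/
def latticeVec (m : Fin 3 → ℤ) : R3 := WithLp.toLp 2 (fun i => (m i : ℝ))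

/-- The half-open unit cell `[0,1)³`, a fundamental domain of `ℤ³`. -/
def unitCell : Set R3 := {x | ∀ i, x i ∈ Ico (0 : ℝ) 1}

/-- `E` is (the periodic extension of) a subset of the torus. -/
def IsPeriodicSet (E : Set R3) : Prop := ∀ (x : R3) (m : Fin 3 → ℤ), x + latticeVec m ∈ E ↔ x ∈ E

/-- `ρ` is a smooth function that describes `E` near its boundary point `x`: `E` coincides near `x`
with the sublevel set of `ρ` at `0` (up to points of the regular level set `{ρ = 0}`, which may or
may not belong to `E`). -/
structure IsDefiningFunction (E : Set R3) (x : R3) (ρ : R3 → ℝ) : Prop where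
  smooth : ContDiff ℝ ∞ ρ
  zero : ρ x = 0
  gradient_ne : gradient ρ x ≠ 0
  inside : ∀ᶠ y in 𝓝 x, ρ y < 0 → y ∈ E
  outside : ∀ᶠ y in 𝓝 x, 0 < ρ y → y ∉ E

/-- `E` is a smooth subset of the torus. -/
structure IsSmoothSet (E : Set R3) : Prop where
  periodic : IsPeriodicSet E
  boundary : ∀ x ∈ frontier E, ∃ ρ, IsDefiningFunction E x ρ

/-- `n` is the outer unit normal to `E` at its boundary point `x`. -/
def IsOuterNormal (E : Set R3) (x n : R3) : Prop :=
  ∃ ρ, IsDefiningFunction E x ρ ∧ n = ‖gradient ρ x‖⁻¹ • gradient ρ x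

open Classical in
/-- The outer unit normal `ν_E`; it takes the value `0` away from the regular boundary points. -/
def normal (E : Set R3) (x : R3) : R3 :=
  if h : ∃ n, IsOuterNormal E x n then h.choose else 0

/-- The tangential part `X_τ = X - (X · ν) ν` at `x` of a vector `X`. -/
def tangentialPart (E : Set R3) (x v : R3) : R3 := v - inner ℝ v (normal E x) • normal E x

/-- The tangential gradient `D_τ f = (D f)_τ` of a function `f` on `∂E`. The derivative is taken
along `∂E`, so only the values of `f` on `∂E` matter; its component normal to `∂E`, which these
values do not determine, is removed by the projection. -/
def tangentialGradient (E : Set R3) (f : R3 → ℝ) (x : R3) : R3 :=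
  tangentialPart E x (gradientWithin f (frontier E) x)

/-- The derivative `D_τ X [v]` of a vector field `X` on `∂E` in the direction of the tangential
part of `v`. -/
def tangentialDerivative (E : Set R3) (X : R3 → R3) (x v : R3) : R3 :=
  fderivWithin ℝ X (frontier E) x (tangentialPart E x v)

/-- The tangential divergence `div_τ X = div X - ∂_ν X · ν` of a vector field `X` on `∂E`. The
difference depends only on the derivatives of `X` in tangential directions. -/
def tangentialDivergence (E : Set R3) (X : R3 → R3) (x : R3) : ℝ :=
  (∑ i, (fderivWithin ℝ X (frontier E) x (EuclideanSpace.single i 1)) i)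
    - inner ℝ (fderivWithin ℝ X (frontier E) x (normal E x)) (normal E x)

/-- The Laplace-Beltrami operator `Δ_τ f = div_τ D_τ f` of `∂E`. -/
def laplaceBeltrami (E : Set R3) (f : R3 → ℝ) : R3 → ℝ :=
  tangentialDivergence E (tangentialGradient E f)

/-- The mean curvature `H`, the sum of the principal curvatures: the trace `div_τ ν` of the
Weingarten map `D_τ ν`. It is positive for a ball. -/
def meanCurvature (E : Set R3) : R3 → ℝ := tangentialDivergence E (normal E)

/-- The second fundamental form `B[v] = (D_τ ν v) · v`, as a quadratic form. -/
def secondFundamentalForm (E : Set R3) (x v : R3) : ℝ :=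
  inner ℝ (tangentialDerivative E (normal E) x v) v

/-- The square `|B|²` of the Euclidean norm of the matrix `D_τ ν`, which is the sum of the squares
of the principal curvatures. -/
def normSqB (E : Set R3) (x : R3) : ℝ :=
  ∑ i, ‖tangentialDerivative E (normal E) x (EuclideanSpace.single i 1)‖ ^ 2

/-- `∫_{∂E} f dℋ²`, the boundary being taken in the torus. The measure `μHE[2]` is the
two-dimensional Hausdorff measure with its usual normalization. -/
def boundaryIntegral (E : Set R3) (f : R3 → ℝ) : ℝ :=
  ∫ x in frontier E ∩ unitCell, f x ∂μHE[2]

/-- `f` is `ℋ²`-integrable on the boundary of `E` in the torus. -/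
def BoundaryIntegrable (E : Set R3) (f : R3 → ℝ) : Prop :=
  IntegrableOn f (frontier E ∩ unitCell) μHE[2]

/-- The divergence of a vector field on `ℝ³`. -/
def divergence (φ : R3 → R3) (x : R3) : ℝ :=
  ∑ i, (fderiv ℝ φ x (EuclideanSpace.single i 1)) i

/-- Admissible test fields for the perimeter: periodic `C¹` vector fields of length at most one. -/
structure IsTestField (φ : R3 → R3) : Prop where
  contDiff : ContDiff ℝ 1 φ
  periodic : ∀ (x : R3) (m : Fin 3 → ℤ), φ (x + latticeVec m) = φ x
  norm_le : ∀ x, ‖φ x‖ ≤ 1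

/-- The perimeter of `E` in the torus, `sup ∫_E div φ` over all test fields `φ`, with values
in `[0, ∞]`. -/
def perimeter (E : Set R3) : ℝ≥0∞ :=
  ⨆ (φ : R3 → R3) (_ : IsTestField φ), ENNReal.ofReal (∫ x in E ∩ unitCell, divergence φ x)

/-- The energy `J`, which is the perimeter. -/
def J (E : Set R3) : ℝ := (perimeter E).toReal

/-- The quadratic form `∂²J(E)[φ] = ∫ |D_τ φ|² - ∫ |B|² φ²`. -/
def secondVariation (E : Set R3) (φ : R3 → ℝ) : ℝ :=
  boundaryIntegral E (fun x => ‖tangentialGradient E φ x‖ ^ 2)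
    - boundaryIntegral E (fun x => normSqB E x * φ x ^ 2)

/-- `ψ` maps points that agree in the torus to points that agree in the torus. -/
def DescendsToTorus (ψ : R3 → R3) : Prop :=
  ∀ (x : R3) (m : Fin 3 → ℤ), ∃ n : Fin 3 → ℤ, ψ (x + latticeVec m) = ψ x + latticeVec n

/-- `ψ` is the lift to `ℝ³` of a smooth diffeomorphism of the torus. -/
def IsTorusDiffeo (ψ : R3 → R3) : Prop :=
  ContDiff ℝ ∞ ψ ∧ DescendsToTorus ψ ∧
    ∃ χ : R3 → R3, ContDiff ℝ ∞ χ ∧ DescendsToTorus χ ∧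
      Function.LeftInverse χ ψ ∧ Function.RightInverse χ ψ

/-- `(E_t)` is a smooth flow of subsets of the torus on `(0, T)`, with reference set `F` and (the
lift of) the smooth family of diffeomorphisms `Ψ_t`. -/
structure IsSmoothFlow (F : Set R3) (Ψ : ℝ → R3 → R3) (E : ℝ → Set R3) (T : ℝ) : Prop where
  reference : IsSmoothSet F
  smooth : ContDiffOn ℝ ∞ (fun p : ℝ × R3 => Ψ p.1 p.2) (Ioo 0 T ×ˢ univ)
  diffeo : ∀ t ∈ Ioo 0 T, IsTorusDiffeo (Ψ t)
  eq_image : ∀ t ∈ Ioo 0 T, E t = Ψ t '' F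

/-- The velocity field `X_t = (∂_t Ψ_t) ∘ Ψ_t⁻¹`. -/
def velocity (Ψ : ℝ → R3 → R3) (t : ℝ) (y : R3) : R3 :=
  deriv (fun s => Ψ s (Function.invFun (Ψ t) y)) t

/-- The outer normal velocity `V_t = X_t · ν_t` of the moving boundary. -/
def normalVelocity (Ψ : ℝ → R3 → R3) (E : ℝ → Set R3) (t : ℝ) (y : R3) : ℝ :=
  inner ℝ (velocity Ψ t y) (normal (E t) y)

/-- `(E_t)` is a smooth flow on `(0, T)` which solves the surface diffusion equation
`V_t = Δ_τ H_t` on `∂E_t`. -/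
def IsSurfaceDiffusionFlow (E : ℝ → Set R3) (T : ℝ) : Prop :=
  ∃ (F : Set R3) (Ψ : ℝ → R3 → R3), IsSmoothFlow F Ψ E T ∧
    ∀ t ∈ Ioo 0 T, ∀ y ∈ frontier (E t),
      normalVelocity Ψ E t y = laplaceBeltrami (E t) (meanCurvature (E t)) y

/-- The tangential gradient `D_τ H` of the mean curvature. -/
def DH (E : Set R3) : R3 → R3 := tangentialGradient E (meanCurvature E)

/-- The surface Laplacian `Δ_τ H` of the mean curvature. -/
def LH (E : Set R3) : R3 → ℝ := laplaceBeltrami E (meanCurvature E)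

end SurfaceDiffusion

end

open SurfaceDiffusion

open Set MeasureTheory
open scoped ContDiff ENNReal Topology

noncomputable section

namespace SurfaceDiffusion

/-! The proof replaces every surface computation by calculus of smooth functions on space-time
together with the Gauss-Green formula. No surface is parametrized and differentiated.

Fix a time t. Composing the flow with the inverse of `Ψ t` gives diffeomorphisms Φ_s with Φ_t the
identity. A periodic defining function of `E t`, transported by Φ_s, gives a function u(s,x) whose
zero set near t is ∂E_s. Normalizing its gradient, with a cutoff away from the surface, gives a
global smooth field N that has length at most one everywhere, is a unit field on an open set O
containing the moving boundaries, and equals the outer normal on them. There ∇u = gN and ∂_t u = -Vg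
(`IsNormalFlow`). Since |N| = 1 near the surface, div N extends the mean curvature H. Symmetry of
the second derivatives of u then gives, for the derivative ∂ = ∂_t + V N·∇ that follows the surface
in the normal direction, the evolution laws ∂N = -D_τ V (`nd_normal`), ∂H = -Δ_τ V - |B|² V
(`nd_sdiv`, `trace_sq`), ∂(½|D_τ f|²) = D_τ f · D_τ ∂f - V B[D_τ f] (`nd_half_sq_tg`).

The integrals rest on two facts. The first variation formula d/dt ∫ f = ∫ (∂f + f H V) over the
boundary (`hasDerivAt_boundaryIntegral`) holds because ∫ f over ∂E_s is the volume integral of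
div(fN) over E_s: the Reynolds transport theorem differentiates it, and Gauss-Green turns the result
back into a boundary integral. Integration by parts on the closed surface (`boundaryIntegral_tdiv`)
holds because the tangential divergence of a tangential field is the normal component of a
divergence-free field.

With f = 1 and V = Δ_τ H the first variation is ∫ H Δ_τ H = -∫ |D_τ H|². With f = ½|D_τ H|² it is
the integral of D_τ H · D_τ ∂H - V B[D_τ H] + ½ H |D_τ H|² V. Its first term integrates to -∫ Δ_τ H
∂H = ∫ (V Δ_τ V + |B|² V²) = -∂²J[V].

Gauss-Green itself is proved from the Hausdorff measure (`exists_approx_gaussGreen`): near a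
boundary point the surface is a graph of slope at most ε, its area is compared with that of its
projection through Lipschitz bounds, and a partition of unity adds up errors of order ε relative to
the total mass of the test function. It also identifies the perimeter with the area, N being an
optimal test field. -/

theorem inner_gradient (ρ : R3 → ℝ) (x v : R3) : inner ℝ (gradient ρ x) v = fderiv ℝ ρ x v := by
  simp [gradient]

theorem inner_gradientWithin (ρ : R3 → ℝ) (s : Set R3) (x v : R3) :
    inner ℝ (gradientWithin ρ s x) v = fderivWithin ℝ ρ s x v := by
  simp [gradientWithin]

/-! ### Defining functions and the outer normal -/

namespace IsDefiningFunction

variable {E : Set R3} {x : R3} {ρ ρ₁ ρ₂ : R3 → ℝ}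

theorem hasDerivAt_line (h : IsDefiningFunction E x ρ) (v : R3) :
    HasDerivAt (fun s : ℝ => ρ (x + s • v)) (fderiv ℝ ρ x v) 0 := by
  have h1 : HasFDerivAt ρ (fderiv ℝ ρ x) (x + (0 : ℝ) • v) := by
    simpa using (h.smooth.differentiable (by simp) x).hasFDerivAt
  have h2 : HasDerivAt (fun s : ℝ => x + s • v) v 0 := by
    simpa using ((hasDerivAt_id (0 : ℝ)).smul_const v).const_add x
  exact h1.comp_hasDerivAt 0 h2

theorem eventually_neg (h : IsDefiningFunction E x ρ) {v : R3} (hv : fderiv ℝ ρ x v < 0) :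
    ∀ᶠ s : ℝ in 𝓝[>] 0, ρ (x + s • v) < 0 := by
  have h1 := (h.hasDerivAt_line v).hasDerivWithinAt (s := Ioi 0)
  have h2 := (hasDerivWithinAt_iff_tendsto_slope' (by simp)).1 h1
  filter_upwards [h2.eventually (gt_mem_nhds hv), self_mem_nhdsWithin] with s hs hs0
  have hs0' : (0 : ℝ) < s := hs0
  simp only [slope_def_field, zero_smul, add_zero, h.zero, sub_zero] at hs
  exact (div_neg_iff.1 hs).resolve_left (by rintro ⟨-, h⟩; linarith) |>.1

theorem neg_compl (h : IsDefiningFunction E x ρ) : IsDefiningFunction Eᶜ x (fun y => -ρ y) where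
  smooth := h.smooth.neg
  zero := by simp [h.zero]
  gradient_ne := by
    have : gradient (fun y => -ρ y) x = - gradient ρ x := by
      simp [gradient, fderiv_fun_neg]
    rw [this]; exact neg_ne_zero.2 h.gradient_ne
  inside := by
    filter_upwards [h.outside] with y hy h1 using hy (by linarith)
  outside := by
    filter_upwards [h.inside] with y hy h1 using fun h2 => h2 (hy (by linarith))

theorem tendsto_line (x v : R3) : Filter.Tendsto (fun s : ℝ => x + s • v) (𝓝[>] 0) (𝓝 x) := by
  have : Continuous (fun s : ℝ => x + s • v) := by fun_prop
  have h := (this.tendsto 0).mono_left (nhdsWithin_le_nhds (s := Ioi (0 : ℝ)))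
  simpa using h

theorem mem_closure (h : IsDefiningFunction E x ρ) : x ∈ closure E := by
  have hlt : fderiv ℝ ρ x (-gradient ρ x) < 0 := by
    rw [map_neg, ← inner_gradient, real_inner_self_eq_norm_sq]
    have := norm_pos_iff.2 h.gradient_ne
    nlinarith
  have h1 := h.eventually_neg hlt
  refine mem_closure_of_tendsto (tendsto_line x (-gradient ρ x)) ?_
  filter_upwards [h1, (tendsto_line x (-gradient ρ x)).eventually h.inside] with s h2 h3
    using h3 h2

theorem mem_frontier (h : IsDefiningFunction E x ρ) : x ∈ frontier E := by
  rw [frontier_eq_closure_inter_closure]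
  exact ⟨h.mem_closure, h.neg_compl.mem_closure⟩

/-- Otherwise the points x + s v with small s > 0 would lie in E according to ρ₁ and outside E
according to ρ₂. -/
theorem fderiv_nonpos (h₁ : IsDefiningFunction E x ρ₁) (h₂ : IsDefiningFunction E x ρ₂) {v : R3}
    (hv : fderiv ℝ ρ₁ x v < 0) : fderiv ℝ ρ₂ x v ≤ 0 := by
  by_contra! hlt
  have h3 := h₂.neg_compl.eventually_neg (v := v) (by simpa [fderiv_fun_neg] using hlt)
  have h5 := ((h₁.eventually_neg hv).and ((tendsto_line x v).eventually h₁.inside)).and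
    (h3.and ((tendsto_line x v).eventually h₂.outside))
  obtain ⟨s, ⟨h6, h7⟩, h8, h9⟩ := h5.exists
  exact h9 (by linarith) (h7 h6)

/-- If the unit gradients n₁ and n₂ differ, then n₁ · n₂ < 1, so ρ₁ strictly decreases and ρ₂
strictly increases in the direction n₂ - n₁, against `fderiv_nonpos`. This is what makes the choice
in `normal` harmless. -/
theorem normalized_eq (h₁ : IsDefiningFunction E x ρ₁) (h₂ : IsDefiningFunction E x ρ₂) :
    ‖gradient ρ₁ x‖⁻¹ • gradient ρ₁ x = ‖gradient ρ₂ x‖⁻¹ • gradient ρ₂ x := by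
  set n₁ := ‖gradient ρ₁ x‖⁻¹ • gradient ρ₁ x with hn₁
  set n₂ := ‖gradient ρ₂ x‖⁻¹ • gradient ρ₂ x with hn₂
  have p₁ := norm_pos_iff.2 h₁.gradient_ne
  have p₂ := norm_pos_iff.2 h₂.gradient_ne
  have u₁ : ‖n₁‖ = 1 := norm_smul_inv_norm h₁.gradient_ne
  have u₂ : ‖n₂‖ = 1 := norm_smul_inv_norm h₂.gradient_ne
  by_contra hne
  have hlt : inner ℝ n₁ n₂ < 1 := by
    have hle : inner ℝ n₁ n₂ ≤ 1 := by
      simpa [u₁, u₂] using real_inner_le_norm n₁ n₂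
    rcases hle.lt_or_eq with h | h
    · exact h
    · exact absurd ((inner_eq_one_iff_of_norm_eq_one (𝕜 := ℝ) u₁ u₂).1 h) hne
  have e₁ : fderiv ℝ ρ₁ x (n₂ - n₁) = ‖gradient ρ₁ x‖ * (inner ℝ n₁ n₂ - 1) := by
    have : inner ℝ n₁ (n₂ - n₁) = inner ℝ n₁ n₂ - 1 := by
      rw [inner_sub_right, real_inner_self_eq_norm_sq, u₁]; norm_num
    rw [← inner_gradient, ← this, hn₁, inner_smul_left]
    simp only [conj_trivial]; field_simp
  have e₂ : fderiv ℝ ρ₂ x (n₂ - n₁) = ‖gradient ρ₂ x‖ * (1 - inner ℝ n₁ n₂) := by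
    have : inner ℝ n₂ (n₂ - n₁) = 1 - inner ℝ n₁ n₂ := by
      rw [inner_sub_right, real_inner_self_eq_norm_sq, u₂, real_inner_comm]; norm_num
    rw [← inner_gradient, ← this, hn₂, inner_smul_left]
    simp only [conj_trivial]; field_simp
  have h3 := h₁.fderiv_nonpos h₂ (v := n₂ - n₁) (by rw [e₁]; nlinarith)
  rw [e₂] at h3
  nlinarith

theorem normal_eq (h : IsDefiningFunction E x ρ) :
    normal E x = ‖gradient ρ x‖⁻¹ • gradient ρ x := by
  have hex : ∃ n, IsOuterNormal E x n := ⟨_, ρ, h, rfl⟩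
  rw [normal, dif_pos hex]
  obtain ⟨ρ', h', e⟩ := hex.choose_spec
  rw [e, h'.normalized_eq h]

theorem norm_normal (h : IsDefiningFunction E x ρ) : ‖normal E x‖ = 1 := by
  rw [h.normal_eq]; exact norm_smul_inv_norm h.gradient_ne

theorem gradient_eq (h : IsDefiningFunction E x ρ) :
    gradient ρ x = ‖gradient ρ x‖ • normal E x := by
  rw [h.normal_eq, smul_smul, mul_inv_cancel₀ (norm_ne_zero_iff.2 h.gradient_ne), one_smul]

theorem continuous_gradient (h : IsDefiningFunction E x ρ) : Continuous (gradient ρ) := by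
  have : Continuous (fderiv ℝ ρ) := h.smooth.continuous_fderiv (by simp)
  exact (LinearIsometryEquiv.continuous _).comp this

theorem eventually (h : IsDefiningFunction E x ρ) :
    ∀ᶠ y in 𝓝 x, ρ y = 0 → IsDefiningFunction E y ρ := by
  filter_upwards [h.inside.eventually_nhds, h.outside.eventually_nhds,
    h.continuous_gradient.continuousAt.eventually_ne h.gradient_ne] with y h1 h2 h3 h4
  exact ⟨h.smooth, h4, h3, h1, h2⟩

theorem eventually_mem_frontier_iff (h : IsDefiningFunction E x ρ) :
    ∀ᶠ y in 𝓝 x, (ρ y < 0 → y ∈ interior E) ∧ (0 < ρ y → y ∉ closure E) ∧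
      (ρ y = 0 → IsDefiningFunction E y ρ) := by
  have hc : Continuous ρ := h.smooth.continuous
  filter_upwards [h.inside.eventually_nhds, h.outside.eventually_nhds, h.eventually]
    with y h1 h2 h3
  refine ⟨fun hy => ?_, fun hy => ?_, h3⟩
  · rw [mem_interior_iff_mem_nhds]
    filter_upwards [h1, hc.continuousAt.eventually (gt_mem_nhds hy)] with z h4 h5 using h4 h5
  · intro hcl
    rw [mem_closure_iff_frequently] at hcl
    apply hcl
    filter_upwards [h2, hc.continuousAt.eventually (lt_mem_nhds hy)] with z h4 h5 using h4 h5

end IsDefiningFunction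

theorem IsSmoothSet.exists_normal {E : Set R3} (hE : IsSmoothSet E) {x : R3}
    (hx : x ∈ frontier E) : ‖normal E x‖ = 1 := by
  obtain ⟨ρ, h⟩ := hE.boundary x hx
  exact h.norm_normal

/-! ### Local graphs -/

/-- The Euclidean plane. -/
abbrev R2 : Type := EuclideanSpace ℝ (Fin 2)

/-- The affine chart of `ℝ³` with origin `x₀` and axes given by a linear isometry. -/
def chart (x₀ : R3) (L : WithLp 2 (R2 × ℝ) ≃ₗᵢ[ℝ] R3) (p : R2 × ℝ) : R3 :=
  x₀ + L (WithLp.toLp 2 p)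

/-- An arbitrary isometry is followed by the reflection that exchanges the image of the vertical
unit vector with n. -/
theorem exists_linearIsometryEquiv (n : R3) (hn : ‖n‖ = 1) :
    ∃ L : WithLp 2 (R2 × ℝ) ≃ₗᵢ[ℝ] R3, L (WithLp.toLp 2 (0, 1)) = n := by
  have hd : Module.finrank ℝ (WithLp 2 (R2 × ℝ)) = Module.finrank ℝ R3 := by
    rw [LinearEquiv.finrank_eq (WithLp.linearEquiv 2 ℝ (R2 × ℝ))]
    simp
  let L₀ : WithLp 2 (R2 × ℝ) ≃ₗᵢ[ℝ] R3 :=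
    (stdOrthonormalBasis ℝ (WithLp 2 (R2 × ℝ))).equiv (stdOrthonormalBasis ℝ R3) (finCongr hd)
  refine ⟨L₀.trans (Submodule.reflection (ℝ ∙ (L₀ (WithLp.toLp 2 (0, 1)) - n))ᗮ), ?_⟩
  have h1 : ‖L₀ (WithLp.toLp 2 (0, 1))‖ = ‖n‖ := by
    rw [LinearIsometryEquiv.norm_map, hn, WithLp.prod_norm_eq_of_L2]
    simp
  simpa using Submodule.reflection_sub h1

section Chart

variable (x₀ : R3) (L : WithLp 2 (R2 × ℝ) ≃ₗᵢ[ℝ] R3)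

/-- The linear part of a chart. -/
def chartLin : (R2 × ℝ) →L[ℝ] R3 :=
  (L : WithLp 2 (R2 × ℝ) →L[ℝ] R3) ∘L
    ((WithLp.prodContinuousLinearEquiv 2 ℝ R2 ℝ).symm : (R2 × ℝ) →L[ℝ] WithLp 2 (R2 × ℝ))

theorem chartLin_apply (p : R2 × ℝ) : chartLin L p = L (WithLp.toLp 2 p) := rfl

theorem chart_eq (p : R2 × ℝ) : chart x₀ L p = x₀ + chartLin L p := rfl

theorem inner_chartLin (p q : R2 × ℝ) :
    inner ℝ (chartLin L p) (chartLin L q) = inner ℝ p.1 q.1 + p.2 * q.2 := by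
  rw [chartLin_apply, chartLin_apply, LinearIsometryEquiv.inner_map_map, WithLp.prod_inner_apply]
  simp [mul_comm]

theorem norm_chartLin_sq (p : R2 × ℝ) : ‖chartLin L p‖ ^ 2 = ‖p.1‖ ^ 2 + p.2 ^ 2 := by
  rw [← real_inner_self_eq_norm_sq, inner_chartLin, real_inner_self_eq_norm_sq, sq p.2]

theorem contDiff_chart {k : ℕ∞ω} : ContDiff ℝ k (chart x₀ L) := by
  have : chart x₀ L = fun p => x₀ + chartLin L p := rfl
  rw [this]; fun_prop

theorem hasFDerivAt_chart (p : R2 × ℝ) : HasFDerivAt (chart x₀ L) (chartLin L) p :=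
  (chartLin L).hasFDerivAt.const_add x₀

/-- A chart as a homeomorphism. -/
def chartHomeo : (R2 × ℝ) ≃ₜ R3 :=
  ((WithLp.prodContinuousLinearEquiv 2 ℝ R2 ℝ).symm.toHomeomorph.trans
    L.toHomeomorph).trans (Homeomorph.addLeft x₀)

theorem measurePreserving_chart : MeasurePreserving (chart x₀ L) := by
  have h1 := WithLp.volume_preserving_toLp R2 ℝ
  exact (measurePreserving_add_left volume x₀).comp (L.measurePreserving.comp h1)

end Chart

/-- The implicit function theorem, in coordinates whose vertical axis is the normal at x₀. The
height function then has zero gradient at the origin, so its slope is at most ε on a small disc. It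
is cut off to be C¹ on the whole plane, so that it can define a global shear later. -/
theorem IsDefiningFunction.exists_graph {E : Set R3} {x₀ : R3} {ρ : R3 → ℝ}
    (h : IsDefiningFunction E x₀ ρ) {L : WithLp 2 (R2 × ℝ) ≃ₗᵢ[ℝ] R3}
    (hL : L (WithLp.toLp 2 (0, 1)) = normal E x₀) {ε : ℝ} (hε : 0 < ε) :
    ∃ u : R2 → ℝ, ContDiff ℝ 1 u ∧ u 0 = 0 ∧ fderiv ℝ u 0 = 0 ∧ ∃ r > 0, ∃ δ > 0,
      (∀ y ∈ Metric.ball 0 r, ‖fderiv ℝ u y‖ ≤ ε ∧ u y ∈ Ioo (-δ) δ) ∧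
      ∀ y ∈ Metric.ball 0 r, ∀ s ∈ Ioo (-δ) δ,
        (s < u y → chart x₀ L (y, s) ∈ interior E) ∧ (u y < s → chart x₀ L (y, s) ∉ closure E) ∧
        (s = u y → chart x₀ L (y, s) ∈ frontier E ∧
          ‖normal E (chart x₀ L (y, s)) - normal E x₀‖ ≤ ε) := by
  have hg := norm_pos_iff.2 h.gradient_ne
  set f : R2 × ℝ → ℝ := fun p => ρ (chart x₀ L p) with hf
  have hfs : ContDiff ℝ ∞ f := h.smooth.comp (contDiff_chart x₀ L)
  have hc0 : chart x₀ L 0 = x₀ := by simp [chart]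
  have hf0 : f 0 = 0 := by simp only [hf, hc0, h.zero]
  have hDf : ∀ p v, fderiv ℝ f p v = fderiv ℝ ρ (chart x₀ L p) (chartLin L v) := by
    intro p v
    have h1 : HasFDerivAt ρ (fderiv ℝ ρ (chart x₀ L p)) (chart x₀ L p) :=
      (h.smooth.differentiable (by simp) _).hasFDerivAt
    have := (h1.comp p (hasFDerivAt_chart x₀ L p)).fderiv
    rw [show f = ρ ∘ chart x₀ L from rfl, this]; rfl
  have hDf0 : ∀ v, fderiv ℝ f 0 v = ‖gradient ρ x₀‖ * v.2 := by
    intro v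
    rw [hDf, hc0, ← inner_gradient, h.gradient_eq, ← hL, ← chartLin_apply, inner_smul_left,
      inner_chartLin]
    rw [norm_smul, norm_norm, chartLin_apply, hL, h.norm_normal]
    simp
  have hinr : ∀ c, (fderiv ℝ f 0 ∘L .inr ℝ R2 ℝ) c = ‖gradient ρ x₀‖ * c := by
    intro c; simp [hDf0]
  have if₂ : (fderiv ℝ f 0 ∘L .inr ℝ R2 ℝ).IsInvertible := by
    refine ⟨ContinuousLinearEquiv.unitsEquivAut ℝ (Units.mk0 ‖gradient ρ x₀‖ hg.ne'), ?_⟩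
    ext
    simp [hDf0]
  have cdf : ContDiffAt ℝ ∞ f 0 := hfs.contDiffAt
  set w : R2 → ℝ := cdf.implicitFunction (by simp) if₂ with hw
  have w0 : w 0 = 0 := cdf.implicitFunction_apply_self (by simp) if₂
  have ws : ContDiffAt ℝ ∞ w 0 := cdf.contDiffAt_implicitFunction (by simp) if₂
  have wd : fderiv ℝ w 0 = 0 := by
    have := (cdf.hasStrictFDerivAt_implicitFunction (by simp) if₂).hasFDerivAt.fderiv
    rw [show ((0 : R2 × ℝ).1) = 0 from rfl] at this
    rw [hw, this]
    have h2 : fderiv ℝ f 0 ∘L .inl ℝ R2 ℝ = 0 := by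
      ext v
      simp [hDf0]
    rw [h2]; simp
  have wz : ∀ᶠ y in 𝓝 (0 : R2), f (y, w y) = 0 := by
    simpa [hf0] using cdf.eventually_apply_implicitFunction (by simp) if₂
  -- a globally smooth function which agrees with `w` near the origin
  obtain ⟨u, hus, huw⟩ : ∃ u : R2 → ℝ, ContDiff ℝ 1 u ∧ u =ᶠ[𝓝 0] w := by
    obtain ⟨s, hs, hws⟩ := (ws.of_le (m := 1) (by exact_mod_cast le_top)).eventually (by simp)
      |>.exists_mem
    obtain ⟨r, hr, hrs⟩ := Metric.mem_nhds_iff.1 hs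
    let b : ContDiffBump (0 : R2) := ⟨r / 3, r / 2, by positivity, by linarith⟩
    refine ⟨fun y => b y * w y, ?_, ?_⟩
    · rw [contDiff_iff_contDiffAt]
      intro y
      by_cases hy : y ∈ Metric.ball (0 : R2) r
      · exact b.contDiff.contDiffAt.mul (hws y (hrs hy))
      · have : (fun y => b y * w y) =ᶠ[𝓝 y] fun _ => 0 := by
          have hy' : y ∈ (Metric.closedBall (0 : R2) (r / 2))ᶜ := by
            simp only [Metric.mem_ball, mem_compl_iff, Metric.mem_closedBall] at hy ⊢
            linarith
          filter_upwards [Metric.isClosed_closedBall.isOpen_compl.mem_nhds hy'] with z hz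
          have : b z = 0 := b.zero_of_le_dist (by
            simp only [mem_compl_iff, Metric.mem_closedBall, not_le] at hz; exact hz.le)
          simp [this]
        exact contDiffAt_const.congr_of_eventuallyEq this
    · filter_upwards [b.eventuallyEq_one] with y hy
      simp [hy]
  have u0 : u 0 = 0 := huw.eq_of_nhds.trans w0
  have ud : fderiv ℝ u 0 = 0 := huw.fderiv_eq.trans wd
  refine ⟨u, hus, u0, ud, ?_⟩
  have hcont : ContinuousAt (chart x₀ L) 0 := (contDiff_chart x₀ L (k := 0)).continuous.continuousAt
  have hDfc : Continuous fun p => fderiv ℝ f p (0, 1) :=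
    (hfs.continuous_fderiv (by simp)).clm_apply continuous_const
  have hnc : ContinuousAt (fun z => ‖gradient ρ z‖⁻¹ • gradient ρ z) x₀ := by
    have := h.continuous_gradient.continuousAt (x := x₀)
    exact (this.norm.inv₀ hg.ne').smul this
  have ev1 : ∀ᶠ p in 𝓝 (0 : R2 × ℝ), 0 < fderiv ℝ f p (0, 1) :=
    hDfc.continuousAt.eventually (lt_mem_nhds (by
      show 0 < fderiv ℝ f 0 (0, 1)
      rw [hDf0]; simpa using h.gradient_ne))
  have ev2 : ∀ᶠ z in 𝓝 x₀,
      ‖‖gradient ρ z‖⁻¹ • gradient ρ z - ‖gradient ρ x₀‖⁻¹ • gradient ρ x₀‖ < ε := by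
    have := (hnc.sub_const (‖gradient ρ x₀‖⁻¹ • gradient ρ x₀)).norm
    exact this.eventually (gt_mem_nhds (by simpa using hε))
  have hcont' := hcont.tendsto
  rw [hc0] at hcont'
  have ev3 := ev1.and (hcont'.eventually (ev2.and h.eventually_mem_frontier_iff))
  rw [show (0 : R2 × ℝ) = ((0 : R2), (0 : ℝ)) from rfl, nhds_prod_eq,
    (Metric.nhds_basis_ball.prod (nhds_basis_Ioo_pos (0 : ℝ))).eventually_iff] at ev3
  obtain ⟨⟨r₁, δ⟩, ⟨hr₁, hδ⟩, ev3⟩ := ev3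
  dsimp only at hr₁ hδ
  simp only [zero_sub, zero_add] at ev3
  have ev4 : ∀ᶠ y in 𝓝 (0 : R2), ‖fderiv ℝ u y‖ < ε ∧ u y ∈ Ioo (-δ) δ ∧ f (y, u y) = 0 := by
    refine ((hus.continuous_fderiv (by simp)).norm.continuousAt.eventually
      (gt_mem_nhds (by
        show ‖fderiv ℝ u 0‖ < ε
        rw [ud]; simpa using hε))).and ((hus.continuous.continuousAt.eventually
      (Ioo_mem_nhds (by rw [u0]; linarith) (by rw [u0]; linarith))).and ?_)
    filter_upwards [huw, wz] with y h1 h2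
    rw [h1, h2]
  obtain ⟨r₂, hr₂, ev4⟩ := Metric.eventually_nhds_iff_ball.1 ev4
  refine ⟨min r₁ r₂, lt_min hr₁ hr₂, δ, hδ, fun y hy => ?_, fun y hy s hs => ?_⟩
  · have := ev4 y (Metric.ball_subset_ball (min_le_right _ _) hy)
    exact ⟨this.1.le, this.2.1⟩
  obtain ⟨-, hyδ, hyf⟩ := ev4 y (Metric.ball_subset_ball (min_le_right _ _) hy)
  have hy1 := Metric.ball_subset_ball (min_le_left _ _) hy
  -- The vertical derivative of f is positive in the cylinder, so on each vertical segment f is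
  -- negative below u y, zero at u y and positive above.
  have hmono : StrictMonoOn (fun s => f (y, s)) (Ioo (-δ) δ) := by
    have hd : ∀ s, HasDerivAt (fun s => f (y, s)) (fderiv ℝ f (y, s) (0, 1)) s := by
      intro s
      have h1 : HasFDerivAt f (fderiv ℝ f (y, s)) (y, s) :=
        (hfs.differentiable (by simp) _).hasFDerivAt
      exact h1.comp_hasDerivAt s ((hasDerivAt_const s y).prodMk (hasDerivAt_id s))
    refine strictMonoOn_of_deriv_pos (convex_Ioo _ _)
      (fun s _ => (hd s).continuousAt.continuousWithinAt) fun s hs => ?_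
    rw [interior_Ioo] at hs
    rw [(hd s).deriv]
    exact (ev3 (x := (y, s)) ⟨hy1, hs⟩).1
  obtain ⟨-, h2, h3, h4, h5⟩ := ev3 (x := (y, s)) ⟨hy1, hs⟩
  refine ⟨fun hlt => h3 ?_, fun hlt => h4 ?_, fun heq => ?_⟩
  · have := hmono hs hyδ hlt
    simp only [hyf] at this; exact this
  · have := hmono hyδ hs hlt
    simp only [hyf] at this; exact this
  · have hd := h5 (by rw [heq]; exact hyf)
    refine ⟨hd.mem_frontier, ?_⟩
    rw [hd.normal_eq, h.normal_eq]; exact h2.le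

/-- The graph map has derivative w ↦ (w, 0) at the origin and carries the tangent cone of a disc,
which is the whole plane, into that of the boundary. Derivatives within the boundary are therefore
unique in tangential directions. -/
theorem IsDefiningFunction.mem_tangentConeAt {E : Set R3} {x : R3} {ρ : R3 → ℝ}
    (h : IsDefiningFunction E x ρ) {v : R3} (hv : inner ℝ v (normal E x) = 0) :
    v ∈ tangentConeAt ℝ (frontier E) x := by
  obtain ⟨L, hL⟩ := exists_linearIsometryEquiv _ h.norm_normal
  obtain ⟨u, hu, u0, ud, r, hr, δ, hδ, h1, h2⟩ := h.exists_graph hL one_pos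
  have hG : HasFDerivAt (fun y => chart x L (y, u y))
      (chartLin L ∘L (ContinuousLinearMap.id ℝ R2).prod (0 : R2 →L[ℝ] ℝ)) 0 := by
    have hu' : HasFDerivAt u (0 : R2 →L[ℝ] ℝ) 0 :=
      ud ▸ (hu.differentiable (by simp) 0).hasFDerivAt
    exact (hasFDerivAt_chart x L (0, u 0)).comp (0 : R2) ((hasFDerivAt_id (0 : R2)).prodMk hu')
  have hmap := (hG.hasFDerivWithinAt (s := Metric.ball 0 r)).mapsTo_tangent_cone
  rw [tangentConeAt_of_mem_nhds (Metric.ball_mem_nhds _ hr)] at hmap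
  have hG0 : chart x L (0, u 0) = x := by
    rw [u0]; simp [chart_eq, show ((0 : R2), (0 : ℝ)) = 0 from rfl]
  rw [hG0] at hmap
  obtain ⟨p, rfl⟩ : ∃ p, chartLin L p = v := by
    obtain ⟨q, hq⟩ := L.surjective v
    exact ⟨WithLp.ofLp q, by simpa [chartLin_apply] using hq⟩
  have hp : p.2 = 0 := by
    rw [← hL, ← chartLin_apply, inner_chartLin] at hv
    simpa using hv
  refine tangentConeAt_mono ?_ (?_ : chartLin L p ∈ _)
    (s := (fun y => chart x L (y, u y)) '' Metric.ball 0 r)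
  · rintro _ ⟨y, hy, rfl⟩
    exact ((h2 y hy (u y) (h1 y hy).2).2.2 rfl).1
  · have := hmap (mem_univ p.1)
    have e : p = (p.1, 0) := Prod.ext rfl hp
    rw [e]; exact this

/-! ### Integration over subgraphs -/

theorem integral_fderiv_eq_zero {V : Type*} [NormedAddCommGroup V] [NormedSpace ℝ V]
    [MeasurableSpace V] [BorelSpace V] [FiniteDimensional ℝ V] {μ : Measure V}
    [μ.IsAddHaarMeasure] {ψ : V → ℝ} (hψ : ContDiff ℝ 1 ψ) (hc : HasCompactSupport ψ) (w : V) :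
    ∫ x, fderiv ℝ ψ x w ∂μ = 0 := by
  have hi : Integrable ψ μ := hψ.continuous.integrable_of_hasCompactSupport hc
  have hi' : Integrable (fun x => fderiv ℝ ψ x w) μ :=
    ((hψ.continuous_fderiv (by simp)).clm_apply continuous_const).integrable_of_hasCompactSupport
      (hc.fderiv_apply ℝ w)
  have := integral_mul_fderiv_eq_neg_fderiv_mul_of_integrable (𝕜 := ℝ) (μ := μ)
    (f := fun _ : V => (1 : ℝ)) (g := ψ) (v := w) (by simp) (by simpa using hi') (by simpa using hi)
    (fun x _ => by fun_prop) (fun x _ => hψ.differentiable (by simp) x)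
  simpa using this

/-- The shear of `ℝ² × ℝ` which maps the lower half-space onto a subgraph. -/
def shear {u : R2 → ℝ} (hu : Continuous u) : (R2 × ℝ) ≃ₜ (R2 × ℝ) where
  toFun p := (p.1, u p.1 + p.2)
  invFun p := (p.1, p.2 - u p.1)
  left_inv p := by simp
  right_inv p := by simp
  continuous_toFun := by fun_prop
  continuous_invFun := by fun_prop

theorem measurePreserving_shear {u : R2 → ℝ} (hu : Continuous u) :
    MeasurePreserving (shear hu) (volume : Measure (R2 × ℝ)) volume := by
  refine (MeasurePreserving.id (volume : Measure R2)).skew_product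
    (g := fun y s => u y + s) (μc := (volume : Measure ℝ)) (μd := volume) ?_ ?_
  · exact (by fun_prop : Continuous (fun p : R2 × ℝ => u p.1 + p.2)).measurable
  · exact Filter.Eventually.of_forall fun y => (measurePreserving_add_left volume (u y)).map_eq

theorem integral_lowerHalf_fderiv_horizontal {ψ : R2 × ℝ → ℝ} (hψ : ContDiff ℝ 1 ψ)
    (hc : HasCompactSupport ψ) (w : R2) :
    ∫ p in {p : R2 × ℝ | p.2 ≤ 0}, fderiv ℝ ψ p (w, 0) = 0 := by
  have hi : Integrable (fun p => fderiv ℝ ψ p (w, 0)) :=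
    ((hψ.continuous_fderiv (by simp)).clm_apply continuous_const).integrable_of_hasCompactSupport
      (hc.fderiv_apply ℝ _)
  have hset : {p : R2 × ℝ | p.2 ≤ 0} = univ ×ˢ Iic 0 := by ext; simp
  rw [hset, Measure.volume_eq_prod, ← Measure.prod_restrict, Measure.restrict_univ,
    integral_prod_symm _ (by
      have := hi.integrableOn (s := (univ : Set R2) ×ˢ Iic (0 : ℝ))
      rwa [IntegrableOn, Measure.volume_eq_prod, ← Measure.prod_restrict,
        Measure.restrict_univ] at this)]
  refine integral_eq_zero_of_ae (Filter.Eventually.of_forall fun s => ?_)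
  have hs : ContDiff ℝ 1 fun y => ψ (y, s) := hψ.comp (contDiff_id.prodMk contDiff_const)
  have hcs : HasCompactSupport fun y => ψ (y, s) :=
    hc.comp_isClosedEmbedding (g := fun y : R2 => (y, s)) 
      (Isometry.of_dist_eq fun a b => by simp [Prod.dist_eq]).isClosedEmbedding
  have := integral_fderiv_eq_zero (μ := (volume : Measure R2)) hs hcs w
  refine Eq.trans ?_ this
  refine integral_congr_ae (Filter.Eventually.of_forall fun y => ?_)
  have h1 : HasFDerivAt ψ (fderiv ℝ ψ (y, s)) (y, s) :=
    (hψ.differentiable (by simp) _).hasFDerivAt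
  have h2 := h1.comp y (f := fun y : R2 => (y, s))
    ((hasFDerivAt_id y).prodMk (hasFDerivAt_const s y))
  have h3 : fderiv ℝ (fun y => ψ (y, s)) y = _ := h2.fderiv
  simp [h3]

theorem integral_lowerHalf_fderiv_vertical {ψ : R2 × ℝ → ℝ} (hψ : ContDiff ℝ 1 ψ)
    (hc : HasCompactSupport ψ) {a : R2 → ℝ} (ha : Continuous a) :
    ∫ p in {p : R2 × ℝ | p.2 ≤ 0}, fderiv ℝ ψ p (0, a p.1) = ∫ y, a y * ψ (y, 0) := by
  have hi : Integrable (fun p => fderiv ℝ ψ p (0, a p.1)) := by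
    refine ((hψ.continuous_fderiv (by simp)).clm_apply
      (by fun_prop)).integrable_of_hasCompactSupport ?_
    refine (hc.fderiv ℝ).mono fun p hp => ?_
    simp only [Function.mem_support] at hp ⊢
    exact fun h => hp (by simp [h])
  have hset : {p : R2 × ℝ | p.2 ≤ 0} = univ ×ˢ Iic 0 := by ext; simp
  rw [hset, Measure.volume_eq_prod, setIntegral_prod _ (by
    rw [← Measure.volume_eq_prod]; exact hi.integrableOn), Measure.restrict_univ]
  refine integral_congr_ae (Filter.Eventually.of_forall fun y => ?_)
  have hs : ContDiff ℝ 1 fun s => ψ (y, s) := hψ.comp (contDiff_const.prodMk contDiff_id)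
  have hcs : HasCompactSupport fun s => ψ (y, s) :=
    hc.comp_isClosedEmbedding (g := fun s : ℝ => (y, s)) 
      (Isometry.of_dist_eq fun a b => by simp [Prod.dist_eq]).isClosedEmbedding
  dsimp only
  rw [← hcs.integral_Iic_deriv_eq hs 0, ← integral_const_mul]
  refine integral_congr_ae (Filter.Eventually.of_forall fun s => ?_)
  have h1 : HasFDerivAt ψ (fderiv ℝ ψ (y, s)) (y, s) :=
    (hψ.differentiable (by simp) _).hasFDerivAt
  have h2 := h1.comp_hasDerivAt s ((hasDerivAt_const s y).prodMk (hasDerivAt_id s))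
  have h3 : deriv (fun s => ψ (y, s)) s = _ := h2.deriv
  have h4 : ((0 : R2), a y) = a y • ((0 : R2), (1 : ℝ)) := by simp
  simp only [h3, h4, map_smul, smul_eq_mul]

/-- A volume-preserving shear flattens the graph and splits the derivative in two. The horizontal
part integrates to zero on every horizontal slice. The vertical part has a coefficient constant
along vertical lines, so the fundamental theorem of calculus leaves only the values on the graph. -/
theorem integral_subgraph_fderiv {u : R2 → ℝ} (hu : ContDiff ℝ 1 u) {φ : R2 × ℝ → ℝ}
    (hφ : ContDiff ℝ 1 φ) (hc : HasCompactSupport φ) (v : R2 × ℝ) :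
    ∫ p in {p : R2 × ℝ | p.2 ≤ u p.1}, fderiv ℝ φ p v
      = ∫ y, (v.2 - fderiv ℝ u y v.1) * φ (y, u y) := by
  set τ := shear hu.continuous with hτ
  have hτs : ContDiff ℝ 1 τ := by
    have : (τ : R2 × ℝ → R2 × ℝ) = fun p => (p.1, u p.1 + p.2) := rfl
    rw [this]; fun_prop
  set ψ : R2 × ℝ → ℝ := φ ∘ τ with hψd
  have hψ : ContDiff ℝ 1 ψ := hφ.comp hτs
  have hψc : HasCompactSupport ψ := hc.comp_homeomorph τ
  have hpre : {p : R2 × ℝ | p.2 ≤ 0} = τ ⁻¹' {p | p.2 ≤ u p.1} := by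
    ext p; simp [hτ, shear]
  have hD : ∀ p : R2 × ℝ, fderiv ℝ φ (τ p) v
      = fderiv ℝ ψ p (v.1, 0) + fderiv ℝ ψ p (0, v.2 - fderiv ℝ u p.1 v.1) := by
    intro p
    have h1 : HasFDerivAt φ (fderiv ℝ φ (τ p)) (τ p) :=
      (hφ.differentiable (by simp) _).hasFDerivAt
    have h2 : HasFDerivAt τ ((ContinuousLinearMap.fst ℝ R2 ℝ).prod
        (fderiv ℝ u p.1 ∘L ContinuousLinearMap.fst ℝ R2 ℝ + ContinuousLinearMap.snd ℝ R2 ℝ)) p := by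
      have hu' : HasFDerivAt u (fderiv ℝ u p.1) p.1 :=
        (hu.differentiable (by simp) _).hasFDerivAt
      exact hasFDerivAt_fst.prodMk ((hu'.comp p hasFDerivAt_fst).add hasFDerivAt_snd)
    rw [← map_add, hψd, (h1.comp p h2).fderiv]
    simp
  rw [← (measurePreserving_shear hu.continuous).setIntegral_preimage_emb
    τ.measurableEmbedding, ← hpre]
  simp only [← hτ, hD]
  have ha : Continuous fun y => v.2 - fderiv ℝ u y v.1 :=
    continuous_const.sub ((hu.continuous_fderiv (by simp)).clm_apply continuous_const)
  have hi1 : Integrable (fun p => fderiv ℝ ψ p (v.1, 0)) :=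
    ((hψ.continuous_fderiv (by simp)).clm_apply continuous_const).integrable_of_hasCompactSupport
      (hψc.fderiv_apply ℝ _)
  have hi2 : Integrable (fun p : R2 × ℝ => fderiv ℝ ψ p (0, v.2 - fderiv ℝ u p.1 v.1)) := by
    refine ((hψ.continuous_fderiv (by simp)).clm_apply
      (continuous_const.prodMk (ha.comp continuous_fst))).integrable_of_hasCompactSupport ?_
    refine (hψc.fderiv ℝ).mono fun p hp => ?_
    simp only [Function.mem_support] at hp ⊢
    exact fun h => hp (by simp [h])
  rw [integral_add hi1.integrableOn hi2.integrableOn, integral_lowerHalf_fderiv_horizontal hψ hψc,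
    integral_lowerHalf_fderiv_vertical hψ hψc ha, zero_add]
  simp [hψd, hτ, shear]

/-! ### Comparison of measures -/

/-- The difference s - m is a positive measure, and it gives |f| a mass of at most (c - 1) ∫ |f| dm.
-/
theorem abs_integral_sub_integral_le {α : Type*} [MeasurableSpace α] {m s : Measure α}
    [IsFiniteMeasure m] {c : ℝ} (hc : 0 ≤ c) (h1 : m ≤ s) (h2 : s ≤ ENNReal.ofReal c • m)
    {f : α → ℝ} (hf : Integrable f s) :
    |∫ x, f x ∂s - ∫ x, f x ∂m| ≤ (c - 1) * ∫ x, |f x| ∂m := by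
  have hm : Integrable f m := hf.mono_measure h1
  have hs : s = (s - m) + m := (Measure.sub_add_cancel_of_le h1).symm
  have hd : Integrable f (s - m) := hf.mono_measure Measure.sub_le
  have e1 : ∫ x, f x ∂s = ∫ x, f x ∂(s - m) + ∫ x, f x ∂m := by
    conv_lhs => rw [hs]
    exact integral_add_measure hd hm
  have e2 : ∫ x, |f x| ∂s = ∫ x, |f x| ∂(s - m) + ∫ x, |f x| ∂m := by
    conv_lhs => rw [hs]
    exact integral_add_measure hd.abs hm.abs
  have e3 : ∫ x, |f x| ∂s ≤ c * ∫ x, |f x| ∂m := by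
    have : ∫ x, |f x| ∂s ≤ ∫ x, |f x| ∂(ENNReal.ofReal c • m) :=
      integral_mono_measure h2 (Filter.Eventually.of_forall fun x => abs_nonneg _)
        (hm.abs.smul_measure (by simp))
    rw [integral_smul_measure, ENNReal.toReal_ofReal hc, smul_eq_mul] at this
    exact this
  rw [e1, add_sub_cancel_right]
  have := abs_integral_le_integral_abs (f := f) (μ := s - m)
  linarith

theorem LipschitzOnWith.euclideanHausdorffMeasure_image_le {X Y : Type*} [EMetricSpace X]
    [MeasurableSpace X] [BorelSpace X] [EMetricSpace Y] [MeasurableSpace Y] [BorelSpace Y]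
    {f : X → Y} {K : NNReal} {s : Set X} (h : LipschitzOnWith K f s) :
    (μHE[2] : Measure Y) (f '' s) ≤ (K : ℝ≥0∞) ^ 2 * μHE[2] s := by
  rw [Measure.euclideanHausdorffMeasure_def, Measure.euclideanHausdorffMeasure_def,
    Measure.smul_apply, Measure.smul_apply]
  have := h.hausdorffMeasure_image_le (d := (2 : ℕ)) (by simp)
  simp only [ENNReal.smul_def, smul_eq_mul]
  rw [mul_left_comm]
  gcongr
  simpa using this

/-! ### Surface measure and the Gauss-Green formula in space -/

/-- The surface measure of `∂E`. -/
def surf (E : Set R3) : Measure R3 := (μHE[2] : Measure R3).restrict (frontier E)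

theorem IsSmoothSet.continuousOn_normal {E : Set R3} (hE : IsSmoothSet E) :
    ContinuousOn (normal E) (frontier E) := by
  intro x hx
  obtain ⟨ρ, h⟩ := hE.boundary x hx
  have hc : ContinuousAt (fun z => ‖gradient ρ z‖⁻¹ • gradient ρ z) x := by
    have := h.continuous_gradient.continuousAt (x := x)
    exact (this.norm.inv₀ (norm_ne_zero_iff.2 h.gradient_ne)).smul this
  refine hc.continuousWithinAt.congr_of_eventuallyEq ?_ h.normal_eq
  filter_upwards [h.eventually_mem_frontier_iff.filter_mono nhdsWithin_le_nhds,
    self_mem_nhdsWithin] with y hy hyf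
  refine (hy.2.2 ?_).normal_eq
  rcases lt_trichotomy (ρ y) 0 with h1 | h1 | h1
  · exact absurd (hy.1 h1) (disjoint_left.1 disjoint_interior_frontier.symm hyf)
  · exact h1
  · exact absurd (frontier_subset_closure hyf) (hy.2.1 h1)

theorem IsSmoothSet.aestronglyMeasurable_normal {E : Set R3} (hE : IsSmoothSet E) :
    AEStronglyMeasurable (normal E) (surf E) :=
  hE.continuousOn_normal.aestronglyMeasurable isClosed_frontier.measurableSet

theorem IsSmoothSet.integrable_mul_inner_normal {E : Set R3} (hE : IsSmoothSet E) {φ : R3 → ℝ}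
    (hφ : Integrable φ (surf E)) (v : R3) :
    Integrable (fun x => φ x * inner ℝ v (normal E x)) (surf E) := by
  refine hφ.mul_bdd (c := ‖v‖) ?_ ?_
  · exact (continuous_const.inner continuous_id (𝕜 := ℝ)).comp_aestronglyMeasurable
      hE.aestronglyMeasurable_normal
  · refine (ae_restrict_iff' isClosed_frontier.measurableSet).2
      (Filter.Eventually.of_forall fun x hx => ?_)
    have := norm_inner_le_norm (𝕜 := ℝ) v (normal E x)
    rwa [hE.exists_normal hx, mul_one] at this

/-- Near each of its boundary points a smooth set satisfies the Gauss-Green formula up to an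
arbitrarily small multiple of the total variation. -/
theorem IsDefiningFunction.exists_approx_gaussGreen {E : Set R3} (hE : IsSmoothSet E) {x₀ : R3}
    {ρ : R3 → ℝ} (h : IsDefiningFunction E x₀ ρ) {ε : ℝ} (hε : 0 < ε) (hε1 : ε ≤ 1) :
    ∃ U : Set R3, IsOpen U ∧ x₀ ∈ U ∧ surf E U < ⊤ ∧ ∀ φ : R3 → ℝ, ContDiff ℝ 1 φ →
      HasCompactSupport φ → tsupport φ ⊆ U → Integrable φ (surf E) → ∀ v,
        |(∫ x in closure E, fderiv ℝ φ x v) - ∫ x, φ x * inner ℝ v (normal E x) ∂surf E|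
          ≤ 5 * ε * ‖v‖ * ∫ x, |φ x| ∂surf E := by
  obtain ⟨L, hL⟩ := exists_linearIsometryEquiv _ h.norm_normal
  obtain ⟨u, hu, u0, ud, r, hr, δ, hδ, h1, h2⟩ := h.exists_graph hL hε
  set B : Set R2 := Metric.ball 0 r with hB
  set κ := chartHomeo x₀ L with hκ
  have hκa : ∀ p, κ p = chart x₀ L p := fun p => rfl
  set U : Set R3 := κ '' (B ×ˢ Ioo (-δ) δ) with hU
  set G : R2 → R3 := fun y => chart x₀ L (y, u y) with hG
  have hGc : Continuous G := (contDiff_chart x₀ L (k := 0)).continuous.comp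
    (continuous_id.prodMk hu.continuous)
  have hUo : IsOpen U := κ.isOpenMap _ (Metric.isOpen_ball.prod isOpen_Ioo)
  have hx0 : x₀ ∈ U := ⟨0, ⟨Metric.mem_ball_self hr, by simpa using hδ⟩, by
    rw [hκa]; simp [chart]⟩
  have hGU : ∀ y ∈ B, G y ∈ U := fun y hy => ⟨(y, u y), ⟨hy, (h1 y hy).2⟩, rfl⟩
  have hGF : ∀ y ∈ B, G y ∈ frontier E ∧ ‖normal E (G y) - normal E x₀‖ ≤ ε :=
    fun y hy => (h2 y hy (u y) (h1 y hy).2).2.2 rfl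
  have hFU : ∀ x ∈ U, x ∈ frontier E → ∃ y ∈ B, G y = x := by
    rintro _ ⟨⟨y, s⟩, ⟨hy, hs⟩, rfl⟩ hx
    rcases lt_trichotomy s (u y) with hlt | heq | hlt
    · exact absurd ((h2 y hy s hs).1 hlt) (disjoint_left.1 disjoint_interior_frontier.symm hx)
    · exact ⟨y, hy, by rw [hG, heq]; rfl⟩
    · exact absurd (frontier_subset_closure hx) ((h2 y hy s hs).2.1 hlt)
  have hGdist : ∀ y z, ‖G y - G z‖ ^ 2 = ‖y - z‖ ^ 2 + (u y - u z) ^ 2 := by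
    intro y z
    have : G y - G z = chartLin L (y - z, u y - u z) := by
      simp only [hG, chart_eq, add_sub_add_left_eq_sub, ← map_sub]; rfl
    rw [this, norm_chartLin_sq]
  -- the graph map is almost an isometry
  have hlip : LipschitzOnWith (Real.toNNReal (1 + ε)) G B := by
    refine LipschitzOnWith.of_dist_le_mul fun y hy z hz => ?_
    rw [Real.coe_toNNReal _ (by linarith), dist_eq_norm, dist_eq_norm]
    have hul : |u y - u z| ≤ ε * ‖y - z‖ := by
      have := (convex_ball (0 : R2) r).norm_image_sub_le_of_norm_fderiv_le
        (f := u) (C := ε) (fun w _ => hu.differentiable (by simp) w)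
        (fun w hw => (h1 w hw).1) hz hy
      simpa using this
    refine (sq_le_sq₀ (norm_nonneg _) (by positivity)).1 ?_
    rw [hGdist, ← sq_abs (u y - u z)]
    have := pow_le_pow_left₀ (abs_nonneg _) hul 2
    nlinarith [mul_nonneg hε.le (sq_nonneg ‖y - z‖)]
  have hproj : LipschitzWith 1 (fun x : R3 => (κ.symm x).1) := by
    refine LipschitzWith.of_dist_le_mul fun x z => ?_
    obtain ⟨p, rfl⟩ := κ.surjective x
    obtain ⟨q, rfl⟩ := κ.surjective z
    simp only [Homeomorph.symm_apply_apply, NNReal.coe_one, one_mul, dist_eq_norm]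
    have : κ p - κ q = chartLin L (p - q) := by
      simp only [hκa, chart_eq, add_sub_add_left_eq_sub, ← map_sub]
    rw [this]
    refine (sq_le_sq₀ (norm_nonneg _) (norm_nonneg _)).1 ?_
    rw [norm_chartLin_sq]
    simp only [Prod.fst_sub]
    nlinarith [sq_nonneg (p - q).2]
  have hprojG : ∀ y, (κ.symm (G y)).1 = y := by
    intro y
    rw [show G y = κ (y, u y) from rfl, Homeomorph.symm_apply_apply]
  -- Here m is plane Lebesgue measure pushed onto the graph and s is the surface measure in U. The
  -- projection to the plane inverts the graph map and is 1-Lipschitz, hence m ≤ s. The graph map is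
  -- (1 + ε)-Lipschitz, hence s ≤ (1 + ε)² m.
  set m : Measure R3 := (volume.restrict B).map G with hm
  set s : Measure R3 := (surf E).restrict U with hs
  have hmS : ∀ S, MeasurableSet S → m S = μHE[2] (G ⁻¹' S ∩ B) := by
    intro S hS
    rw [hm, Measure.map_apply hGc.measurable hS, Measure.restrict_apply (hGc.measurable hS),
      EuclideanSpace.euclideanHausdorffMeasure_eq_volume]
  have hsS : ∀ S, MeasurableSet S → s S = μHE[2] (G '' (G ⁻¹' S ∩ B)) := by
    intro S hS
    rw [hs, surf, Measure.restrict_apply hS,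
      Measure.restrict_apply (hS.inter hUo.measurableSet)]
    congr 1
    ext x
    constructor
    · rintro ⟨⟨hxS, hxU⟩, hxF⟩
      obtain ⟨y, hy, rfl⟩ := hFU x hxU hxF
      exact ⟨y, ⟨hxS, hy⟩, rfl⟩
    · rintro ⟨y, ⟨hyS, hy⟩, rfl⟩
      exact ⟨⟨hyS, hGU y hy⟩, (hGF y hy).1⟩
  have hms : m ≤ s := by
    refine Measure.le_intro fun S hS _ => ?_
    rw [hmS S hS, hsS S hS]
    have := LipschitzOnWith.euclideanHausdorffMeasure_image_le
      (hproj.lipschitzOnWith (s := G '' (G ⁻¹' S ∩ B)))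
    rw [image_image] at this
    simpa [hprojG] using this
  have hsm : s ≤ ENNReal.ofReal ((1 + ε) ^ 2) • m := by
    refine Measure.le_intro fun S hS _ => ?_
    rw [Measure.smul_apply, hmS S hS, hsS S hS]
    have := LipschitzOnWith.euclideanHausdorffMeasure_image_le
      (hlip.mono (inter_subset_right (s := G ⁻¹' S)))
    rw [ENNReal.ofReal_pow (by linarith)]
    exact this
  have : IsFiniteMeasure (volume.restrict B) := ⟨by
    rw [Measure.restrict_apply_univ]; exact Metric.isBounded_ball.measure_lt_top⟩
  have hmfin : IsFiniteMeasure m := by rw [hm]; infer_instance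
  refine ⟨U, hUo, hx0, ?_, fun φ hφ hc hsupp hi v => ?_⟩
  · have h3 : surf E U = s univ := by rw [hs, Measure.restrict_apply_univ]
    rw [h3]
    refine (hsm univ).trans_lt ?_
    rw [Measure.smul_apply, smul_eq_mul]
    exact ENNReal.mul_lt_top ENNReal.ofReal_lt_top (measure_lt_top _ _)
  have hφ0 : ∀ x, x ∉ U → φ x = 0 := fun x hx => image_eq_zero_of_notMem_tsupport
    fun h => hx (hsupp h)
  obtain ⟨p, rfl⟩ : ∃ p, chartLin L p = v := by
    obtain ⟨q, hq⟩ := L.surjective v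
    exact ⟨WithLp.ofLp q, by simpa [chartLin_apply] using hq⟩
  have hpn : inner ℝ (chartLin L p) (normal E x₀) = p.2 := by
    rw [← hL, ← chartLin_apply, inner_chartLin]; simp
  have hv2 := norm_chartLin_sq L p
  have hp1 : ‖p.1‖ ≤ ‖chartLin L p‖ :=
    (sq_le_sq₀ (norm_nonneg _) (norm_nonneg _)).1 (by nlinarith [sq_nonneg p.2])
  have hp2 : |p.2| ≤ ‖chartLin L p‖ := by
    refine (sq_le_sq₀ (abs_nonneg _) (norm_nonneg _)).1 ?_
    rw [sq_abs]; nlinarith [sq_nonneg ‖p.1‖]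
  -- the volume integral
  have hvol : (∫ x in closure E, fderiv ℝ φ x (chartLin L p))
      = ∫ y in B, (p.2 - fderiv ℝ u y p.1) * φ (G y) := by
    have hz : ∀ x, x ∉ U → fderiv ℝ φ x (chartLin L p) = 0 := fun x hx => by
      have : fderiv ℝ φ x = 0 := by
        by_contra hne
        exact hx (hsupp (support_fderiv_subset ℝ hne))
      simp [this]
    have e1 : (∫ x in closure E, fderiv ℝ φ x (chartLin L p))
        = ∫ x in κ '' {p | p.2 ≤ u p.1}, fderiv ℝ φ x (chartLin L p) := by
      have hmeas : MeasurableSet {p : R2 × ℝ | p.2 ≤ u p.1} :=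
        (isClosed_le continuous_snd (hu.continuous.comp continuous_fst)).measurableSet
      rw [← integral_indicator isClosed_closure.measurableSet,
        ← integral_indicator (κ.measurableEmbedding.measurableSet_image.2 hmeas)]
      congr 1
      ext x
      by_cases hx : x ∈ U
      · obtain ⟨⟨y, t⟩, ⟨hy, ht⟩, rfl⟩ := hx
        have hiff : κ (y, t) ∈ closure E ↔ κ (y, t) ∈ κ '' {p | p.2 ≤ u p.1} := by
          rw [κ.injective.mem_set_image]
          constructor
          · intro hcl
            by_contra hlt
            exact (h2 y hy t ht).2.1 (not_le.1 hlt) hcl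
          · intro hle
            rcases (show t ≤ u y from hle).lt_or_eq with hlt | heq
            · exact interior_subset_closure ((h2 y hy t ht).1 hlt)
            · exact frontier_subset_closure ((h2 y hy t ht).2.2 heq).1
        by_cases hk : κ (y, t) ∈ closure E
        · rw [indicator_of_mem hk, indicator_of_mem (hiff.1 hk)]
        · rw [indicator_of_notMem hk, indicator_of_notMem (fun h => hk (hiff.2 h))]
      · simp [indicator, hz x hx]
    have hφ' : ContDiff ℝ 1 (φ ∘ κ) := hφ.comp (contDiff_chart x₀ L)
    have e2 := integral_subgraph_fderiv hu hφ' (hc.comp_homeomorph κ) p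
    rw [e1, ← (measurePreserving_chart x₀ L).setIntegral_preimage_emb
      (κ.measurableEmbedding), show chart x₀ L ⁻¹' (κ '' {p | p.2 ≤ u p.1}) = {p | p.2 ≤ u p.1}
        from preimage_image_eq _ κ.injective]
    have e3 : ∀ q, fderiv ℝ φ (chart x₀ L q) (chartLin L p) = fderiv ℝ (φ ∘ κ) q p := by
      intro q
      have h3 : HasFDerivAt φ (fderiv ℝ φ (chart x₀ L q)) (chart x₀ L q) :=
        (hφ.differentiable (by simp) _).hasFDerivAt
      rw [show φ ∘ κ = φ ∘ chart x₀ L from rfl, (h3.comp q (hasFDerivAt_chart x₀ L q)).fderiv]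
      rfl
    simp only [e3]
    rw [e2]
    symm
    refine setIntegral_eq_integral_of_forall_compl_eq_zero fun y hy => ?_
    have : G y ∉ U := by
      rintro ⟨q, ⟨hq, -⟩, hqe⟩
      have := κ.injective (hqe.trans (hκa (y, u y)).symm)
      rw [this] at hq
      exact hy hq
    show (p.2 - fderiv ℝ u y p.1) * φ (G y) = 0
    rw [hφ0 _ this, mul_zero]
  have hφs : ∀ f : R3 → ℝ, (∀ x, x ∉ U → f x = 0) → ∫ x, f x ∂surf E = ∫ x, f x ∂s := by
    intro f hf
    rw [hs, setIntegral_eq_integral_of_forall_compl_eq_zero hf]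
  have hm_int : ∀ f : R3 → ℝ, Continuous f → ∫ x, f x ∂m = ∫ y in B, f (G y) := by
    intro f hf
    rw [hm, integral_map hGc.aemeasurable hf.aestronglyMeasurable]
  have his : Integrable φ s := hi.restrict
  have him : Integrable φ m := his.mono_measure hms
  have hiG : Integrable (fun y => φ (G y)) (volume.restrict B) :=
    (integrable_map_measure hφ.continuous.aestronglyMeasurable hGc.aemeasurable).1 him
  set A : ℝ := ∫ x, |φ x| ∂surf E with hA
  have hmA : ∫ x, |φ x| ∂m ≤ A := by
    rw [hA, hφs (fun x => |φ x|) fun x hx => by simp [hφ0 x hx]]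
    exact integral_mono_measure hms (Filter.Eventually.of_forall fun x => abs_nonneg _) his.abs
  have hcmp := abs_integral_sub_integral_le (by positivity) hms hsm his
  have hcu : Continuous fun y => fderiv ℝ u y p.1 :=
    (hu.continuous_fderiv (by simp)).clm_apply continuous_const
  have hbd : ∀ᵐ y ∂(volume.restrict B), ‖fderiv ℝ u y p.1‖ ≤ ε * ‖p.1‖ := by
    refine (ae_restrict_iff' Metric.isOpen_ball.measurableSet).2
      (Filter.Eventually.of_forall fun y hy => ?_)
    exact (ContinuousLinearMap.le_opNorm _ _).trans
      (mul_le_mul_of_nonneg_right (h1 y hy).1 (norm_nonneg _))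
  have hi3 : Integrable (fun y => fderiv ℝ u y p.1 * φ (G y)) (volume.restrict B) :=
    hiG.bdd_mul hcu.aestronglyMeasurable hbd
  -- The constant 5 collects three errors: ε from the slope of the graph (`t1`), 3ε from the
  -- comparison of measures, where (1 + ε)² - 1 ≤ 3ε uses ε ≤ 1 (`t2`), and ε from the oscillation
  -- of the normal (`t3`).
  have t1 : |∫ y in B, fderiv ℝ u y p.1 * φ (G y)| ≤ ε * ‖p.1‖ * A := by
    calc |∫ y in B, fderiv ℝ u y p.1 * φ (G y)|
        ≤ ∫ y in B, ε * ‖p.1‖ * |φ (G y)| := by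
          rw [← Real.norm_eq_abs]
          refine norm_integral_le_of_norm_le (hiG.abs.const_mul _) ?_
          filter_upwards [hbd] with y hy
          rw [norm_mul]
          exact mul_le_mul_of_nonneg_right hy (abs_nonneg _)
      _ = ε * ‖p.1‖ * ∫ x, |φ x| ∂m := by
          rw [integral_const_mul, hm_int (fun x => |φ x|) hφ.continuous.abs]
      _ ≤ _ := by gcongr
  have t2 : |∫ x, φ x ∂s - ∫ x, φ x ∂m| ≤ 3 * ε * A := by
    refine hcmp.trans ?_
    have : (1 + ε) ^ 2 - 1 ≤ 3 * ε := by nlinarith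
    have h5 : 0 ≤ ∫ x, |φ x| ∂m := integral_nonneg fun x => abs_nonneg _
    calc ((1 + ε) ^ 2 - 1) * ∫ x, |φ x| ∂m ≤ 3 * ε * ∫ x, |φ x| ∂m := by gcongr
      _ ≤ _ := by gcongr
  have hin := hE.integrable_mul_inner_normal hi (chartLin L p)
  have t3 : |∫ x, φ x * inner ℝ (chartLin L p) (normal E x) ∂surf E - p.2 * ∫ x, φ x ∂s|
      ≤ ε * ‖chartLin L p‖ * A := by
    rw [← hφs φ hφ0, ← integral_const_mul, ← integral_sub hin (hi.const_mul _), hA,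
      ← integral_const_mul, ← Real.norm_eq_abs]
    refine norm_integral_le_of_norm_le (hi.abs.const_mul _) ?_
    refine (ae_restrict_iff' isClosed_frontier.measurableSet).2
      (Filter.Eventually.of_forall fun x hx => ?_)
    by_cases hxU : x ∈ U
    · obtain ⟨y, hy, rfl⟩ := hFU x hxU hx
      have : φ (G y) * inner ℝ (chartLin L p) (normal E (G y)) - p.2 * φ (G y)
          = φ (G y) * inner ℝ (chartLin L p) (normal E (G y) - normal E x₀) := by
        rw [inner_sub_right, hpn]; ring
      rw [this, norm_mul, mul_comm, Real.norm_eq_abs (φ (G y))]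
      gcongr
      refine (norm_inner_le_norm _ _).trans ?_
      rw [mul_comm]
      gcongr
      exact (hGF y hy).2
    · simp [hφ0 x hxU]
  have e4 : (∫ y in B, (p.2 - fderiv ℝ u y p.1) * φ (G y))
      = p.2 * ∫ x, φ x ∂m - ∫ y in B, fderiv ℝ u y p.1 * φ (G y) := by
    rw [hm_int φ hφ.continuous, ← integral_const_mul, ← integral_sub (hiG.const_mul _) hi3]
    congr 1
    ext y; ring
  rw [hvol, e4]
  have hA0 : 0 ≤ A := integral_nonneg fun x => abs_nonneg _
  set v := ‖chartLin L p‖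
  have t2' : |p.2 * (∫ x, φ x ∂s - ∫ x, φ x ∂m)| ≤ v * (3 * ε * A) := by
    rw [abs_mul]
    exact mul_le_mul hp2 t2 (abs_nonneg _) (norm_nonneg _)
  have t1' : ε * ‖p.1‖ * A ≤ ε * v * A := by gcongr
  rw [abs_le] at t1 t2' t3 ⊢
  constructor <;> nlinarith [t1.1, t1.2, t2'.1, t2'.2, t3.1, t3.2]

theorem IsSmoothSet.isLocallyFiniteMeasure_surf {E : Set R3} (hE : IsSmoothSet E) :
    IsLocallyFiniteMeasure (surf E) := by
  refine ⟨fun x => ?_⟩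
  by_cases hx : x ∈ frontier E
  · obtain ⟨ρ, h⟩ := hE.boundary x hx
    obtain ⟨U, hU, hxU, hf, -⟩ := h.exists_approx_gaussGreen hE one_pos le_rfl
    exact ⟨U, hU.mem_nhds hxU, hf⟩
  · refine ⟨(frontier E)ᶜ, isClosed_frontier.isOpen_compl.mem_nhds hx, ?_⟩
    rw [surf, Measure.restrict_apply isClosed_frontier.measurableSet.compl]
    simp

/-- A set of finite two-dimensional Hausdorff measure is null for the three-dimensional one. -/
theorem IsSmoothSet.volume_frontier {E : Set R3} (hE : IsSmoothSet E) :
    volume (frontier E) = 0 := by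
  have := hE.isLocallyFiniteMeasure_surf
  refine measure_null_of_locally_null _ fun x _ => ?_
  obtain ⟨U, hxU, hU, hf⟩ := (surf E).exists_isOpen_measure_lt_top x
  refine ⟨frontier E ∩ U, inter_mem_nhdsWithin _ (hU.mem_nhds hxU), ?_⟩
  rw [surf, Measure.restrict_apply hU.measurableSet, inter_comm] at hf
  have := (Measure.euclideanHausdorffMeasure_zero_or_top (show 2 < 3 by norm_num)
    (frontier E ∩ U)).resolve_right hf.ne
  rwa [EuclideanSpace.euclideanHausdorffMeasure_eq_volume] at this

theorem IsSmoothSet.closure_ae_eq {E : Set R3} (hE : IsSmoothSet E) :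
    closure E =ᵐ[volume] E := by
  refine (Filter.EventuallyLE.antisymm (subset_closure.eventuallyLE) ?_).symm
  refine ae_le_set.2 (measure_mono_null ?_ hE.volume_frontier)
  exact fun x hx => ⟨hx.1, fun h => hx.2 (interior_subset h)⟩

/-- A smooth set may contain an arbitrary part of its boundary, so it need not be Borel. It agrees
with its closure up to a null set. -/
theorem IsSmoothSet.nullMeasurableSet {E : Set R3} (hE : IsSmoothSet E) :
    NullMeasurableSet E volume :=
  isClosed_closure.measurableSet.nullMeasurableSet.congr hE.closure_ae_eq

/-- Away from the boundary both integrals vanish: inside E a compactly supported function has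
derivatives of integral zero, outside the closure there is nothing to integrate. -/
theorem IsSmoothSet.exists_local_gaussGreen {E : Set R3} (hE : IsSmoothSet E) {ε : ℝ}
    (hε : 0 < ε) (hε1 : ε ≤ 1) (x : R3) :
    ∃ U : Set R3, IsOpen U ∧ x ∈ U ∧ ∀ φ : R3 → ℝ, ContDiff ℝ 1 φ →
      HasCompactSupport φ → tsupport φ ⊆ U → ∀ v,
        |(∫ x in closure E, fderiv ℝ φ x v) - ∫ x, φ x * inner ℝ v (normal E x) ∂surf E|
          ≤ 5 * ε * ‖v‖ * ∫ x, |φ x| ∂surf E := by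
  have := hE.isLocallyFiniteMeasure_surf
  by_cases hx : x ∈ frontier E
  · obtain ⟨ρ, h⟩ := hE.boundary x hx
    obtain ⟨U, hU, hxU, -, hf⟩ := h.exists_approx_gaussGreen hE hε hε1
    exact ⟨U, hU, hxU, fun φ h1 h2 h3 v =>
      hf φ h1 h2 h3 (h1.continuous.integrable_of_hasCompactSupport h2) v⟩
  have hbd : ∀ φ : R3 → ℝ, tsupport φ ⊆ (frontier E)ᶜ → ∀ v,
      ∫ x, φ x * inner ℝ v (normal E x) ∂surf E = 0 := by
    intro φ hφ v
    refine setIntegral_eq_zero_of_forall_eq_zero fun y hy => ?_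
    rw [image_eq_zero_of_notMem_tsupport fun h => hφ h hy, zero_mul]
  have hnn : ∀ (φ : R3 → ℝ) (v : R3), 0 ≤ 5 * ε * ‖v‖ * ∫ x, |φ x| ∂surf E := fun φ v =>
    mul_nonneg (by positivity) (integral_nonneg fun x => abs_nonneg _)
  have hz : ∀ (φ : R3 → ℝ) (v y : R3), y ∉ tsupport φ → fderiv ℝ φ y v = 0 := by
    intro φ v y hy
    have : fderiv ℝ φ y = 0 := by
      by_contra hne
      exact hy (support_fderiv_subset ℝ hne)
    simp [this]
  by_cases hxi : x ∈ interior E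
  · refine ⟨interior E, isOpen_interior, hxi, fun φ h1 h2 h3 v => ?_⟩
    rw [hbd φ (fun y hy hyf => disjoint_left.1 disjoint_interior_frontier (h3 hy) hyf),
      setIntegral_eq_integral_of_forall_compl_eq_zero (fun y hy => hz φ v y fun hys =>
        hy (interior_subset_closure (h3 hys))), integral_fderiv_eq_zero h1 h2]
    simpa using hnn φ v
  · have hxc : x ∉ closure E := fun h => hx ⟨h, hxi⟩
    refine ⟨(closure E)ᶜ, isClosed_closure.isOpen_compl, hxc, fun φ h1 h2 h3 v => ?_⟩
    rw [hbd φ (fun y hy hyf => h3 hy (frontier_subset_closure hyf)),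
      setIntegral_eq_zero_of_forall_eq_zero (fun y hy => hz φ v y fun hys => h3 hys hy)]
    simpa using hnn φ v

open Manifold in
/-- The Gauss-Green formula for compactly supported functions on `ℝ³`. -/
theorem IsSmoothSet.integral_fderiv_of_hasCompactSupport {E : Set R3} (hE : IsSmoothSet E)
    {φ : R3 → ℝ} (hφ : ContDiff ℝ 1 φ) (hc : HasCompactSupport φ) (v : R3) :
    ∫ x in closure E, fderiv ℝ φ x v = ∫ x, φ x * inner ℝ v (normal E x) ∂surf E := by
  have := hE.isLocallyFiniteMeasure_surf
  set A : ℝ := ∫ x, |φ x| ∂surf E with hA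
  have hA0 : 0 ≤ A := integral_nonneg fun x => abs_nonneg _
  suffices h : ∀ ε > 0, ε ≤ 1 → |(∫ x in closure E, fderiv ℝ φ x v)
      - ∫ x, φ x * inner ℝ v (normal E x) ∂surf E| ≤ 5 * ε * ‖v‖ * A by
    rw [← sub_eq_zero, ← abs_nonpos_iff]
    refine le_of_forall_pos_le_add fun η hη => ?_
    have hM : 0 < 5 * ‖v‖ * A + 1 := by positivity
    refine (h (min 1 (η / (5 * ‖v‖ * A + 1))) (by positivity) (min_le_left _ _)).trans ?_
    have h2 := min_le_right 1 (η / (5 * ‖v‖ * A + 1))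
    rw [le_div_iff₀ hM] at h2
    have : 0 < min 1 (η / (5 * ‖v‖ * A + 1)) := by positivity
    nlinarith
  intro ε hε hε1
  choose U hUo hxU hU using hE.exists_local_gaussGreen hε hε1
  obtain ⟨t, ht⟩ := hc.isCompact.elim_finite_subcover U hUo
    fun x _ => mem_iUnion.2 ⟨x, hxU x⟩
  obtain ⟨f, hf⟩ := SmoothPartitionOfUnity.exists_isSubordinate 𝓘(ℝ, R3) (isClosed_tsupport φ)
    (fun i : t => U i) (fun i => hUo i) (by simpa [iUnion_subtype] using ht)
  have hfs : ∀ i, ContDiff ℝ 1 (f i) := fun i =>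
    ((f i).contMDiff.contDiff).of_le (by exact_mod_cast le_top)
  have hsum : ∀ x, φ x = ∑ i, f i x * φ x := by
    intro x
    rw [← Finset.sum_mul]
    by_cases hx : x ∈ tsupport φ
    · have := f.sum_eq_one hx
      rw [finsum_eq_sum_of_fintype] at this
      rw [this, one_mul]
    · rw [image_eq_zero_of_notMem_tsupport hx, mul_zero]
  set g : t → R3 → ℝ := fun i x => f i x * φ x with hg
  have hgs : ∀ i, ContDiff ℝ 1 (g i) := fun i => (hfs i).mul hφ
  have hgc : ∀ i, HasCompactSupport (g i) := fun i => hc.mul_left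
  have hφg : φ = fun x => ∑ i, g i x := funext hsum
  have hgi : ∀ i, Integrable (g i) (surf E) := fun i =>
    (hgs i).continuous.integrable_of_hasCompactSupport (hgc i)
  have hgd : ∀ i, Integrable (fun x => fderiv ℝ (g i) x v) := fun i =>
    (((hgs i).continuous_fderiv (by simp)).clm_apply
      continuous_const).integrable_of_hasCompactSupport ((hgc i).fderiv_apply ℝ _)
  have e1 : ∫ x in closure E, fderiv ℝ φ x v = ∑ i, ∫ x in closure E, fderiv ℝ (g i) x v := by
    rw [← integral_finsetSum _ fun i _ => (hgd i).integrableOn]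
    congr 1
    ext x
    rw [hφg, fderiv_fun_sum fun i _ => (hgs i).differentiable (by simp) x]
    simp
  have e2 : ∫ x, φ x * inner ℝ v (normal E x) ∂surf E
      = ∑ i, ∫ x, g i x * inner ℝ v (normal E x) ∂surf E := by
    rw [← integral_finsetSum _ fun i _ => hE.integrable_mul_inner_normal (hgi i) v]
    congr 1
    ext x
    conv_lhs => rw [hsum x, Finset.sum_mul]
  -- The weights are nonnegative, so the masses of the pieces add up exactly to that of φ, and the
  -- total error does not depend on how many pieces the cover needs.
  have e3 : A = ∑ i, ∫ x, |g i x| ∂surf E := by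
    rw [← integral_finsetSum _ fun i _ => (hgi i).abs, hA]
    congr 1
    ext x
    have h1 : ∀ i, |g i x| = f i x * |φ x| := fun i => by
      simp only [hg, abs_mul, abs_of_nonneg (f.nonneg i x)]
    simp only [h1]
    conv_lhs => rw [hsum x]
    rw [← Finset.sum_mul, ← Finset.sum_mul, abs_mul, abs_of_nonneg
      (Finset.sum_nonneg fun i _ => f.nonneg i x)]
  rw [e1, e2, e3, ← Finset.sum_sub_distrib, Finset.mul_sum]
  refine (Finset.abs_sum_le_sum_abs _ _).trans (Finset.sum_le_sum fun i _ => ?_)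
  refine hU i (g i) (hgs i) (hgc i) ?_ v
  exact (tsupport_mul_subset_left (f := f i) (g := φ)).trans (hf i)

/-! ### The lattice and its fundamental domain -/

/-- The embedding of `ℤ³` into `ℝ³` as a homomorphism. -/
def latticeHom : (Fin 3 → ℤ) →+ R3 where
  toFun := latticeVec
  map_zero' := by ext; simp [latticeVec]
  map_add' a b := by ext; simp [latticeVec]

theorem latticeVec_apply (m : Fin 3 → ℤ) (i : Fin 3) : latticeVec m i = m i := rfl

theorem latticeVec_add (a b : Fin 3 → ℤ) : latticeVec (a + b) = latticeVec a + latticeVec b :=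
  latticeHom.map_add a b

theorem latticeVec_neg (a : Fin 3 → ℤ) : latticeVec (-a) = -latticeVec a :=
  latticeHom.map_neg a

theorem latticeVec_zero : latticeVec 0 = 0 := latticeHom.map_zero

theorem latticeVec_injective : Function.Injective latticeVec := by
  intro a b h
  funext i
  have := congrArg (fun v : R3 => v i) h
  simpa [latticeVec_apply] using this

/-- The lattice `ℤ³` as a subgroup of `ℝ³`. -/
def lattice : AddSubgroup R3 := latticeHom.range

/-- The parametrization of the lattice by `ℤ³`. -/
def latticeEquiv : (Fin 3 → ℤ) ≃ lattice :=
  (AddMonoidHom.ofInjective (f := latticeHom) latticeVec_injective).toEquiv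

theorem latticeEquiv_vadd (m : Fin 3 → ℤ) (x : R3) : latticeEquiv m +ᵥ x = x + latticeVec m :=
  add_comm _ _

instance : Countable lattice := latticeEquiv.symm.injective.countable

/-- Functions on the torus. -/
def IsPeriodic {α : Type*} (f : R3 → α) : Prop :=
  ∀ (x : R3) (m : Fin 3 → ℤ), f (x + latticeVec m) = f x

theorem measurableSet_unitCell : MeasurableSet unitCell := by
  have : unitCell = ⋂ i, (fun x : R3 => x i) ⁻¹' Ico (0 : ℝ) 1 := by ext; simp [unitCell]
  rw [this]
  exact MeasurableSet.iInter fun i =>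
    (by fun_prop : Continuous fun x : R3 => x i).measurable measurableSet_Ico

/-- The closed unit cell. -/
def closedCell : Set R3 := {x | ∀ i, x i ∈ Icc (0 : ℝ) 1}

theorem unitCell_subset_closedCell : unitCell ⊆ closedCell := fun _ h i => ⟨(h i).1, (h i).2.le⟩

theorem isCompact_closedCell : IsCompact closedCell := by
  have h : IsCompact (univ.pi fun _ : Fin 3 => Icc (0 : ℝ) 1) :=
    isCompact_univ_pi fun _ => isCompact_Icc
  have h2 := h.image (PiLp.continuous_toLp 2 (fun _ : Fin 3 => ℝ))
  convert h2 using 1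
  ext x
  constructor
  · exact fun hx => ⟨WithLp.ofLp x, fun i _ => hx i, rfl⟩
  · rintro ⟨y, hy, rfl⟩ i
    exact hy i (mem_univ i)

theorem exists_unique_translate_mem_unitCell (x : R3) :
    ∃! m : Fin 3 → ℤ, x + latticeVec m ∈ unitCell := by
  refine ⟨fun i => -⌊x i⌋, fun i => ?_, fun m hm => ?_⟩
  · simp only [PiLp.add_apply, latticeVec_apply, Int.cast_neg, mem_Ico]
    constructor
    · linarith [Int.floor_le (x i)]
    · linarith [Int.lt_floor_add_one (x i)]
  · funext i
    have := hm i
    simp only [PiLp.add_apply, latticeVec_apply, mem_Ico] at this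
    have h2 : ⌊x i⌋ = -m i := Int.floor_eq_iff.2 ⟨by push_cast; linarith, by push_cast; linarith⟩
    simp [h2]

theorem exists_translate_mem_unitCell (x : R3) : ∃ m : Fin 3 → ℤ, x + latticeVec m ∈ unitCell :=
  (exists_unique_translate_mem_unitCell x).exists

/-- Besides the unit cell this serves its images under flow maps, in the change of variables on the
torus. -/
theorem isAddFundamentalDomain_of_existsUnique {D : Set R3} {μ : Measure R3}
    (hD : NullMeasurableSet D μ) (h : ∀ x : R3, ∃! m : Fin 3 → ℤ, x + latticeVec m ∈ D) :
    IsAddFundamentalDomain lattice D μ := by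
  refine IsAddFundamentalDomain.mk' hD fun x => ?_
  obtain ⟨m, hm, hu⟩ := h x
  refine ⟨latticeEquiv m, by simpa only [latticeEquiv_vadd] using hm, fun g hg => ?_⟩
  obtain ⟨k, rfl⟩ := latticeEquiv.surjective g
  rw [hu k (by simpa only [latticeEquiv_vadd] using hg)]

theorem isAddFundamentalDomain_unitCell (μ : Measure R3) :
    IsAddFundamentalDomain lattice unitCell μ :=
  isAddFundamentalDomain_of_existsUnique measurableSet_unitCell.nullMeasurableSet
    exists_unique_translate_mem_unitCell

theorem IsPeriodicSet.preimage {E : Set R3} (hE : IsPeriodicSet E) (m : Fin 3 → ℤ) :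
    (fun x => x + latticeVec m) ⁻¹' E = E := by
  ext x; exact hE x m

theorem IsPeriodicSet.frontier {E : Set R3} (hE : IsPeriodicSet E) :
    IsPeriodicSet (frontier E) := by
  intro x m
  have := (Homeomorph.addRight (latticeVec m)).preimage_frontier E
  rw [show (Homeomorph.addRight (latticeVec m)) ⁻¹' E = E from hE.preimage m] at this
  exact (Set.ext_iff.1 this x)

theorem IsPeriodicSet.closure {E : Set R3} (hE : IsPeriodicSet E) :
    IsPeriodicSet (closure E) := by
  intro x m
  have := (Homeomorph.addRight (latticeVec m)).preimage_closure E
  rw [show (Homeomorph.addRight (latticeVec m)) ⁻¹' E = E from hE.preimage m] at this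
  exact (Set.ext_iff.1 this x)

theorem IsPeriodicSet.vaddInvariantMeasure_surf {E : Set R3} (hE : IsPeriodicSet E) :
    VAddInvariantMeasure lattice R3 (surf E) := by
  refine ⟨fun c s hs => ?_⟩
  obtain ⟨m, rfl⟩ := latticeEquiv.surjective c
  simp only [latticeEquiv_vadd]
  have hm : Measurable fun x : R3 => x + latticeVec m := by fun_prop
  rw [surf, Measure.restrict_apply hs, Measure.restrict_apply (hm hs)]
  conv_lhs => rw [← hE.frontier.preimage m, ← preimage_inter]
  exact measure_preimage_add_right _ _ _

/-! ### Unfolding -/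

section Unfolding

variable {μ : Measure R3} [VAddInvariantMeasure lattice R3 μ]

theorem measurePreserving_add_latticeVec (m : Fin 3 → ℤ) :
    MeasurePreserving (fun x => x + latticeVec m) μ μ := by
  have := measurePreserving_vadd (latticeEquiv m) μ
  simpa only [latticeEquiv_vadd] using this

/-- Cut space into translates of the cell and move each back: the periodic factor is unchanged and
only the sum of the translates of η remains. The case c = 1 is used for the cutoff `cellBump`, the
case c = 0 for its derivatives. -/
theorem integral_mul_periodic {η f : R3 → ℝ} (hf : IsPeriodic f) {S : Finset (Fin 3 → ℤ)}
    (hS : ∀ m ∉ S, ∀ x ∈ unitCell, η (x + latticeVec m) = 0) {c : ℝ}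
    (hc : ∀ x ∈ unitCell, ∑ m ∈ S, η (x + latticeVec m) = c)
    (hi : Integrable (fun x => η x * f x) μ) :
    ∫ x, η x * f x ∂μ = c * ∫ x in unitCell, f x ∂μ := by
  rw [(isAddFundamentalDomain_unitCell μ).integral_eq_tsum'' _ hi, ← latticeEquiv.tsum_eq]
  simp only [latticeEquiv_vadd, hf _ _]
  rw [tsum_eq_sum (s := S) fun m hm => setIntegral_eq_zero_of_forall_eq_zero fun x hx => by
    rw [hS m hm x hx, zero_mul]]
  have hI : ∀ m, Integrable (fun x => η (x + latticeVec m) * f x) μ := by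
    intro m
    have := (measurePreserving_add_latticeVec (μ := μ) m).integrable_comp_of_integrable hi
    refine this.congr (Filter.Eventually.of_forall fun x => ?_)
    simp [Function.comp, hf x m]
  rw [← integral_finsetSum _ fun m _ => (hI m).integrableOn, ← integral_const_mul]
  refine setIntegral_congr_fun measurableSet_unitCell fun x hx => ?_
  simp only [← Finset.sum_mul, hc x hx]

end Unfolding

/-! ### A partition of unity made of lattice translates -/

/-- A smooth bump on the line, supported in `[-1, 1]`, whose integer translates sum to `1`. -/
def hat (t : ℝ) : ℝ := Real.smoothTransition (t + 1) - Real.smoothTransition t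

theorem contDiff_hat : ContDiff ℝ ∞ hat := by
  unfold hat
  exact (Real.smoothTransition.contDiff.comp (contDiff_id.add contDiff_const)).sub
    Real.smoothTransition.contDiff

theorem hat_eq_zero_of_one_le {t : ℝ} (h : 1 ≤ t) : hat t = 0 := by
  rw [hat, Real.smoothTransition.one_of_one_le (by linarith),
    Real.smoothTransition.one_of_one_le h, sub_self]

theorem hat_eq_zero_of_le_neg_one {t : ℝ} (h : t ≤ -1) : hat t = 0 := by
  rw [hat, Real.smoothTransition.zero_of_nonpos (by linarith),
    Real.smoothTransition.zero_of_nonpos (by linarith), sub_self]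

/-- The sum telescopes to the smooth transition at t + 2 minus that at t - 2, that is, 1 - 0 in the
given range. -/
theorem sum_hat {t : ℝ} (h1 : -1 ≤ t) (h2 : t ≤ 2) :
    ∑ k ∈ Finset.Icc (-2 : ℤ) 1, hat (t + k) = 1 := by
  have : Finset.Icc (-2 : ℤ) 1 = {-2, -1, 0, 1} := by decide
  rw [this]
  norm_num
  simp only [hat]
  rw [show t + -2 + 1 = t + -1 by ring, show t + 1 + 1 = t + 2 by ring,
    show t + -1 + 1 = t by ring,
    Real.smoothTransition.one_of_one_le (show 1 ≤ t + 2 by linarith),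
    Real.smoothTransition.zero_of_nonpos (show t + -2 ≤ 0 by linarith)]
  linarith

/-- A smooth compactly supported function on `ℝ³` whose lattice translates sum to `1`. -/
def cellBump (x : R3) : ℝ := ∏ i, hat (x i)

/-- The lattice points whose translates of `cellBump` can be nonzero near the unit cell. -/
def cellIndices : Finset (Fin 3 → ℤ) := Fintype.piFinset fun _ => Finset.Icc (-2 : ℤ) 1

theorem contDiff_cellBump : ContDiff ℝ ∞ cellBump := by
  unfold cellBump
  exact contDiff_prod fun i _ => contDiff_hat.comp (by fun_prop)

theorem hasCompactSupport_cellBump : HasCompactSupport cellBump := by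
  have h : IsCompact (univ.pi fun _ : Fin 3 => Icc (-1 : ℝ) 1) :=
    isCompact_univ_pi fun _ => isCompact_Icc
  refine HasCompactSupport.of_support_subset_isCompact
    (h.image (PiLp.continuous_toLp 2 (fun _ : Fin 3 => ℝ))) fun x hx => ?_
  refine ⟨WithLp.ofLp x, fun i _ => ?_, rfl⟩
  have hi : hat (x i) ≠ 0 := Finset.prod_ne_zero_iff.1 hx i (Finset.mem_univ i)
  constructor
  · by_contra! hlt
    exact hi (hat_eq_zero_of_le_neg_one hlt.le)
  · by_contra! hlt
    exact hi (hat_eq_zero_of_one_le hlt.le)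

theorem cellBump_eq_zero {m : Fin 3 → ℤ} (hm : m ∉ cellIndices) {x : R3}
    (hx : ∀ i, x i ∈ Ioo (-1 : ℝ) 2) : cellBump (x + latticeVec m) = 0 := by
  rw [cellIndices, Fintype.mem_piFinset] at hm
  push Not at hm
  obtain ⟨i, hi⟩ := hm
  rw [Finset.mem_Icc, not_and_or, not_le, not_le] at hi
  refine Finset.prod_eq_zero (Finset.mem_univ i) ?_
  have hxi := hx i
  simp only [PiLp.add_apply, latticeVec_apply]
  rcases hi with hi | hi
  · have : (m i : ℝ) ≤ -3 := by exact_mod_cast (by omega : m i ≤ -3)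
    exact hat_eq_zero_of_le_neg_one (by linarith [hxi.2])
  · have : (2 : ℝ) ≤ m i := by exact_mod_cast (by omega : 2 ≤ m i)
    exact hat_eq_zero_of_one_le (by linarith [hxi.1])

theorem sum_cellBump {x : R3} (hx : ∀ i, x i ∈ Ioo (-1 : ℝ) 2) :
    ∑ m ∈ cellIndices, cellBump (x + latticeVec m) = 1 := by
  have := Finset.prod_univ_sum (fun _ : Fin 3 => Finset.Icc (-2 : ℤ) 1)
    (fun i k => hat (x i + k))
  simp only [cellBump, cellIndices, PiLp.add_apply, latticeVec_apply]
  rw [← this]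
  exact Finset.prod_eq_one fun i _ => sum_hat (hx i).1.le (hx i).2.le

/-- An open neighbourhood of the closed unit cell. -/
def bigCell : Set R3 := {x | ∀ i, x i ∈ Ioo (-1 : ℝ) 2}

theorem isOpen_bigCell : IsOpen bigCell := by
  have : bigCell = ⋂ i, (fun x : R3 => x i) ⁻¹' Ioo (-1 : ℝ) 2 := by ext; simp [bigCell]
  rw [this]
  exact isOpen_iInter_of_finite fun i =>
    isOpen_Ioo.preimage (by fun_prop : Continuous fun x : R3 => x i)

theorem closedCell_subset_bigCell : closedCell ⊆ bigCell :=
  fun _ h i => ⟨by linarith [(h i).1], by linarith [(h i).2]⟩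

theorem fderiv_cellBump_translate (m : Fin 3 → ℤ) (x v : R3) :
    fderiv ℝ (fun y => cellBump (y + latticeVec m)) x v
      = fderiv ℝ cellBump (x + latticeVec m) v := by
  rw [fderiv_comp_add_right]

theorem fderiv_cellBump_eq_zero {m : Fin 3 → ℤ} (hm : m ∉ cellIndices) {x : R3}
    (hx : x ∈ bigCell) (v : R3) : fderiv ℝ cellBump (x + latticeVec m) v = 0 := by
  rw [← fderiv_cellBump_translate]
  have : (fun y => cellBump (y + latticeVec m)) =ᶠ[𝓝 x] fun _ => 0 := by
    filter_upwards [isOpen_bigCell.mem_nhds hx] with y hy using cellBump_eq_zero hm hy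
  rw [this.fderiv_eq]; simp

/-- The translates sum to a constant on an open neighbourhood of the closed cell, not merely on the
cell, so the identity can be differentiated. -/
theorem sum_fderiv_cellBump {x : R3} (hx : x ∈ bigCell) (v : R3) :
    ∑ m ∈ cellIndices, fderiv ℝ cellBump (x + latticeVec m) v = 0 := by
  have h1 : (fun y => ∑ m ∈ cellIndices, cellBump (y + latticeVec m)) =ᶠ[𝓝 x] fun _ => 1 := by
    filter_upwards [isOpen_bigCell.mem_nhds hx] with y hy using sum_cellBump hy
  have h2 : fderiv ℝ (fun y => ∑ m ∈ cellIndices, cellBump (y + latticeVec m)) x v = 0 := by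
    rw [h1.fderiv_eq]; simp
  have hd : ∀ m ∈ cellIndices, DifferentiableAt ℝ (fun y => cellBump (y + latticeVec m)) x :=
    fun m _ => (contDiff_cellBump.comp (contDiff_id.add contDiff_const)).differentiable (by simp) x
  rw [fderiv_fun_sum hd] at h2
  simpa only [sum_apply, fderiv_cellBump_translate] using h2

theorem integral_cellBump_mul {μ : Measure R3} [VAddInvariantMeasure lattice R3 μ] {f : R3 → ℝ}
    (hf : IsPeriodic f) (hi : Integrable (fun x => cellBump x * f x) μ) :
    ∫ x, cellBump x * f x ∂μ = ∫ x in unitCell, f x ∂μ := by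
  have h := fun x hx => closedCell_subset_bigCell (unitCell_subset_closedCell (a := x) hx)
  rw [integral_mul_periodic hf (S := cellIndices) (fun m hm x hx => cellBump_eq_zero hm (h x hx))
    (fun x hx => sum_cellBump (h x hx)) hi, one_mul]

theorem integral_fderiv_cellBump_mul {μ : Measure R3} [VAddInvariantMeasure lattice R3 μ]
    {f : R3 → ℝ} (hf : IsPeriodic f) (v : R3)
    (hi : Integrable (fun x => fderiv ℝ cellBump x v * f x) μ) :
    ∫ x, fderiv ℝ cellBump x v * f x ∂μ = 0 := by
  have h := fun x hx => closedCell_subset_bigCell (unitCell_subset_closedCell (a := x) hx)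
  rw [integral_mul_periodic hf (S := cellIndices) (η := fun x => fderiv ℝ cellBump x v)
    (fun m hm x hx => fderiv_cellBump_eq_zero hm (h x hx) v)
    (fun x hx => sum_fderiv_cellBump (h x hx) v) hi, zero_mul]

/-! ### The Gauss-Green formula on the torus -/

theorem boundaryIntegral_eq (E : Set R3) (f : R3 → ℝ) :
    boundaryIntegral E f = ∫ x in unitCell, f x ∂surf E := by
  rw [boundaryIntegral, surf, Measure.restrict_restrict measurableSet_unitCell, inter_comm]

theorem boundaryIntegrable_iff (E : Set R3) (f : R3 → ℝ) :
    BoundaryIntegrable E f ↔ IntegrableOn f unitCell (surf E) := by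
  rw [BoundaryIntegrable, IntegrableOn, IntegrableOn, surf,
    Measure.restrict_restrict measurableSet_unitCell, inter_comm]

theorem boundaryIntegral_congr {E : Set R3} {f g : R3 → ℝ} (h : EqOn f g (frontier E)) :
    boundaryIntegral E f = boundaryIntegral E g :=
  setIntegral_congr_fun (isClosed_frontier.measurableSet.inter measurableSet_unitCell)
    fun _ hx => h hx.1

theorem IsSmoothSet.surf_unitCell_lt_top {E : Set R3} (hE : IsSmoothSet E) :
    surf E unitCell < ⊤ := by
  have := hE.isLocallyFiniteMeasure_surf
  exact (measure_mono unitCell_subset_closedCell).trans_lt isCompact_closedCell.measure_lt_top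

theorem IsSmoothSet.boundaryIntegrable {E : Set R3} (hE : IsSmoothSet E) {f : R3 → ℝ}
    (hf : ContinuousOn f (frontier E)) : BoundaryIntegrable E f := by
  rw [boundaryIntegrable_iff]
  have hK : IsCompact (frontier E ∩ closedCell) := isCompact_closedCell.inter_left isClosed_frontier
  obtain ⟨C, hC⟩ := hK.exists_bound_of_continuousOn (hf.mono inter_subset_left)
  have hm : AEStronglyMeasurable f (surf E) :=
    hf.aestronglyMeasurable isClosed_frontier.measurableSet
  refine Measure.integrableOn_of_bounded hE.surf_unitCell_lt_top.ne hm (M := C) ?_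
  rw [surf, Measure.restrict_restrict measurableSet_unitCell]
  refine (ae_restrict_iff' (measurableSet_unitCell.inter isClosed_frontier.measurableSet)).2
    (Filter.Eventually.of_forall fun x hx => hC x ⟨hx.2, unitCell_subset_closedCell hx.1⟩)

theorem IsOuterNormal.translate {E : Set R3} (hE : IsPeriodicSet E) {x n : R3}
    (h : IsOuterNormal E x n) (m : Fin 3 → ℤ) : IsOuterNormal E (x + latticeVec m) n := by
  obtain ⟨ρ, hρ, rfl⟩ := h
  have hg : gradient (fun y => ρ (y + -latticeVec m)) (x + latticeVec m) = gradient ρ x := by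
    simp only [gradient, fderiv_comp_add_right, add_neg_cancel_right]
  have ht : Filter.Tendsto (fun y : R3 => y + -latticeVec m) (𝓝 (x + latticeVec m)) (𝓝 x) := by
    have : Continuous (fun y : R3 => y + -latticeVec m) := by fun_prop
    simpa using this.tendsto (x + latticeVec m)
  have hmem : ∀ y, y + -latticeVec m ∈ E ↔ y ∈ E := fun y => by
    rw [← latticeVec_neg, hE y]
  refine ⟨fun y => ρ (y + -latticeVec m), ⟨?_, ?_, ?_, ?_, ?_⟩, by rw [hg]⟩
  · exact hρ.smooth.comp (contDiff_id.add contDiff_const)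
  · simpa using hρ.zero
  · rw [hg]; exact hρ.gradient_ne
  · filter_upwards [ht.eventually hρ.inside] with y hy h1 using (hmem y).1 (hy h1)
  · filter_upwards [ht.eventually hρ.outside] with y hy h1 using fun h2 => hy h1 ((hmem y).2 h2)

theorem normal_eq_of_isOuterNormal {E : Set R3} {x n : R3} (h : IsOuterNormal E x n) :
    normal E x = n := by
  obtain ⟨ρ, hρ, rfl⟩ := h
  exact hρ.normal_eq

theorem IsPeriodicSet.normal {E : Set R3} (hE : IsPeriodicSet E) : IsPeriodic (normal E) := by
  intro x m
  by_cases h : ∃ n, IsOuterNormal E x n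
  · obtain ⟨n, hn⟩ := h
    rw [normal_eq_of_isOuterNormal hn, normal_eq_of_isOuterNormal (hn.translate hE m)]
  · have h' : ¬∃ n, IsOuterNormal E (x + latticeVec m) n := by
      rintro ⟨n, hn⟩
      have := hn.translate hE (-m)
      rw [latticeVec_neg, add_neg_cancel_right] at this
      exact h ⟨n, this⟩
    rw [SurfaceDiffusion.normal, dif_neg h', SurfaceDiffusion.normal, dif_neg h]

theorem IsPeriodic.fderiv {V : Type*} [NormedAddCommGroup V] [NormedSpace ℝ V] {f : R3 → V}
    (hf : IsPeriodic f) : IsPeriodic (fderiv ℝ f) := by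
  intro x m
  rw [← fderiv_comp_add_right]
  congr 1
  ext y
  exact hf y m

theorem IsPeriodic.divergence {X : R3 → R3} (hX : IsPeriodic X) :
    IsPeriodic (divergence X) := by
  intro x m
  simp only [SurfaceDiffusion.divergence, hX.fderiv x m]

theorem fderiv_apply_component {V : Type*} [NormedAddCommGroup V] [NormedSpace ℝ V] {X : V → R3}
    {x : V} (hX : DifferentiableAt ℝ X x) (v : V) (i : Fin 3) :
    (fderiv ℝ X x v) i = fderiv ℝ (fun y => X y i) x v := by
  have h := (EuclideanSpace.proj (𝕜 := ℝ) i : R3 →L[ℝ] ℝ).hasFDerivAt.comp x hX.hasFDerivAt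
  have h2 : _root_.fderiv ℝ (fun y => X y i) x = _ := h.fderiv
  rw [h2]; rfl

theorem divergence_eq {X : R3 → R3} {x : R3} (hX : DifferentiableAt ℝ X x) :
    divergence X x = ∑ i, fderiv ℝ (fun y => X y i) x (EuclideanSpace.single i 1) := by
  simp only [divergence, fderiv_apply_component hX]

/-- The **Gauss-Green formula** for smooth subsets of the torus. -/
theorem IsSmoothSet.integral_divergence {E : Set R3} (hE : IsSmoothSet E) {X : R3 → R3}
    (hX : ContDiff ℝ 1 X) (hp : IsPeriodic X) :
    ∫ x in E ∩ unitCell, divergence X x = boundaryIntegral E fun x => inner ℝ (X x) (normal E x) := by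
  have hfin := hE.isLocallyFiniteMeasure_surf
  have hinv := hE.periodic.vaddInvariantMeasure_surf
  have hvol : VAddInvariantMeasure lattice R3 volume := inferInstance
  have hXi : ∀ i, ContDiff ℝ 1 fun x => X x i := fun i => by fun_prop
  have hXd := hX.differentiable (by simp)
  have hη : ContDiff ℝ 1 cellBump := contDiff_cellBump.of_le (by exact_mod_cast le_top)
  have hηd := hη.differentiable (by simp)
  have hdivc : Continuous (divergence X) := by
    have := hX.continuous_fderiv (by simp)
    unfold divergence
    fun_prop
  have hcl := isClosed_closure (s := E).measurableSet
  -- integration against the indicator function of the set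
  have hind : ∀ g : R3 → ℝ, IsPeriodic g → IsPeriodic ((closure E).indicator g) := by
    intro g hg x m
    by_cases hx : x ∈ closure E
    · rw [indicator_of_mem hx, indicator_of_mem ((hE.periodic.closure x m).2 hx), hg]
    · rw [indicator_of_notMem hx, indicator_of_notMem fun h => hx ((hE.periodic.closure x m).1 h)]
  have hmulind : ∀ η g : R3 → ℝ, ∀ x, η x * (closure E).indicator g x
      = (closure E).indicator (fun x => η x * g x) x := fun η g x => by
    by_cases hx : x ∈ closure E <;> simp [hx]
  have hdc : ∀ v, Continuous fun x => fderiv ℝ cellBump x v := fun v =>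
    (hη.continuous_fderiv (by simp)).clm_apply continuous_const
  have hdcs : ∀ v, HasCompactSupport fun x => fderiv ℝ cellBump x v := fun v =>
    hasCompactSupport_cellBump.fderiv_apply ℝ v
  have e1 : ∫ x in E ∩ unitCell, divergence X x
      = ∫ x in closure E, cellBump x * divergence X x := by
    have hi : Integrable (fun x => cellBump x * (closure E).indicator (divergence X) x) := by
      simp only [hmulind]
      exact ((hη.continuous.mul hdivc).integrable_of_hasCompactSupport
        hasCompactSupport_cellBump.mul_right).indicator hcl
    have := integral_cellBump_mul (hind _ hp.divergence) hi
    simp only [hmulind] at this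
    rw [integral_indicator hcl, setIntegral_indicator hcl] at this
    rw [this]
    exact setIntegral_congr_set (by
      rw [inter_comm]
      exact (ae_eq_refl _).inter hE.closure_ae_eq.symm)
  -- The gradient of the cutoff contributes nothing, because its lattice translates sum to zero. So
  -- the cutoff can be moved under the derivative and the formula on ℝ³ applies.
  have e2 : ∀ i, ∫ x in closure E,
      fderiv ℝ cellBump x (EuclideanSpace.single i 1) * X x i = 0 := by
    intro i
    have hi : Integrable (fun x => fderiv ℝ cellBump x (EuclideanSpace.single i 1)
        * (closure E).indicator (fun x => X x i) x) := by
      simp only [hmulind (fun x => fderiv ℝ cellBump x (EuclideanSpace.single i 1))]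
      exact (((hdc _).mul (hXi i).continuous).integrable_of_hasCompactSupport
        (hdcs _).mul_right).indicator hcl
    have := integral_fderiv_cellBump_mul
      (hind (fun x => X x i) fun x m => by simp only [hp x m]) (EuclideanSpace.single i 1) hi
    simp only [hmulind (fun x => fderiv ℝ cellBump x (EuclideanSpace.single i 1))] at this
    rwa [integral_indicator hcl] at this
  have hηX : ∀ i, ContDiff ℝ 1 fun x => cellBump x * X x i := fun i => hη.mul (hXi i)
  have hηXc : ∀ i, HasCompactSupport fun x => cellBump x * X x i := fun i =>
    hasCompactSupport_cellBump.mul_right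
  have e3 : ∀ x, cellBump x * divergence X x
      = ∑ i, (fderiv ℝ (fun y => cellBump y * X y i) x (EuclideanSpace.single i 1)
        - fderiv ℝ cellBump x (EuclideanSpace.single i 1) * X x i) := by
    intro x
    rw [divergence_eq (hXd x), Finset.mul_sum]
    refine Finset.sum_congr rfl fun i _ => ?_
    rw [fderiv_fun_mul (hηd x) ((hXi i).differentiable (by simp) x)]
    simp only [add_apply, smul_apply, smul_eq_mul]
    ring
  have hI1 : ∀ i, Integrable fun x =>
      fderiv ℝ (fun y => cellBump y * X y i) x (EuclideanSpace.single i 1) := fun i =>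
    (((hηX i).continuous_fderiv (by simp)).clm_apply
      continuous_const).integrable_of_hasCompactSupport ((hηXc i).fderiv_apply ℝ _)
  have hI2 : ∀ i, Integrable fun x =>
      fderiv ℝ cellBump x (EuclideanSpace.single i 1) * X x i := fun i =>
    ((hdc _).mul (hXi i).continuous).integrable_of_hasCompactSupport (hdcs _).mul_right
  have hS : ∀ i, Integrable (fun x => cellBump x * X x i) (surf E) := fun i =>
    (hηX i).continuous.integrable_of_hasCompactSupport (hηXc i)
  rw [e1]
  simp only [e3]
  rw [integral_finsetSum Finset.univ fun i _ =>
    (show IntegrableOn (fun x => _ - _) _ _ from ((hI1 i).sub (hI2 i)).integrableOn)]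
  have e4 : ∀ i, ∫ x in closure E,
      (fderiv ℝ (fun y => cellBump y * X y i) x (EuclideanSpace.single i 1)
        - fderiv ℝ cellBump x (EuclideanSpace.single i 1) * X x i)
      = ∫ x, cellBump x * X x i * inner ℝ (EuclideanSpace.single i 1) (normal E x) ∂surf E := by
    intro i
    rw [integral_sub (hI1 i).integrableOn (hI2 i).integrableOn, e2, sub_zero,
      hE.integral_fderiv_of_hasCompactSupport (hηX i) (hηXc i)]
  simp only [e4]
  rw [← integral_finsetSum _ fun i _ => hE.integrable_mul_inner_normal (hS i) _]
  have e5 : ∀ x, ∑ i, cellBump x * X x i * inner ℝ (EuclideanSpace.single i (1 : ℝ)) (normal E x)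
      = cellBump x * inner ℝ (X x) (normal E x) := by
    intro x
    rw [PiLp.inner_apply, Finset.mul_sum]
    refine Finset.sum_congr rfl fun i _ => ?_
    rw [EuclideanSpace.inner_single_left]
    simp
    ring
  rw [boundaryIntegral_eq]
  have hi : Integrable (fun x => cellBump x * inner ℝ (X x) (normal E x)) (surf E) := by
    simp only [← e5]
    exact integrable_finsetSum _ fun i _ => hE.integrable_mul_inner_normal (hS i) _
  simp only [e5]
  exact integral_cellBump_mul (fun x m => by rw [hp x m, hE.periodic.normal x m]) hi

/-! ### The perimeter -/

/-- By Gauss-Green every test field gives the flux ∫ φ · ν, which is at most the area since |φ| ≤ 1,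
and an admissible extension of the normal attains it. -/
theorem IsSmoothSet.perimeter_eq {E : Set R3} (hE : IsSmoothSet E) {N : R3 → R3}
    (hN : IsTestField N) (hν : ∀ x ∈ frontier E, N x = normal E x) :
    perimeter E = ENNReal.ofReal (boundaryIntegral E fun _ => 1) := by
  refine le_antisymm (iSup₂_le fun φ hφ => ?_) ?_
  · rw [hE.integral_divergence hφ.contDiff hφ.periodic]
    refine ENNReal.ofReal_le_ofReal ?_
    rw [boundaryIntegral_eq, boundaryIntegral_eq]
    refine integral_mono_ae ((boundaryIntegrable_iff _ _).1 (hE.boundaryIntegrable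
      (hφ.contDiff.continuous.continuousOn.inner hE.continuousOn_normal)))
      ((boundaryIntegrable_iff _ _).1 (hE.boundaryIntegrable continuousOn_const)) ?_
    refine ae_restrict_of_ae ((ae_restrict_iff' isClosed_frontier.measurableSet).2
      (Filter.Eventually.of_forall fun x hx => ?_))
    refine (real_inner_le_norm _ _).trans ?_
    rw [hE.exists_normal hx, mul_one]
    exact hφ.norm_le x
  · refine le_trans (le_of_eq ?_) (le_iSup₂ (f := fun (φ : R3 → R3) (_ : IsTestField φ) =>
      ENNReal.ofReal (∫ x in E ∩ unitCell, divergence φ x)) N hN)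
    rw [hE.integral_divergence hN.contDiff hN.periodic]
    congr 1
    refine boundaryIntegral_congr fun x hx => ?_
    rw [hν x hx, real_inner_self_eq_norm_sq, hE.exists_normal hx]
    norm_num

theorem IsSmoothSet.J_eq {E : Set R3} (hE : IsSmoothSet E) {N : R3 → R3}
    (hN : IsTestField N) (hν : ∀ x ∈ frontier E, N x = normal E x) :
    J E = boundaryIntegral E fun _ => 1 := by
  rw [J, hE.perimeter_eq hN hν, ENNReal.toReal_ofReal]
  exact integral_nonneg fun _ => zero_le_one

/-! ### Calculus in space-time -/

/-- Space-time. -/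
abbrev ST : Type := ℝ × R3

/-- The directional derivative of a function on space-time. -/
def pd (v : ST) (f : ST → ℝ) : ST → ℝ := fun p => fderiv ℝ f p v

/-- The time direction. -/
def eT : ST := (1, 0)

/-- The coordinate directions of space. -/
def eX (i : Fin 3) : ST := (0, EuclideanSpace.single i 1)

theorem contDiff_pd {f : ST → ℝ} (hf : ContDiff ℝ ∞ f) (v : ST) : ContDiff ℝ ∞ (pd v f) :=
  (hf.fderiv_right (m := ∞) (by simp)).clm_apply contDiff_const

theorem pd_comm {f : ST → ℝ} (hf : ContDiff ℝ ∞ f) (v w : ST) (p : ST) :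
    pd v (pd w f) p = pd w (pd v f) p := by
  have hd : DifferentiableAt ℝ (fderiv ℝ f) p :=
    (hf.fderiv_right (m := ∞) (by simp)).differentiable (by simp) p
  have h1 : ∀ a b : ST, pd a (pd b f) p = fderiv ℝ (fderiv ℝ f) p a b := by
    intro a b
    have : fderiv ℝ (fun q => fderiv ℝ f q b) p = _ :=
      (hd.hasFDerivAt.clm_apply (hasFDerivAt_const b p)).fderiv
    change fderiv ℝ (fun q => fderiv ℝ f q b) p a = _
    rw [this]
    simp
  rw [h1, h1]
  exact (hf.contDiffAt.isSymmSndFDerivAt (by simpa using ENat.LEInfty.out)).eq v w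

theorem pd_add {f g : ST → ℝ} (hf : ContDiff ℝ ∞ f) (hg : ContDiff ℝ ∞ g) (v p : ST) :
    pd v (fun q => f q + g q) p = pd v f p + pd v g p := by
  simp only [pd]
  rw [fderiv_fun_add (hf.differentiable (by simp) p) (hg.differentiable (by simp) p)]
  rfl

theorem pd_sub {f g : ST → ℝ} (hf : ContDiff ℝ ∞ f) (hg : ContDiff ℝ ∞ g) (v p : ST) :
    pd v (fun q => f q - g q) p = pd v f p - pd v g p := by
  simp only [pd]
  rw [fderiv_fun_sub (hf.differentiable (by simp) p) (hg.differentiable (by simp) p)]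
  rfl

theorem pd_neg {f : ST → ℝ} (v p : ST) : pd v (fun q => -f q) p = -pd v f p := by
  simp only [pd]
  rw [fderiv_fun_neg]
  rfl

theorem pd_const (c : ℝ) (v p : ST) : pd v (fun _ => c) p = 0 := by
  simp [pd]

theorem pd_mul {f g : ST → ℝ} (hf : ContDiff ℝ ∞ f) (hg : ContDiff ℝ ∞ g) (v p : ST) :
    pd v (fun q => f q * g q) p = pd v f p * g p + f p * pd v g p := by
  simp only [pd]
  rw [fderiv_fun_mul (hf.differentiable (by simp) p) (hg.differentiable (by simp) p)]
  simp only [add_apply, smul_apply, smul_eq_mul]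
  ring

theorem pd_sum {ι : Type*} {s : Finset ι} {f : ι → ST → ℝ} (hf : ∀ i, ContDiff ℝ ∞ (f i))
    (v p : ST) : pd v (fun q => ∑ i ∈ s, f i q) p = ∑ i ∈ s, pd v (f i) p := by
  simp only [pd]
  rw [fderiv_fun_sum fun i _ => (hf i).differentiable (by simp) p]
  simp

/-- The structural identities of a normal flow hold only on the open set O; this is what allows them
to be differentiated there. -/
theorem pd_congr {O : Set ST} (hO : IsOpen O) {f g : ST → ℝ} (h : EqOn f g O) (v : ST) :
    EqOn (pd v f) (pd v g) O := by
  intro p hp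
  have : f =ᶠ[𝓝 p] g := by
    filter_upwards [hO.mem_nhds hp] with q hq using h hq
  simp only [pd, this.fderiv_eq]

/-- The tangential gradient with respect to the field `N`. -/
def tg (N : Fin 3 → ST → ℝ) (f : ST → ℝ) (i : Fin 3) (p : ST) : ℝ :=
  pd (eX i) f p - N i p * ∑ j, N j p * pd (eX j) f p

/-- The tangential divergence with respect to the field `N`. -/
def tdiv (N Y : Fin 3 → ST → ℝ) (p : ST) : ℝ :=
  ∑ i, pd (eX i) (Y i) p - ∑ i, ∑ j, N i p * N j p * pd (eX j) (Y i) p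

/-- The spatial divergence of the field `N`. -/
def sdiv (N : Fin 3 → ST → ℝ) (p : ST) : ℝ := ∑ i, pd (eX i) (N i) p

/-- The derivative along the space-time field `∂_t + V N`. -/
def nd (N : Fin 3 → ST → ℝ) (V f : ST → ℝ) (p : ST) : ℝ :=
  pd eT f p + V p * ∑ j, N j p * pd (eX j) f p

section Smooth

variable {N Y : Fin 3 → ST → ℝ} {f V : ST → ℝ}

theorem contDiff_tg (hN : ∀ i, ContDiff ℝ ∞ (N i)) (hf : ContDiff ℝ ∞ f) (i : Fin 3) :
    ContDiff ℝ ∞ (tg N f i) :=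
  (contDiff_pd hf _).sub ((hN i).mul (ContDiff.sum fun j _ => (hN j).mul (contDiff_pd hf _)))

theorem contDiff_tdiv (hN : ∀ i, ContDiff ℝ ∞ (N i)) (hY : ∀ i, ContDiff ℝ ∞ (Y i)) :
    ContDiff ℝ ∞ (tdiv N Y) :=
  (ContDiff.sum fun i _ => contDiff_pd (hY i) _).sub (ContDiff.sum fun i _ =>
    ContDiff.sum fun j _ => ((hN i).mul (hN j)).mul (contDiff_pd (hY i) _))

theorem contDiff_sdiv (hN : ∀ i, ContDiff ℝ ∞ (N i)) : ContDiff ℝ ∞ (sdiv N) :=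
  ContDiff.sum fun i _ => contDiff_pd (hN i) _

theorem contDiff_nd (hN : ∀ i, ContDiff ℝ ∞ (N i)) (hV : ContDiff ℝ ∞ V) (hf : ContDiff ℝ ∞ f) :
    ContDiff ℝ ∞ (nd N V f) :=
  (contDiff_pd hf _).add (hV.mul (ContDiff.sum fun j _ => (hN j).mul (contDiff_pd hf _)))

end Smooth

/-- A space-time field `N` of unit normals to the level sets of a function `u`, which move with
normal velocity `V`. -/
structure IsNormalFlow (N : Fin 3 → ST → ℝ) (V u g : ST → ℝ) (O : Set ST) : Prop where
  isOpen : IsOpen O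
  smoothN : ∀ i, ContDiff ℝ ∞ (N i)
  smoothV : ContDiff ℝ ∞ V
  smoothU : ContDiff ℝ ∞ u
  smoothG : ContDiff ℝ ∞ g
  unit : ∀ p ∈ O, ∑ i, N i p ^ 2 = 1
  ne : ∀ p ∈ O, g p ≠ 0
  grad : ∀ i, ∀ p ∈ O, pd (eX i) u p = g p * N i p
  transport : ∀ p ∈ O, pd eT u p = -(V p * g p)

/-! ### Evolution laws along a normal flow -/

namespace IsNormalFlow

variable {N : Fin 3 → ST → ℝ} {V u g : ST → ℝ} {O : Set ST} {p : ST}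

theorem normal_pd (h : IsNormalFlow N V u g O) (hp : p ∈ O) (v : ST) :
    ∑ i, N i p * pd v (N i) p = 0 := by
  have h1 := pd_congr h.isOpen (f := fun p => ∑ i, N i p * N i p) (g := fun _ => 1)
    (fun q hq => by simpa [sq] using h.unit q hq) v hp
  rw [pd_sum (fun i => (h.smoothN i).mul (h.smoothN i)), pd_const] at h1
  simp only [pd_mul (h.smoothN _) (h.smoothN _)] at h1
  have h2 : ∑ i, N i p * pd v (N i) p
      = 1 / 2 * ∑ i, (pd v (N i) p * N i p + N i p * pd v (N i) p) := by
    rw [Finset.mul_sum]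
    exact Finset.sum_congr rfl fun i _ => by ring
  rw [h2, h1, mul_zero]

theorem pd_grad (h : IsNormalFlow N V u g O) (hp : p ∈ O) (v : ST) (i : Fin 3) :
    pd v (pd (eX i) u) p = pd v g p * N i p + g p * pd v (N i) p := by
  rw [pd_congr h.isOpen (h.grad i) v hp, pd_mul h.smoothG (h.smoothN i)]

/-- Symmetry of the spatial Hessian of u, expanded through ∇u = gN. -/
theorem symm (h : IsNormalFlow N V u g O) (hp : p ∈ O) (i j : Fin 3) :
    pd (eX j) g p * N i p + g p * pd (eX j) (N i) p
      = pd (eX i) g p * N j p + g p * pd (eX i) (N j) p := by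
  rw [← h.pd_grad hp, ← h.pd_grad hp, pd_comm h.smoothU]

/-- Equality of the mixed derivatives ∂_t ∂_i u = ∂_i ∂_t u, the right side expanded through ∂_t u =
-Vg. -/
theorem pd_time (h : IsNormalFlow N V u g O) (hp : p ∈ O) (i : Fin 3) :
    pd eT g p * N i p + g p * pd eT (N i) p
      = -(pd (eX i) V p * g p + V p * pd (eX i) g p) := by
  rw [← h.pd_grad hp, pd_comm h.smoothU, pd_congr h.isOpen h.transport _ hp, pd_neg,
    pd_mul h.smoothV h.smoothG]

/-- Contracting `pd_time` with N determines ∂_t g, and contracting `symm` with N expresses g ∂_N N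
through the tangential part of ∇g. After substitution all derivatives of g cancel, and the factor g
is nonzero. -/
theorem nd_normal (h : IsNormalFlow N V u g O) (hp : p ∈ O) (i : Fin 3) :
    nd N V (N i) p = -tg N V i p := by
  have hu := h.unit p hp
  have ht := h.normal_pd hp eT
  have hn := fun j => h.normal_pd hp (eX j)
  have hT := h.pd_time hp
  have hS := h.symm hp
  refine mul_left_cancel₀ (h.ne p hp) ?_
  simp only [nd, tg, Fin.sum_univ_three] at *
  have hgt : pd eT g p = -(g p * (N 0 p * pd (eX 0) V p + N 1 p * pd (eX 1) V p
      + N 2 p * pd (eX 2) V p)) - V p * (N 0 p * pd (eX 0) g p + N 1 p * pd (eX 1) g p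
      + N 2 p * pd (eX 2) g p) := by
    linear_combination N 0 p * hT 0 + N 1 p * hT 1 + N 2 p * hT 2 - pd eT g p * hu - g p * ht
  have hs : g p * (N 0 p * pd (eX 0) (N i) p + N 1 p * pd (eX 1) (N i) p
      + N 2 p * pd (eX 2) (N i) p) = pd (eX i) g p - N i p * (N 0 p * pd (eX 0) g p
      + N 1 p * pd (eX 1) g p + N 2 p * pd (eX 2) g p) := by
    linear_combination N 0 p * hS i 0 + N 1 p * hS i 1 + N 2 p * hS i 2 + g p * hn i
      + pd (eX i) g p * hu
  linear_combination hT i - N i p * hgt + V p * hs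

theorem sum_normal_tg (h : IsNormalFlow N V u g O) (hp : p ∈ O) (f : ST → ℝ) :
    ∑ i, N i p * tg N f i p = 0 := by
  have hu := h.unit p hp
  simp only [tg, Fin.sum_univ_three] at *
  linear_combination -(N 0 p * pd (eX 0) f p + N 1 p * pd (eX 1) f p + N 2 p * pd (eX 2) f p) * hu

theorem sum_normal_pd_tg (h : IsNormalFlow N V u g O) (hp : p ∈ O) {f : ST → ℝ}
    (hf : ContDiff ℝ ∞ f) (v : ST) :
    ∑ i, N i p * pd v (tg N f i) p = -∑ i, pd v (N i) p * tg N f i p := by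
  have h1 := pd_congr h.isOpen (f := fun p => ∑ i, N i p * tg N f i p) (g := fun _ => 0)
    (fun q hq => h.sum_normal_tg hq f) v hp
  have hs := contDiff_tg h.smoothN hf
  rw [pd_sum (fun i => (h.smoothN i).mul (hs i)), pd_const] at h1
  simp only [pd_mul (h.smoothN _) (hs _), Finset.sum_add_distrib] at h1
  linarith

/-- The evolution of the mean curvature along a normal flow. -/
theorem nd_sdiv (h : IsNormalFlow N V u g O) (hp : p ∈ O) :
    nd N V (sdiv N) p = -tdiv N (tg N V) p
      - V p * ∑ i, ∑ j, pd (eX j) (N i) p * pd (eX i) (N j) p := by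
  have hsV := contDiff_tg h.smoothN h.smoothV
  -- Take the divergence of the law for N. Commuting it with the moving derivative leaves ∇V · ∂_N N
  -- and V times the trace of (DN)².
  have h1 : ∀ i, pd (eX i) (nd N V (N i)) p = -pd (eX i) (tg N V i) p := fun i => by
    rw [pd_congr h.isOpen (fun q hq => h.nd_normal hq i) (eX i) hp, pd_neg]
  have h2 : ∀ i, pd (eX i) (nd N V (N i)) p = pd eT (pd (eX i) (N i)) p
      + (pd (eX i) V p * ∑ j, N j p * pd (eX j) (N i) p
        + V p * ∑ j, (pd (eX i) (N j) p * pd (eX j) (N i) p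
          + N j p * pd (eX j) (pd (eX i) (N i)) p)) := by
    intro i
    have hj : ∀ j, ContDiff ℝ ∞ fun q => N j q * pd (eX j) (N i) q := fun j =>
      (h.smoothN j).mul (contDiff_pd (h.smoothN i) _)
    have : nd N V (N i) = fun q => pd eT (N i) q + V q * ∑ j, N j q * pd (eX j) (N i) q := rfl
    rw [this, pd_add (contDiff_pd (h.smoothN i) _) (h.smoothV.mul (ContDiff.sum fun j _ => hj j)),
      pd_mul h.smoothV (ContDiff.sum fun j _ => hj j), pd_sum hj, pd_comm (h.smoothN i)]
    simp only [pd_mul (h.smoothN _) (contDiff_pd (h.smoothN i) _), pd_comm (h.smoothN i) (eX i)]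
  have h3 : ∀ v, pd v (sdiv N) p = ∑ i, pd v (pd (eX i) (N i)) p := fun v =>
    pd_sum (fun i => contDiff_pd (h.smoothN i) _) v p
  have h4 := fun j => h.sum_normal_pd_tg hp h.smoothV (eX j)
  have h5 := fun j => h.normal_pd hp (eX j)
  simp only [h2] at h1
  simp only [nd, h3, tdiv]
  -- Since D_τ V is orthogonal to N throughout O, the derivative can be moved onto N. The result is
  -- exactly the term that cancels ∇V · ∂_N N.
  have h6 : ∑ i, ∑ j, N i p * N j p * pd (eX j) (tg N V i) p
      = -∑ i, (∑ j, N j p * pd (eX j) (N i) p) * pd (eX i) V p := by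
    have : ∑ i, ∑ j, N i p * N j p * pd (eX j) (tg N V i) p
        = ∑ j, N j p * ∑ i, N i p * pd (eX j) (tg N V i) p := by
      rw [Finset.sum_comm]
      refine Finset.sum_congr rfl fun j _ => ?_
      rw [Finset.mul_sum]
      exact Finset.sum_congr rfl fun i _ => by ring
    rw [this]
    simp only [h4]
    simp only [tg, Fin.sum_univ_three] at *
    linear_combination (N 0 p * pd (eX 0) V p + N 1 p * pd (eX 1) V p + N 2 p * pd (eX 2) V p) *
      (N 0 p * h5 0 + N 1 p * h5 1 + N 2 p * h5 2)
  rw [h6]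
  simp only [Fin.sum_univ_three] at *
  linear_combination h1 0 + h1 1 + h1 2

/-- The evolution of the squared length of the tangential gradient of `f`. -/
theorem nd_half_sq_tg (h : IsNormalFlow N V u g O) (hp : p ∈ O) {f : ST → ℝ}
    (hf : ContDiff ℝ ∞ f) :
    nd N V (fun q => 1 / 2 * ∑ i, tg N f i q ^ 2) p
      = ∑ i, tg N f i p * tg N (nd N V f) i p
        - V p * ∑ i, ∑ j, pd (eX i) (N j) p * tg N f i p * tg N f j p := by
  have hs := contDiff_tg h.smoothN hf
  have hσs : ContDiff ℝ ∞ fun q => ∑ j, N j q * pd (eX j) f q :=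
    ContDiff.sum fun j _ => (h.smoothN j).mul (contDiff_pd hf _)
  have h1 : ∀ v, pd v (fun q => 1 / 2 * ∑ i, tg N f i q ^ 2) p
      = ∑ i, tg N f i p * pd v (tg N f i) p := by
    intro v
    have hsq : ∀ i, ContDiff ℝ ∞ fun q => tg N f i q ^ 2 := fun i => (hs i).pow 2
    rw [pd_mul contDiff_const (ContDiff.sum fun i _ => hsq i), pd_const, pd_sum hsq]
    simp only [sq, pd_mul (hs _) (hs _), Finset.mul_sum, zero_mul,
      Finset.sum_const_zero, zero_add]
    exact Finset.sum_congr rfl fun i _ => by ring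
  have h2 : ∀ v i, pd v (tg N f i) p = pd v (pd (eX i) f) p
      - (pd v (N i) p * (∑ j, N j p * pd (eX j) f p)
        + N i p * pd v (fun q => ∑ j, N j q * pd (eX j) f q) p) := by
    intro v i
    rw [← pd_mul (h.smoothN i) hσs, ← pd_sub (contDiff_pd hf _) ((h.smoothN i).mul hσs)]
    rfl
  have h3 : ∀ i, pd (eX i) (nd N V f) p = pd eT (pd (eX i) f) p
      + (pd (eX i) V p * (∑ j, N j p * pd (eX j) f p)
        + V p * ∑ j, (pd (eX i) (N j) p * pd (eX j) f p
          + N j p * pd (eX j) (pd (eX i) f) p)) := by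
    intro i
    have hj : ∀ j, ContDiff ℝ ∞ fun q => N j q * pd (eX j) f q := fun j =>
      (h.smoothN j).mul (contDiff_pd hf _)
    have : nd N V f = fun q => pd eT f q + V q * ∑ j, N j q * pd (eX j) f q := rfl
    rw [this, pd_add (contDiff_pd hf _) (h.smoothV.mul hσs), pd_mul h.smoothV hσs, pd_sum hj,
      pd_comm hf]
    simp only [pd_mul (h.smoothN _) (contDiff_pd hf _), pd_comm hf (eX i)]
  have h4 := fun i => h.nd_normal hp i
  have h5 := fun j => h.normal_pd hp (eX j)
  have h6 := h.sum_normal_tg hp f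
  have h7 := h.sum_normal_tg hp V
  -- Contraction with the tangential vector D_τ f does not see normal components, so projected
  -- gradients may be replaced by full ones (`e1`, `e2`); in `e3` this holds because N · ∂_i N = 0.
  -- Writing D_τ f = ∇f - σN with σ = N · ∇f, the derivatives of σ drop out, and the term -σ ∂N = σ
  -- D_τ V cancels the one that comes from differentiating V in `nd N V f`.
  have e1 : ∑ i, tg N f i p * tg N (nd N V f) i p
      = ∑ i, tg N f i p * pd (eX i) (nd N V f) p := by
    have : ∑ i, tg N f i p * tg N (nd N V f) i p
        = ∑ i, tg N f i p * pd (eX i) (nd N V f) p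
          - (∑ i, N i p * tg N f i p) * ∑ j, N j p * pd (eX j) (nd N V f) p := by
      rw [Finset.sum_mul, ← Finset.sum_sub_distrib]
      exact Finset.sum_congr rfl fun i _ => by rw [tg.eq_1 N (nd N V f)]; ring
    rw [this, h6, zero_mul, sub_zero]
  have e2 : ∑ i, tg N f i p * tg N V i p = ∑ i, tg N f i p * pd (eX i) V p := by
    have : ∑ i, tg N f i p * tg N V i p
        = ∑ i, tg N f i p * pd (eX i) V p
          - (∑ i, N i p * tg N f i p) * ∑ j, N j p * pd (eX j) V p := by
      rw [Finset.sum_mul, ← Finset.sum_sub_distrib]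
      exact Finset.sum_congr rfl fun i _ => by rw [tg.eq_1 N V]; ring
    rw [this, h6, zero_mul, sub_zero]
  have e3 : ∀ i, ∑ j, pd (eX i) (N j) p * tg N f j p = ∑ j, pd (eX i) (N j) p * pd (eX j) f p := by
    intro i
    have : ∑ j, pd (eX i) (N j) p * tg N f j p = ∑ j, pd (eX i) (N j) p * pd (eX j) f p
        - (∑ j, N j p * pd (eX i) (N j) p) * ∑ j, N j p * pd (eX j) f p := by
      rw [Finset.sum_mul, ← Finset.sum_sub_distrib]
      exact Finset.sum_congr rfl fun j _ => by rw [tg]; ring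
    rw [this, h5, zero_mul, sub_zero]
  rw [e1]
  simp only [nd, h1, h2] at h4 ⊢
  simp only [h3]
  obtain ⟨q, hq⟩ : ∃ q : Fin 3 → ℝ, ∀ i, tg N f i p = q i := ⟨_, fun _ => rfl⟩
  obtain ⟨w, hw⟩ : ∃ w : Fin 3 → ℝ, ∀ i, tg N V i p = w i := ⟨_, fun _ => rfl⟩
  simp only [hq, hw] at *
  simp only [Fin.sum_univ_three] at *
  linear_combination (-(N 0 p * pd (eX 0) f p + N 1 p * pd (eX 1) f p + N 2 p * pd (eX 2) f p)) *
    (q 0 * h4 0 + q 1 * h4 1 + q 2 * h4 2 - e2)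
    - (pd eT (fun q => N 0 q * pd (eX 0) f q + N 1 q * pd (eX 1) f q + N 2 q * pd (eX 2) f q) p
      + V p * (N 0 p * pd (eX 0) (fun q => N 0 q * pd (eX 0) f q + N 1 q * pd (eX 1) f q
        + N 2 q * pd (eX 2) f q) p + N 1 p * pd (eX 1) (fun q => N 0 q * pd (eX 0) f q
        + N 1 q * pd (eX 1) f q + N 2 q * pd (eX 2) f q) p + N 2 p * pd (eX 2) (fun q =>
        N 0 q * pd (eX 0) f q + N 1 q * pd (eX 1) f q + N 2 q * pd (eX 2) f q) p)) * h6
    + V p * (q 0 * e3 0 + q 1 * e3 1 + q 2 * e3 2)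

/-- The trace of the square of the derivative of the normal is the squared length of the second
fundamental form. -/
theorem trace_sq (h : IsNormalFlow N V u g O) (hp : p ∈ O) :
    ∑ i, ∑ j, pd (eX j) (N i) p * pd (eX i) (N j) p = ∑ i, ∑ k, tg N (N k) i p ^ 2 := by
  have hu := h.unit p hp
  have hn := fun j => h.normal_pd hp (eX j)
  have hS := fun i j => h.symm hp i j
  have hg := h.ne p hp
  -- The projected derivative of N is symmetric. By `symm` the antisymmetric part of g DN is built
  -- from products of ∇g and N, which tangential projection in both indices kills; the value index
  -- is already tangential because N · ∂N = 0.
  have ha : ∀ i k, tg N (N k) i p = tg N (N i) k p := by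
    intro i k
    refine mul_left_cancel₀ hg ?_
    have h1 : ∀ l, g p * pd (eX l) (N k) p - g p * pd (eX k) (N l) p
        = pd (eX k) g p * N l p - pd (eX l) g p * N k p := fun l => by linarith [hS k l]
    have h2 : ∀ l, g p * pd (eX l) (N i) p - g p * pd (eX i) (N l) p
        = pd (eX i) g p * N l p - pd (eX l) g p * N i p := fun l => by linarith [hS i l]
    have h3 := h1 i
    simp only [tg, Fin.sum_univ_three] at *
    linear_combination h3 - N i p * (N 0 p * h1 0 + N 1 p * h1 1 + N 2 p * h1 2)
      + N k p * (N 0 p * h2 0 + N 1 p * h2 1 + N 2 p * h2 2)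
      - N i p * g p * hn k + N k p * g p * hn i
      - (N i p * pd (eX k) g p - N k p * pd (eX i) g p) * hu
  have hb : ∑ i, ∑ k, tg N (N k) i p ^ 2 = ∑ i, ∑ k, tg N (N k) i p * tg N (N i) k p :=
    Finset.sum_congr rfl fun i _ => Finset.sum_congr rfl fun k _ => by rw [sq, ← ha i k]
  rw [hb]
  simp only [tg]
  have hM : ∀ i, ∑ k, N k p * pd (eX i) (N k) p = 0 := hn
  obtain ⟨M, hm⟩ : ∃ M : Fin 3 → Fin 3 → ℝ, ∀ i k, pd (eX i) (N k) p = M i k :=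
    ⟨_, fun _ _ => rfl⟩
  simp only [hm] at *
  -- Every term of the expansion except the trace contains a factor Σ_k N_k ∂_j N_k, which vanishes.
  have key : ∑ i, ∑ k, (M i k - N i p * ∑ j, N j p * M j k) * (M k i - N k p * ∑ j, N j p * M j i)
      = ∑ i, ∑ j, M j i * M i j - 2 * ∑ j, (∑ i, N i p * M i j) * (∑ k, N k p * M j k)
        + (∑ k, N k p * ∑ j, N j p * M j k) ^ 2 := by
    simp only [Fin.sum_univ_three]
    ring
  rw [key]
  have hM2 : ∑ k, N k p * ∑ j, N j p * M j k = 0 := by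
    have : ∑ k, N k p * ∑ j, N j p * M j k = ∑ j, N j p * ∑ k, N k p * M j k := by
      simp only [Fin.sum_univ_three]; ring
    rw [this]
    simp [hM]
  rw [hM2]
  simp [hM]

end IsNormalFlow

/-! ### Tangential operators on a time slice -/

/-- A tangential v lies in the tangent cone, where the derivative within the boundary is determined
by the boundary values. Any smooth extension may thus be used, and the undetermined normal part of
`fderivWithin` is never evaluated. -/
theorem fderivWithin_frontier {W : Type*} [NormedAddCommGroup W] [NormedSpace ℝ W] {E : Set R3}
    (hE : IsSmoothSet E) {X X' : R3 → W} (h : ∀ y ∈ frontier E, X y = X' y) {x : R3}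
    (hx : x ∈ frontier E) (hX' : DifferentiableAt ℝ X' x) {v : R3}
    (hv : inner ℝ v (normal E x) = 0) :
    fderivWithin ℝ X (frontier E) x v = fderiv ℝ X' x v := by
  obtain ⟨ρ, hρ⟩ := hE.boundary x hx
  have h1 : HasFDerivWithinAt X (fderiv ℝ X' x) (frontier E) x :=
    hX'.hasFDerivAt.hasFDerivWithinAt.congr h (h x hx)
  exact h1.differentiableWithinAt.hasFDerivWithinAt.unique_on h1 (hρ.mem_tangentConeAt hv)

/-- The spatial vector field with the given space-time components, at time `s`. -/
def vec (Y : Fin 3 → ST → ℝ) (s : ℝ) (x : R3) : R3 := WithLp.toLp 2 fun i => Y i (s, x)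

theorem vec_apply (Y : Fin 3 → ST → ℝ) (s : ℝ) (x : R3) (i : Fin 3) : vec Y s x i = Y i (s, x) :=
  rfl

theorem inner_vec (v : R3) (Y : Fin 3 → ST → ℝ) (s : ℝ) (x : R3) :
    inner ℝ v (vec Y s x) = ∑ i, v i * Y i (s, x) := by
  rw [PiLp.inner_apply]
  exact Finset.sum_congr rfl fun i _ => by simp [vec_apply, mul_comm]

theorem norm_vec_sq (Y : Fin 3 → ST → ℝ) (s : ℝ) (x : R3) :
    ‖vec Y s x‖ ^ 2 = ∑ i, Y i (s, x) ^ 2 := by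
  rw [EuclideanSpace.norm_sq_eq]
  exact Finset.sum_congr rfl fun i _ => by simp [vec_apply]

theorem contDiff_slice {W : Type*} [NormedAddCommGroup W] [NormedSpace ℝ W] {k : ℕ∞ω}
    {F : ST → W} (hF : ContDiff ℝ k F) (s : ℝ) : ContDiff ℝ k fun x => F (s, x) :=
  hF.comp (contDiff_const.prodMk contDiff_id)

theorem contDiff_vec {Y : Fin 3 → ST → ℝ} (hY : ∀ i, ContDiff ℝ ∞ (Y i)) (s : ℝ) :
    ContDiff ℝ ∞ (vec Y s) := by
  rw [contDiff_euclidean]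
  exact fun i => contDiff_slice (hY i) s

theorem fderiv_slice {F : ST → ℝ} (hF : ContDiff ℝ ∞ F) (s : ℝ) (x v : R3) :
    fderiv ℝ (fun y => F (s, y)) x v = ∑ j, v j * pd (eX j) F (s, x) := by
  have h1 : HasFDerivAt F (fderiv ℝ F (s, x)) (s, x) :=
    (hF.differentiable (by simp) _).hasFDerivAt
  have h2 := h1.comp x ((hasFDerivAt_const s x).prodMk (hasFDerivAt_id x))
  have h3 : fderiv ℝ (fun y => F (s, y)) x = _ := h2.fderiv
  have h4 : ((0 : ℝ), v) = ∑ j, v j • eX j := by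
    refine Prod.ext (by simp [eX, Prod.fst_sum]) ?_
    simp only [eX, Prod.snd_sum, Prod.smul_snd]
    ext i
    simp [Finset.sum_apply, Pi.single_apply]
  rw [h3]
  change fderiv ℝ F (s, x) (0, v) = _
  rw [h4, map_sum]
  simp [pd]

theorem fderiv_vec {Y : Fin 3 → ST → ℝ} (hY : ∀ i, ContDiff ℝ ∞ (Y i)) (s : ℝ) (x v : R3)
    (i : Fin 3) : (fderiv ℝ (vec Y s) x v) i = ∑ j, v j * pd (eX j) (Y i) (s, x) := by
  rw [fderiv_apply_component ((contDiff_vec hY s).differentiable (by simp) x)]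
  exact fderiv_slice (hY i) s x v

theorem divergence_vec {Y : Fin 3 → ST → ℝ} (hY : ∀ i, ContDiff ℝ ∞ (Y i)) (s : ℝ) (x : R3) :
    divergence (vec Y s) x = sdiv Y (s, x) := by
  simp only [divergence, fderiv_vec hY, sdiv]
  refine Finset.sum_congr rfl fun i _ => ?_
  simp [PiLp.single_apply]

/-- `E` is a smooth set whose outer unit normal extends to the field `N` at time `s`. -/
structure HasNormalField (E : Set R3) (N : Fin 3 → ST → ℝ) (s : ℝ) : Prop where
  smoothSet : IsSmoothSet E
  smooth : ∀ i, ContDiff ℝ ∞ (N i)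
  normal_eq : ∀ x ∈ frontier E, normal E x = vec N s x

namespace HasNormalField

variable {E : Set R3} {N : Fin 3 → ST → ℝ} {s : ℝ} {x : R3}

theorem sum_sq (h : HasNormalField E N s) (hx : x ∈ frontier E) : ∑ i, N i (s, x) ^ 2 = 1 := by
  rw [← norm_vec_sq, ← h.normal_eq x hx, h.smoothSet.exists_normal hx, one_pow]

theorem inner_tangentialPart (h : HasNormalField E N s) (hx : x ∈ frontier E) (v : R3) :
    inner ℝ (tangentialPart E x v) (normal E x) = 0 := by
  rw [tangentialPart, inner_sub_left, inner_smul_left, real_inner_self_eq_norm_sq,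
    h.smoothSet.exists_normal hx]
  simp

theorem tangentialPart_apply (h : HasNormalField E N s) (hx : x ∈ frontier E) (v : R3)
    (i : Fin 3) : tangentialPart E x v i = v i - (∑ j, v j * N j (s, x)) * N i (s, x) := by
  rw [tangentialPart, h.normal_eq x hx, inner_vec]
  rfl

/-- The tangential projection is self-adjoint, so it can be moved to the test vector and only
tangential derivatives occur. -/
theorem tangentialGradient_eq (h : HasNormalField E N s) {f : R3 → ℝ} {F : ST → ℝ}
    (hF : ContDiff ℝ ∞ F) (hf : ∀ y ∈ frontier E, f y = F (s, y)) (hx : x ∈ frontier E) :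
    tangentialGradient E f x = vec (tg N F) s x := by
  have hself : ∀ a b : R3, inner ℝ (tangentialPart E x a) b = inner ℝ a (tangentialPart E x b) := by
    intro a b
    simp only [tangentialPart, inner_sub_right, inner_smul_right, real_inner_comm b]
    ring
  refine ext_inner_left ℝ fun v => ?_
  rw [real_inner_comm, tangentialGradient, hself, inner_gradientWithin,
    fderivWithin_frontier h.smoothSet hf hx ((contDiff_slice hF s).differentiable (by simp) x)
      (h.inner_tangentialPart hx v), fderiv_slice hF, inner_vec]
  simp only [h.tangentialPart_apply hx, tg, Fin.sum_univ_three]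
  ring

theorem fderivWithin_component (h : HasNormalField E N s) {X : R3 → R3} {Y : Fin 3 → ST → ℝ}
    (hY : ∀ i, ContDiff ℝ ∞ (Y i)) (hX : ∀ y ∈ frontier E, X y = vec Y s y)
    (hx : x ∈ frontier E) (v : R3) (i : Fin 3) :
    (fderivWithin ℝ X (frontier E) x (tangentialPart E x v)) i
      = ∑ j, (v j - (∑ l, v l * N l (s, x)) * N j (s, x)) * pd (eX j) (Y i) (s, x) := by
  rw [fderivWithin_frontier h.smoothSet hX hx ((contDiff_vec hY s).differentiable (by simp) x)
      (h.inner_tangentialPart hx v), fderiv_vec hY]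
  simp only [h.tangentialPart_apply hx]

theorem tangentialDivergence_eq (h : HasNormalField E N s) {X : R3 → R3} {Y : Fin 3 → ST → ℝ}
    (hY : ∀ i, ContDiff ℝ ∞ (Y i)) (hX : ∀ y ∈ frontier E, X y = vec Y s y)
    (hx : x ∈ frontier E) : tangentialDivergence E X x = tdiv N Y (s, x) := by
  -- The trace minus its normal entry is the trace of the derivative composed with the tangential
  -- projection.
  have h1 : tangentialDivergence E X x = ∑ i, (fderivWithin ℝ X (frontier E) x
      (tangentialPart E x (EuclideanSpace.single i 1))) i := by
    have h2 : ∀ i : Fin 3, inner ℝ (EuclideanSpace.single i (1 : ℝ)) (normal E x) = normal E x i := by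
      intro i; simp [EuclideanSpace.inner_single_left]
    simp only [tangentialPart, map_sub, map_smul, PiLp.sub_apply, PiLp.smul_apply, smul_eq_mul,
      h2, Finset.sum_sub_distrib, tangentialDivergence]
    congr 1
  rw [h1]
  simp only [h.fderivWithin_component hY hX hx, tdiv, PiLp.single_apply, Fin.sum_univ_three]
  simp
  ring

/-- The normal part of the divergence of N vanishes, so `sdiv N` can serve as an extension of the
mean curvature off the surface. -/
theorem tdiv_self (hn : ∀ v, ∑ i, N i (s, x) * pd v (N i) (s, x) = 0) :
    tdiv N N (s, x) = sdiv N (s, x) := by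
  have : ∑ i, ∑ j, N i (s, x) * N j (s, x) * pd (eX j) (N i) (s, x)
      = ∑ j, N j (s, x) * ∑ i, N i (s, x) * pd (eX j) (N i) (s, x) := by
    simp only [Fin.sum_univ_three]; ring
  rw [tdiv, this]
  simp [hn, sdiv]

theorem laplaceBeltrami_eq (h : HasNormalField E N s) {f : R3 → ℝ} {F : ST → ℝ}
    (hF : ContDiff ℝ ∞ F) (hf : ∀ y ∈ frontier E, f y = F (s, y)) (hx : x ∈ frontier E) :
    laplaceBeltrami E f x = tdiv N (tg N F) (s, x) :=
  h.tangentialDivergence_eq (contDiff_tg h.smooth hF)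
    (fun _ hy => h.tangentialGradient_eq hF hf hy) hx

theorem meanCurvature_eq (h : HasNormalField E N s)
    (hn : ∀ v, ∑ i, N i (s, x) * pd v (N i) (s, x) = 0) (hx : x ∈ frontier E) :
    meanCurvature E x = sdiv N (s, x) := by
  rw [meanCurvature, h.tangentialDivergence_eq h.smooth h.normal_eq hx, tdiv_self hn]

theorem normSqB_eq (h : HasNormalField E N s) (hx : x ∈ frontier E) :
    normSqB E x = ∑ i, ∑ k, tg N (N k) i (s, x) ^ 2 := by
  rw [normSqB]
  refine Finset.sum_congr rfl fun i _ => ?_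
  rw [EuclideanSpace.norm_sq_eq]
  refine Finset.sum_congr rfl fun k _ => ?_
  rw [tangentialDerivative, h.fderivWithin_component h.smooth h.normal_eq hx, Real.norm_eq_abs,
    sq_abs]
  congr 1
  simp only [tg, PiLp.single_apply, ite_mul, one_mul, zero_mul, Finset.sum_ite_eq',
    Finset.mem_univ, if_true, sub_mul, Finset.sum_sub_distrib, Finset.mul_sum, mul_assoc]

theorem secondFundamentalForm_eq (h : HasNormalField E N s) {Y : Fin 3 → ST → ℝ}
    (hY : ∑ i, N i (s, x) * Y i (s, x) = 0) (hx : x ∈ frontier E) :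
    secondFundamentalForm E x (vec Y s x)
      = ∑ i, ∑ j, pd (eX i) (N j) (s, x) * Y i (s, x) * Y j (s, x) := by
  have hY' : ∑ i, Y i (s, x) * N i (s, x) = 0 := by
    rw [← hY]; exact Finset.sum_congr rfl fun i _ => mul_comm _ _
  rw [secondFundamentalForm, inner_vec, Finset.sum_comm]
  refine Finset.sum_congr rfl fun j _ => ?_
  rw [tangentialDerivative, h.fderivWithin_component h.smooth h.normal_eq hx, Finset.sum_mul]
  refine Finset.sum_congr rfl fun i _ => ?_
  simp only [vec_apply, hY']
  ring

/-- The divergence theorem on the closed surface `∂E`, for tangential fields. -/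
theorem boundaryIntegral_tdiv (h : HasNormalField E N s) (hNp : IsPeriodic (vec N s))
    {Y : Fin 3 → ST → ℝ} (hY : ∀ i, ContDiff ℝ ∞ (Y i)) (hYp : IsPeriodic (vec Y s))
    (hn : ∀ x ∈ frontier E, ∀ v, ∑ i, N i (s, x) * pd v (N i) (s, x) = 0)
    (hYN : ∀ x ∈ frontier E, ∑ i, N i (s, x) * Y i (s, x) = 0) :
    boundaryIntegral E (fun x => tdiv N Y (s, x)) = 0 := by
  -- The field Z is the row-wise divergence of the antisymmetric matrix N ⊗ Y - Y ⊗ N. Hence Z is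
  -- divergence-free, while on ∂E its normal component is the tangential divergence of Y.
  -- Gauss-Green for Z is the claim.
  set A : Fin 3 → Fin 3 → ST → ℝ := fun i j p => N i p * Y j p - N j p * Y i p with hA
  have hAs : ∀ i j, ContDiff ℝ ∞ (A i j) := fun i j =>
    ((h.smooth i).mul (hY j)).sub ((h.smooth j).mul (hY i))
  set Z : Fin 3 → ST → ℝ := fun i p => ∑ j, pd (eX j) (A i j) p with hZ
  have hZs : ∀ i, ContDiff ℝ ∞ (Z i) := fun i => ContDiff.sum fun j _ => contDiff_pd (hAs i j) _
  have hAp : ∀ i j, IsPeriodic fun x => A i j (s, x) := by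
    intro i j x m
    have h1 := fun k => congrArg (fun v : R3 => v k) (hNp x m)
    have h2 := fun k => congrArg (fun v : R3 => v k) (hYp x m)
    simp only [vec_apply] at h1 h2
    simp only [hA, h1, h2]
  have hslice : ∀ i j x, pd (eX j) (A i j) (s, x)
      = fderiv ℝ (fun y => A i j (s, y)) x (EuclideanSpace.single j 1) := by
    intro i j x
    rw [fderiv_slice (hAs i j)]
    simp [PiLp.single_apply]
  have hZp : IsPeriodic (vec Z s) := by
    intro x m
    ext i
    simp only [vec_apply, hZ, hslice, (hAp i _).fderiv x m]
  have hdiv : ∀ x, divergence (vec Z s) x = 0 := by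
    intro x
    have h1 : ∀ i j p, pd (eX i) (pd (eX j) (A i j)) p = -pd (eX j) (pd (eX i) (A j i)) p := by
      intro i j p
      have : pd (eX j) (A j i) = fun q => -pd (eX j) (A i j) q := by
        have hneg : A j i = fun q => -A i j q := by
          funext q; simp [hA]
        rw [hneg]; funext q; exact pd_neg _ _
      rw [pd_comm (hAs j i), this, pd_neg, neg_neg]
    rw [divergence_vec hZs, sdiv]
    simp only [hZ, pd_sum fun j => contDiff_pd (hAs _ j) _]
    have h2 : ∑ i, ∑ j, pd (eX i) (pd (eX j) (A i j)) (s, x)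
        = -∑ i, ∑ j, pd (eX i) (pd (eX j) (A i j)) (s, x) := by
      conv_lhs => rw [Finset.sum_comm]
      rw [← Finset.sum_neg_distrib]
      refine Finset.sum_congr rfl fun i _ => ?_
      rw [← Finset.sum_neg_distrib]
      exact Finset.sum_congr rfl fun j _ => by rw [h1 j i]
    linarith
  have hGG := h.smoothSet.integral_divergence
    ((contDiff_vec hZs s).of_le (by exact_mod_cast le_top)) hZp
  simp only [hdiv, integral_zero] at hGG
  rw [hGG]
  refine boundaryIntegral_congr fun x hx => ?_
  have hu := h.sum_sq hx
  have h1 := hYN x hx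
  have h2 := fun j => hn x hx (eX j)
  rw [h.normal_eq x hx, inner_vec]
  simp only [vec_apply, hZ, hA, pd_sub ((h.smooth _).mul (hY _)) ((h.smooth _).mul (hY _)),
    pd_mul (h.smooth _) (hY _), tdiv, Fin.sum_univ_three] at *
  linear_combination -(pd (eX 0) (Y 0) (s, x) + pd (eX 1) (Y 1) (s, x) + pd (eX 2) (Y 2) (s, x)) * hu
    + (pd (eX 0) (N 0) (s, x) + pd (eX 1) (N 1) (s, x) + pd (eX 2) (N 2) (s, x)) * h1
    - Y 0 (s, x) * h2 0 - Y 1 (s, x) * h2 1 - Y 2 (s, x) * h2 2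

end HasNormalField

/-! ### Periodization -/

theorem exists_finset_latticeVec (R : ℝ) :
    ∃ S : Finset (Fin 3 → ℤ), ∀ m ∉ S, R < ‖latticeVec m‖ := by
  refine ⟨Fintype.piFinset fun _ => Finset.Icc (-⌈R⌉) ⌈R⌉, fun m hm => ?_⟩
  rw [Fintype.mem_piFinset] at hm
  push Not at hm
  obtain ⟨i, hi⟩ := hm
  have h1 : R < |(m i : ℝ)| := by
    by_contra! hle
    refine hi (Finset.mem_Icc.2 (abs_le.1 ?_))
    have : ((|m i| : ℤ) : ℝ) ≤ (⌈R⌉ : ℝ) := by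
      push_cast
      exact hle.trans (Int.le_ceil R)
    exact_mod_cast this
  exact h1.trans_le (by simpa [latticeVec_apply] using PiLp.norm_apply_le (latticeVec m) i)

/-- The sum of all lattice translates of a function. -/
def periodize (w : R3 → ℝ) (x : R3) : ℝ := ∑ᶠ m : Fin 3 → ℤ, w (x + latticeVec m)

theorem isPeriodic_periodize (w : R3 → ℝ) : IsPeriodic (periodize w) := by
  intro x m
  simp only [periodize]
  rw [← finsum_comp_equiv (Equiv.addLeft m) (f := fun k => w (x + latticeVec k))]
  simp [latticeVec_add, add_assoc]

/-- Compact support leaves finitely many relevant translates near x₀. The index 0 is included so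
that the untranslated term can later be singled out as strictly positive. -/
theorem exists_periodize_eq_sum {w : R3 → ℝ} (hw : HasCompactSupport w) (x₀ : R3) :
    ∃ S : Finset (Fin 3 → ℤ), 0 ∈ S ∧ ∀ x ∈ Metric.ball x₀ 1,
      periodize w x = ∑ m ∈ S, w (x + latticeVec m) := by
  obtain ⟨R, hR⟩ := hw.isCompact.isBounded.subset_closedBall 0
  obtain ⟨S, hS⟩ := exists_finset_latticeVec (R + ‖x₀‖ + 1)
  refine ⟨insert 0 S, Finset.mem_insert_self _ _,
    fun x hx => finsum_eq_sum_of_support_subset _ fun m hm => ?_⟩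
  by_contra hmS
  have h1 := hS m fun h => hmS (Finset.mem_coe.2 (Finset.mem_insert_of_mem h))
  have h2 : x + latticeVec m ∈ Metric.closedBall 0 R := hR (subset_tsupport _ hm)
  rw [mem_closedBall_zero_iff] at h2
  rw [Metric.mem_ball, dist_eq_norm] at hx
  have h3 : ‖latticeVec m‖ ≤ ‖x + latticeVec m‖ + ‖x - x₀‖ + ‖x₀‖ := by
    calc ‖latticeVec m‖ = ‖(x + latticeVec m) - (x - x₀) - x₀‖ := by congr 1; abel
      _ ≤ _ := (norm_sub_le _ _).trans (add_le_add_left (norm_sub_le _ _) _)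
  linarith

theorem contDiff_periodize {w : R3 → ℝ} (hw : ContDiff ℝ ∞ w) (hc : HasCompactSupport w) :
    ContDiff ℝ ∞ (periodize w) := by
  rw [contDiff_iff_contDiffAt]
  intro x₀
  obtain ⟨S, -, hS⟩ := exists_periodize_eq_sum hc x₀
  have : ContDiff ℝ ∞ fun x => ∑ m ∈ S, w (x + latticeVec m) :=
    ContDiff.sum fun m _ => hw.comp (contDiff_id.add contDiff_const)
  refine this.contDiffAt.congr_of_eventuallyEq ?_
  filter_upwards [Metric.ball_mem_nhds x₀ one_pos] with x hx using hS x hx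

/-! ### A global defining function -/

/-- Local defining functions on a finite cover of the boundary in the closed cell are added with
nonnegative bumps. Where the bumps act, they all have the same sign pattern relative to E, so
nothing cancels. On the boundary the normal derivative of bρ is b|∇ρ|, positive wherever some bump
is positive. -/
theorem IsSmoothSet.exists_bump_mul {E : Set R3} (hE : IsSmoothSet E) :
    ∃ w : R3 → ℝ, ContDiff ℝ ∞ w ∧ HasCompactSupport w ∧ (∀ x, w x < 0 → x ∈ E) ∧
      (∀ x, 0 < w x → x ∉ E) ∧ (∀ x ∈ frontier E, w x = 0) ∧
      (∀ x ∈ frontier E, 0 ≤ fderiv ℝ w x (normal E x)) ∧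
      ∀ x ∈ frontier E ∩ closedCell, 0 < fderiv ℝ w x (normal E x) := by
  have hK : IsCompact (frontier E ∩ closedCell) := isCompact_closedCell.inter_left isClosed_frontier
  have hloc : ∀ x ∈ frontier E ∩ closedCell, ∃ ρ : R3 → ℝ, ∃ r > 0, ContDiff ℝ ∞ ρ ∧
      ∀ y ∈ Metric.ball x r, (ρ y < 0 → y ∈ interior E) ∧ (0 < ρ y → y ∉ closure E) ∧
        (ρ y = 0 → IsDefiningFunction E y ρ) := by
    intro x hx
    obtain ⟨ρ, h⟩ := hE.boundary x hx.1
    obtain ⟨r, hr, hb⟩ := Metric.eventually_nhds_iff_ball.1 h.eventually_mem_frontier_iff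
    exact ⟨ρ, r, hr, h.smooth, hb⟩
  choose! ρ r hr hρ hb using hloc
  obtain ⟨t, htK, ht⟩ := hK.elim_nhds_subcover (fun x => Metric.ball x (r x / 3))
    fun x hx => Metric.ball_mem_nhds x (by have := hr x hx; positivity)
  have hr' : ∀ x : t, 0 < r x := fun x => hr x (htK x x.2)
  let b : ∀ x : t, ContDiffBump (x : R3) := fun x =>
    ⟨r x / 3, r x / 2, by have := hr' x; positivity, by have := hr' x; linarith⟩
  have hbr : ∀ (x : t) y, b x y ≠ 0 → y ∈ Metric.ball (x : R3) (r x) := by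
    intro x y hy
    by_contra hlt
    refine hy ((b x).zero_of_le_dist ?_)
    rw [Metric.mem_ball, not_lt] at hlt
    exact (by linarith [hr' x] : r x / 2 ≤ r x).trans hlt
  have hbs : ∀ x : t, ContDiff ℝ ∞ fun y => b x y * ρ x y := fun x =>
    (b x).contDiff.mul (hρ x (htK x x.2))
  have hz : ∀ (x : t), ∀ y ∈ frontier E, b x y ≠ 0 → IsDefiningFunction E y (ρ x) := by
    intro x y hy hxy
    obtain ⟨h1, h2, h3⟩ := hb x (htK x x.2) y (hbr x y hxy)
    refine h3 ?_
    rcases lt_trichotomy (ρ x y) 0 with h | h | h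
    · exact absurd (h1 h) (disjoint_left.1 disjoint_interior_frontier.symm hy)
    · exact h
    · exact absurd (frontier_subset_closure hy) (h2 h)
  have hfd : ∀ (x : t), ∀ y ∈ frontier E, ∃ c : ℝ, 0 ≤ c ∧ (b x y ≠ 0 → 0 < c) ∧
      fderiv ℝ (fun z => b x z * ρ x z) y (normal E y) = c := by
    intro x y hy
    refine ⟨_, ?_, ?_, rfl⟩
    all_goals
      rw [fderiv_fun_mul ((b x).contDiff (n := 1) |>.differentiable (by simp) y)
        ((hρ x (htK x x.2)).differentiable (by simp) y)]
      simp only [add_apply, smul_apply, smul_eq_mul]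
    · by_cases hxy : b x y = 0
      -- Outside its ball ρ need not vanish on the boundary. But where the nonnegative bump is zero
      -- it attains its minimum, so its derivative vanishes as well.
      · have hmin : IsLocalMin (b x) y := Filter.Eventually.of_forall fun z => by
          rw [hxy]; exact (b x).nonneg
        rw [hxy, hmin.fderiv_eq_zero]
        simp
      · have hd := hz x y hy hxy
        rw [hd.zero, zero_mul, add_zero, ← inner_gradient, hd.gradient_eq, inner_smul_left,
          real_inner_self_eq_norm_sq, hd.norm_normal]
        have := (b x).nonneg (x := y)
        simp only [conj_trivial]
        positivity
    · intro hxy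
      have hd := hz x y hy hxy
      rw [hd.zero, zero_mul, add_zero, ← inner_gradient, hd.gradient_eq, inner_smul_left,
        real_inner_self_eq_norm_sq, hd.norm_normal]
      have := lt_of_le_of_ne ((b x).nonneg (x := y)) (Ne.symm hxy)
      have := norm_pos_iff.2 hd.gradient_ne
      simp only [conj_trivial]
      positivity
  have hsumd : ∀ y v, fderiv ℝ (fun z => ∑ x : t, b x z * ρ x z) y v
      = ∑ x : t, fderiv ℝ (fun z => b x z * ρ x z) y v := by
    intro y v
    rw [fderiv_fun_sum fun x _ => (hbs x).differentiable (by simp) y]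
    simp
  refine ⟨fun y => ∑ x : t, b x y * ρ x y, ContDiff.sum fun x _ => hbs x, ?_, fun y hy => ?_,
    fun y hy => ?_, fun y hy => ?_, fun y hy => ?_, fun y hy => ?_⟩
  · refine HasCompactSupport.intro (K := ⋃ x ∈ t, Metric.closedBall x (r x))
      (t.isCompact_biUnion fun x _ => isCompact_closedBall _ _) fun y hy => ?_
    refine Finset.sum_eq_zero fun x _ => ?_
    by_cases hxy : b x y = 0
    · rw [hxy, zero_mul]
    · exact absurd (mem_biUnion x.2 (Metric.ball_subset_closedBall (hbr x y hxy))) hy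
  · by_contra hyE
    refine absurd hy (not_lt.2 (Finset.sum_nonneg fun x _ => ?_))
    by_cases hxy : b x y = 0
    · rw [hxy, zero_mul]
    · refine mul_nonneg (b x).nonneg ?_
      by_contra! hlt
      exact hyE (interior_subset ((hb x (htK x x.2) y (hbr x y hxy)).1 hlt))
  · intro hyE
    refine absurd hy (not_lt.2 (Finset.sum_nonpos fun x _ => ?_))
    by_cases hxy : b x y = 0
    · rw [hxy, zero_mul]
    · refine mul_nonpos_of_nonneg_of_nonpos (b x).nonneg ?_
      by_contra! hlt
      exact (hb x (htK x x.2) y (hbr x y hxy)).2.1 hlt (subset_closure hyE)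
  · refine Finset.sum_eq_zero fun x _ => ?_
    by_cases hxy : b x y = 0
    · rw [hxy, zero_mul]
    · rw [(hz x y hy hxy).zero, mul_zero]
  · rw [hsumd]
    refine Finset.sum_nonneg fun x _ => ?_
    obtain ⟨c, hc, -, he⟩ := hfd x y hy
    rw [he]; exact hc
  · rw [hsumd]
    obtain ⟨x, hx, hyx⟩ := mem_iUnion₂.1 (ht hy)
    refine Finset.sum_pos' (fun x _ => ?_) ⟨⟨x, hx⟩, Finset.mem_univ _, ?_⟩
    · obtain ⟨c, hc, -, he⟩ := hfd x y hy.1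
      rw [he]; exact hc
    · obtain ⟨c, -, hc, he⟩ := hfd ⟨x, hx⟩ y hy.1
      rw [he]
      refine hc ?_
      rw [(b ⟨x, hx⟩).one_of_mem_closedBall (Metric.ball_subset_closedBall hyx)]
      exact one_ne_zero

/-- A smooth subset of the torus has a global smooth defining function. -/
theorem IsSmoothSet.exists_definingFunction {E : Set R3} (hE : IsSmoothSet E) :
    ∃ u : R3 → ℝ, ContDiff ℝ ∞ u ∧ IsPeriodic u ∧ ∀ x ∈ frontier E, IsDefiningFunction E x u := by
  obtain ⟨w, hw, hc, hin, hout, h0, hn, hp⟩ := hE.exists_bump_mul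
  have hEm : ∀ x (m : Fin 3 → ℤ), x + latticeVec m ∈ E ↔ x ∈ E := hE.periodic
  have hu := contDiff_periodize hw hc
  refine ⟨periodize w, hu, isPeriodic_periodize w, fun x hx => ⟨hu, ?_, ?_, ?_, ?_⟩⟩
  · rw [periodize]
    exact finsum_eq_zero_of_forall_eq_zero fun m => h0 _ ((hE.periodic.frontier x m).2 hx)
  · obtain ⟨m, hm⟩ := exists_translate_mem_unitCell x
    -- By periodicity the gradient may be tested at the translate in the unit cell. There the
    -- untranslated summand has positive normal derivative and all others have nonnegative ones.
    suffices h : 0 < fderiv ℝ (periodize w) (x + latticeVec m) (normal E (x + latticeVec m)) by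
      intro hg
      rw [(isPeriodic_periodize w).fderiv x m, ← inner_gradient, hg, inner_zero_left] at h
      exact lt_irrefl _ h
    obtain ⟨S, h0S, hS⟩ := exists_periodize_eq_sum hc (x + latticeVec m)
    have hxm := (hE.periodic.frontier x m).2 hx
    generalize x + latticeVec m = z at *
    have h1 : periodize w =ᶠ[𝓝 z] fun y => ∑ k ∈ S, w (y + latticeVec k) := by
      filter_upwards [Metric.ball_mem_nhds z one_pos] with y hy using hS y hy
    have hd : ∀ k ∈ S, DifferentiableAt ℝ (fun y => w (y + latticeVec k)) z := fun k _ =>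
      (hw.comp (contDiff_id.add contDiff_const)).differentiable (by simp) z
    rw [h1.fderiv_eq, fderiv_fun_sum hd]
    simp only [sum_apply, fderiv_comp_add_right]
    refine Finset.sum_pos' (fun k _ => ?_) ⟨0, h0S, ?_⟩
    · rw [← hE.periodic.normal z k]
      exact hn _ ((hE.periodic.frontier z k).2 hxm)
    · rw [latticeVec_zero, add_zero]
      exact hp z ⟨hxm, unitCell_subset_closedCell hm⟩
  · refine Filter.Eventually.of_forall fun y hy => ?_
    by_contra hyE
    refine absurd hy (not_lt.2 (finsum_nonneg fun m => ?_))
    by_contra! hlt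
    exact hyE ((hEm y m).1 (hin _ hlt))
  · refine Filter.Eventually.of_forall fun y hy hyE => ?_
    have : 0 ≤ ∑ᶠ m : Fin 3 → ℤ, -w (y + latticeVec m) := finsum_nonneg fun m => by
      by_contra! hlt
      exact hout _ (by linarith) ((hEm y m).2 hyE)
    rw [finsum_neg_distrib] at this
    rw [periodize] at hy
    linarith

/-! ### Images under diffeomorphisms -/

section Diffeo

variable {ψ χ : R3 → R3} {E : Set R3}

theorem injective_fderiv_of_leftInverse (hψ : ContDiff ℝ ∞ ψ) (hχ : ContDiff ℝ ∞ χ)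
    (hl : Function.LeftInverse χ ψ) (x : R3) : Function.Injective (fderiv ℝ ψ x) := by
  have h1 : fderiv ℝ (χ ∘ ψ) x = (fderiv ℝ χ (ψ x)).comp (fderiv ℝ ψ x) :=
    fderiv_comp x (hχ.differentiable (by simp) _) (hψ.differentiable (by simp) _)
  rw [hl.comp_eq_id, fderiv_id] at h1
  intro a b hab
  have h2 := fun v => congrArg (fun L : R3 →L[ℝ] R3 => L v) h1
  simp only [ContinuousLinearMap.id_apply, ContinuousLinearMap.comp_apply] at h2
  rw [h2 a, h2 b, hab]

theorem IsDefiningFunction.image (hψ : ContDiff ℝ ∞ ψ) (hχ : ContDiff ℝ ∞ χ)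
    (hl : Function.LeftInverse χ ψ) (hr : Function.RightInverse χ ψ) {x : R3} {ρ : R3 → ℝ}
    (h : IsDefiningFunction E (χ x) ρ) : IsDefiningFunction (ψ '' E) x (ρ ∘ χ) := by
  have hc : Filter.Tendsto χ (𝓝 x) (𝓝 (χ x)) := hχ.continuous.continuousAt
  rw [image_eq_preimage_of_inverse hl hr]
  refine ⟨h.smooth.comp hχ, h.zero, fun h0 => h.gradient_ne ?_, hc.eventually h.inside,
    hc.eventually h.outside⟩
  have h1 : fderiv ℝ (ρ ∘ χ) x = (fderiv ℝ ρ (χ x)).comp (fderiv ℝ χ x) :=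
    fderiv_comp x (h.smooth.differentiable (by simp) _) (hχ.differentiable (by simp) _)
  have hs : Function.Surjective (fderiv ℝ χ x) := by
    have hi := injective_fderiv_of_leftInverse hχ hψ hr x
    exact LinearMap.surjective_of_injective (f := (fderiv ℝ χ x : R3 →ₗ[ℝ] R3)) hi
  refine ext_inner_right ℝ fun v => ?_
  obtain ⟨w, rfl⟩ := hs v
  rw [inner_gradient, inner_zero_left]
  have h2 := congrArg (fun L : R3 →L[ℝ] ℝ => L w) h1
  simp only [ContinuousLinearMap.comp_apply] at h2
  rw [← h2, ← inner_gradient, h0, inner_zero_left]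

theorem frontier_image_of_inverse (hψ : Continuous ψ) (hχ : Continuous χ)
    (hl : Function.LeftInverse χ ψ) (hr : Function.RightInverse χ ψ) :
    frontier (ψ '' E) = ψ '' frontier E :=
  ((Homeomorph.mk ⟨ψ, χ, hl, hr⟩ hψ hχ).image_frontier E).symm

theorem IsSmoothSet.image (hE : IsSmoothSet E) (hψ : ContDiff ℝ ∞ ψ) (hχ : ContDiff ℝ ∞ χ)
    (hl : Function.LeftInverse χ ψ) (hr : Function.RightInverse χ ψ) (hχt : DescendsToTorus χ) :
    IsSmoothSet (ψ '' E) := by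
  refine ⟨fun x m => ?_, fun x hx => ?_⟩
  · obtain ⟨n, hn⟩ := hχt x m
    rw [image_eq_preimage_of_inverse hl hr, mem_preimage, mem_preimage, hn, hE.periodic]
  · rw [frontier_image_of_inverse hψ.continuous hχ.continuous hl hr,
      image_eq_preimage_of_inverse hl hr] at hx
    obtain ⟨ρ, hρ⟩ := hE.boundary _ hx
    exact ⟨_, hρ.image hψ hχ hl hr⟩

end Diffeo

/-! ### Flow maps -/

/-- `Φ` is a smooth family of lifts of diffeomorphisms of the torus that are isotopic to the
identity, which is attained at time `t`; the inverse family is `Ξ`. -/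
structure IsFlowMap (Φ Ξ : ST → R3) (t : ℝ) : Prop where
  smooth : ContDiff ℝ ∞ Φ
  smooth_inv : ContDiff ℝ ∞ Ξ
  left_inv : ∀ s y, Ξ (s, Φ (s, y)) = y
  right_inv : ∀ s x, Φ (s, Ξ (s, x)) = x
  periodic : ∀ s y m, Φ (s, y + latticeVec m) = Φ (s, y) + latticeVec m
  eq_self : ∀ y, Φ (t, y) = y

/-- A smooth family of diffeomorphisms has a smooth family of inverses. -/
theorem contDiff_inverse_family {Φ Ξ : ST → R3} (hΦ : ContDiff ℝ ∞ Φ)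
    (hinv : ∀ s, ∃ χ : R3 → R3, ContDiff ℝ ∞ χ ∧ Function.LeftInverse χ fun y => Φ (s, y))
    (hl : ∀ s y, Ξ (s, Φ (s, y)) = y) (hr : ∀ s x, Φ (s, Ξ (s, x)) = x) : ContDiff ℝ ∞ Ξ := by
  -- The inverse function theorem is applied to (s, y) ↦ (s, Φ(s, y)), whose derivative is injective
  -- because each time slice has a smooth left inverse. Near each point Ξ is then the second
  -- component of the local inverse.
  set Θ : ST → ST := fun p => (p.1, Φ p) with hΘdef
  have hΘ : ContDiff ℝ ∞ Θ := contDiff_fst.prodMk hΦ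
  rw [contDiff_iff_contDiffAt]
  rintro ⟨s, x⟩
  set p : ST := (s, Ξ (s, x)) with hp
  have hΘp : Θ p = (s, x) := by simp [hΘdef, hp, hr]
  have hder : HasFDerivAt Θ ((ContinuousLinearMap.fst ℝ ℝ R3).prod (fderiv ℝ Φ p)) p :=
    hasFDerivAt_fst.prodMk (hΦ.differentiable (by simp) p).hasFDerivAt
  have hinj : Function.Injective
      (((ContinuousLinearMap.fst ℝ ℝ R3).prod (fderiv ℝ Φ p) : ST →L[ℝ] ST) : ST →ₗ[ℝ] ST) := by
    rw [← LinearMap.ker_eq_bot, LinearMap.ker_eq_bot']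
    rintro ⟨a, b⟩ hab
    have ha : a = 0 := congrArg Prod.fst hab
    have hb : fderiv ℝ Φ p (a, b) = 0 := congrArg Prod.snd hab
    subst ha
    obtain ⟨χ, hχ, hχl⟩ := hinv s
    have hsl : fderiv ℝ (fun y => Φ (s, y)) (Ξ (s, x)) b = fderiv ℝ Φ p (0, b) := by
      have h1 : HasFDerivAt Φ (fderiv ℝ Φ p) (s, Ξ (s, x)) :=
        (hΦ.differentiable (by simp) p).hasFDerivAt
      have h2 := h1.comp (Ξ (s, x)) ((hasFDerivAt_const s (Ξ (s, x))).prodMk (hasFDerivAt_id _))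
      have h3 : fderiv ℝ (fun y => Φ (s, y)) (Ξ (s, x)) = _ := h2.fderiv
      rw [h3]
      rfl
    have := injective_fderiv_of_leftInverse (contDiff_slice hΦ s) hχ hχl (Ξ (s, x))
      (a₁ := b) (a₂ := 0) (by rw [hsl, hb, map_zero])
    rw [this]
    rfl
  let e : ST ≃L[ℝ] ST := (LinearEquiv.ofInjectiveEndo _ hinj).toContinuousLinearEquiv
  have he : HasFDerivAt Θ (e : ST →L[ℝ] ST) p := by
    have : (e : ST →L[ℝ] ST) = (ContinuousLinearMap.fst ℝ ℝ R3).prod (fderiv ℝ Φ p) :=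
      ContinuousLinearMap.ext fun v => rfl
    rwa [this]
  have hsm : ContDiffAt ℝ ∞ (hΘ.contDiffAt.localInverse he (by simp)) (Θ p) :=
    hΘ.contDiffAt.to_localInverse he (by simp)
  have hev := (hΘ.contDiffAt.hasStrictFDerivAt' he (by simp)).eventually_right_inverse
  rw [hΘp] at hsm hev
  refine (contDiff_snd.contDiffAt.comp _ hsm).congr_of_eventuallyEq ?_
  filter_upwards [hev] with q hq
  change Θ (hΘ.contDiffAt.localInverse he (by simp) q) = q at hq
  set z := hΘ.contDiffAt.localInverse he (by simp) q
  change Ξ q = z.2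
  rw [← hq]
  exact hl z.1 z.2

/-- Reparametrizing time by κ replaces a flow on (0, T) by a family defined for all times and
unchanged near t, so that smoothness can be stated on all of space-time. -/
theorem exists_smooth_clamp {t T : ℝ} (ht : t ∈ Ioo 0 T) :
    ∃ κ : ℝ → ℝ, ContDiff ℝ ∞ κ ∧ (∀ s, κ s ∈ Ioo 0 T) ∧ ∀ᶠ s in 𝓝 t, κ s = s := by
  obtain ⟨δ, hδ, h1, h2⟩ : ∃ δ > 0, 2 * δ < t ∧ 2 * δ < T - t :=
    ⟨min t (T - t) / 3, by have := lt_min ht.1 (sub_pos.2 ht.2); positivity,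
      by have := min_le_left t (T - t); linarith [ht.1],
      by have := min_le_right t (T - t); linarith [ht.2]⟩
  let b : ContDiffBump t := ⟨δ, 2 * δ, hδ, by linarith⟩
  refine ⟨fun s => t + (s - t) * b s, contDiff_const.add
    ((contDiff_id.sub contDiff_const).mul b.contDiff), fun s => ?_, ?_⟩
  · have h3 : |(s - t) * b s| ≤ 2 * δ := by
      by_cases hs : b s = 0
      · rw [hs, mul_zero, abs_zero]; positivity
      · have h4 : |s - t| < 2 * δ := by
          by_contra! hle
          exact hs (b.zero_of_le_dist (by rwa [Real.dist_eq]))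
        rw [abs_mul, abs_of_nonneg b.nonneg]
        nlinarith [b.le_one (x := s), abs_nonneg (s - t), b.nonneg (x := s)]
    have := abs_le.1 h3
    constructor <;> linarith [this.1, this.2]
  · filter_upwards [b.eventuallyEq_one] with s hs
    rw [hs]; simp

/-- The lattice is discrete and the time line is connected. -/
theorem lattice_translation_eq {f : ℝ → R3} (hf : Continuous f)
    (hn : ∀ s, ∃ n : Fin 3 → ℤ, f s = latticeVec n) (s t : ℝ) : f s = f t := by
  choose n hn using hn
  have hc : Continuous n := by
    refine continuous_pi fun i => ?_
    rw [Int.isClosedEmbedding_coe_real.isInducing.continuous_iff]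
    have : (fun s => f s i) = (fun k : ℤ => (k : ℝ)) ∘ fun s => n s i := by
      funext s; simp [hn s, latticeVec_apply]
    rw [← this]
    fun_prop
  rw [hn, hn, PreconnectedSpace.constant inferInstance hc (x := s) (y := t)]

/-- The map is Φ_s = Ψ_{κ(s)} ∘ Ψ_t⁻¹. The difference Φ_s(y + m) - Φ_s(y) is a lattice vector that
depends continuously on s and equals m at s = t, so Φ_s commutes with lattice translations. -/
theorem IsSmoothFlow.exists_flowMap {F : Set R3} {Ψ : ℝ → R3 → R3} {E : ℝ → Set R3} {T t : ℝ}
    (h : IsSmoothFlow F Ψ E T) (ht : t ∈ Ioo 0 T) :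
    ∃ Φ Ξ : ST → R3, IsFlowMap Φ Ξ t ∧ IsSmoothSet (E t) ∧
      (∀ᶠ s in 𝓝 t, E s = (fun y => Φ (s, y)) '' E t) ∧
      ∀ y, velocity Ψ t y = fderiv ℝ Φ (t, y) eT := by
  obtain ⟨κ, hκ, hκT, hκt⟩ := exists_smooth_clamp ht
  have hd := fun s (hs : s ∈ Ioo 0 T) => (h.diffeo s hs).2.2
  choose! χ hχ hχt hl hr using hd
  have hΨs := fun s hs => (h.diffeo s hs).1
  have hκt' : κ t = t := hκt.self_of_nhds
  have hΦ : ContDiff ℝ ∞ fun p : ST => Ψ (κ p.1) (χ t p.2) :=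
    h.smooth.comp_contDiff (f := fun p : ST => (κ p.1, χ t p.2))
      ((hκ.comp contDiff_fst).prodMk ((hχ t ht).comp contDiff_snd)) fun p => ⟨hκT _, mem_univ _⟩
  have hΞ : ContDiff ℝ ∞ fun p : ST => Ψ t (χ (κ p.1) p.2) := by
    refine contDiff_inverse_family hΦ (fun s => ⟨fun x => Ψ t (χ (κ s) x),
      (hΨs t ht).comp (hχ _ (hκT s)), fun y => ?_⟩) (fun s y => ?_) fun s x => ?_
    · simp only [hl _ (hκT s) _, hr t ht _]
    · simp only [hl _ (hκT s) _, hr t ht _]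
    · simp only [hl t ht _, hr _ (hκT s) _]
  refine ⟨_, _, ⟨hΦ, hΞ, fun s y => ?_, fun s x => ?_, fun s y m => ?_, fun y => ?_⟩, ?_, ?_,
    fun y => ?_⟩
  · simp only [hl _ (hκT s) _, hr t ht _]
  · simp only [hl t ht _, hr _ (hκT s) _]
  · have hc : ∀ z, Continuous fun s => Ψ (κ s) (χ t z) := fun z =>
      hΦ.continuous.comp (Continuous.prodMk continuous_id continuous_const)
    have hcc : Continuous fun s => Ψ (κ s) (χ t (y + latticeVec m)) - Ψ (κ s) (χ t y) :=
      (hc _).sub (hc _)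
    have := lattice_translation_eq hcc (fun s => by
      obtain ⟨k, hk⟩ := hχt t ht y m
      obtain ⟨n, hn⟩ := (h.diffeo _ (hκT s)).2.1 (χ t y) k
      exact ⟨n, by rw [hk, hn]; abel⟩) s t
    simp only [hκt', hr t ht _] at this
    simp only
    rw [← sub_eq_iff_eq_add', this]
    abel
  · simp only [hκt', hr t ht _]
  · rw [h.eq_image t ht]
    exact h.reference.image (hΨs t ht) (hχ t ht) (hl t ht) (hr t ht) (hχt t ht)
  · filter_upwards [hκt] with s hs
    have hsT : s ∈ Ioo 0 T := hs ▸ hκT s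
    simp only [h.eq_image t ht, h.eq_image s hsT, hs, image_image, hl t ht _]
  · have h1 : Function.invFun (Ψ t) y = χ t y := by
      conv_lhs => rw [← hr t ht y]
      exact Function.leftInverse_invFun (hl t ht).injective _
    rw [velocity, h1]
    have h2 : (fun s => Ψ s (χ t y)) =ᶠ[𝓝 t] fun s => Ψ (κ s) (χ t y) := by
      filter_upwards [hκt] with s hs
      rw [hs]
    rw [h2.deriv_eq]
    have h3 := (hΦ.differentiable (by simp) (t, y)).hasFDerivAt
    have h4 := h3.comp_hasDerivAt t ((hasDerivAt_id t).prodMk (hasDerivAt_const t y))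
    exact h4.deriv

/-! ### Spatially periodic functions on space-time -/

/-- Spatial periodicity of a function on space-time. -/
def IsSpacePeriodic (f : ST → ℝ) : Prop := ∀ s, IsPeriodic fun x => f (s, x)

/-- The constant c admits the components of a flow map, which are periodic only up to the
coordinates of lattice vectors. -/
theorem pd_translate {f : ST → ℝ} {m : Fin 3 → ℤ} {c : ℝ}
    (hf : ∀ s x, f (s, x + latticeVec m) = f (s, x) + c) (v : ST) (s : ℝ) (x : R3) :
    pd v f (s, x + latticeVec m) = pd v f (s, x) := by
  have h1 : (fun q : ST => f (q + ((0 : ℝ), latticeVec m))) = fun q => f q + c := by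
    funext q
    obtain ⟨r, y⟩ := q
    simpa using hf r y
  have h2 : fderiv ℝ (fun q : ST => f (q + ((0 : ℝ), latticeVec m))) (s, x) = fderiv ℝ f (s, x) := by
    rw [h1, fderiv_add_const]
  rw [fderiv_comp_add_right] at h2
  simp only [Prod.mk_add_mk, add_zero] at h2
  simp only [pd, h2]

namespace IsSpacePeriodic

variable {f g : ST → ℝ} {N : Fin 3 → ST → ℝ}

theorem pd (hf : IsSpacePeriodic f) (v : ST) : IsSpacePeriodic (pd v f) := fun s x m =>
  pd_translate (c := 0) (fun r y => by simpa using hf r y m) v s x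

theorem mul (hf : IsSpacePeriodic f) (hg : IsSpacePeriodic g) :
    IsSpacePeriodic fun p => f p * g p := fun s x m => by
  simp only [hf s x m, hg s x m]

theorem add (hf : IsSpacePeriodic f) (hg : IsSpacePeriodic g) :
    IsSpacePeriodic fun p => f p + g p := fun s x m => by
  simp only [hf s x m, hg s x m]

theorem sub (hf : IsSpacePeriodic f) (hg : IsSpacePeriodic g) :
    IsSpacePeriodic fun p => f p - g p := fun s x m => by
  simp only [hf s x m, hg s x m]

theorem sum {f : Fin 3 → ST → ℝ} (hf : ∀ i, IsSpacePeriodic (f i)) :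
    IsSpacePeriodic fun p => ∑ i, f i p := fun s x m => by
  simp only [hf _ s x m]

theorem tg (hN : ∀ i, IsSpacePeriodic (N i)) (hf : IsSpacePeriodic f) (i : Fin 3) :
    IsSpacePeriodic (tg N f i) :=
  (hf.pd _).sub ((hN i).mul (sum fun j => (hN j).mul (hf.pd _)))

theorem sdiv (hN : ∀ i, IsSpacePeriodic (N i)) : IsSpacePeriodic (sdiv N) :=
  sum fun i => (hN i).pd _

theorem nd (hN : ∀ i, IsSpacePeriodic (N i)) (hg : IsSpacePeriodic g) (hf : IsSpacePeriodic f) :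
    IsSpacePeriodic (nd N g f) :=
  (hf.pd _).add (hg.mul (sum fun j => (hN j).mul (hf.pd _)))

theorem vec (hN : ∀ i, IsSpacePeriodic (N i)) (s : ℝ) : IsPeriodic (vec N s) := fun x m => by
  ext i
  exact hN i s x m

end IsSpacePeriodic

/-! ### The Jacobian of a flow map -/

/-- The Jacobian determinant of the time slices. -/
def jac (Φ : ST → R3) (p : ST) : ℝ :=
  (Matrix.of fun i j => pd (eX j) (fun q => Φ q i) p).det

theorem det_fderiv_slice {Φ : ST → R3} (hΦ : ContDiff ℝ ∞ Φ) (s : ℝ) (y : R3) :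
    (fderiv ℝ (fun z => Φ (s, z)) y).det = jac Φ (s, y) := by
  have hc : ∀ i, ContDiff ℝ ∞ fun q => Φ q i := fun i => contDiff_euclidean.1 hΦ i
  rw [ContinuousLinearMap.det, ← LinearMap.det_toMatrix (EuclideanSpace.basisFun (Fin 3) ℝ).toBasis,
    jac]
  congr 1
  ext i j
  rw [LinearMap.toMatrix_apply]
  simp only [OrthonormalBasis.coe_toBasis, EuclideanSpace.basisFun_apply,
    OrthonormalBasis.coe_toBasis_repr_apply, EuclideanSpace.basisFun_repr, Matrix.of_apply,
    ContinuousLinearMap.coe_coe]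
  rw [fderiv_apply_component ((contDiff_slice hΦ s).differentiable (by simp) y),
    fderiv_slice (hc i)]
  simp [PiLp.single_apply]

theorem contDiff_jac {Φ : ST → R3} (hΦ : ContDiff ℝ ∞ Φ) : ContDiff ℝ ∞ (jac Φ) := by
  have hc : ∀ i j, ContDiff ℝ ∞ (pd (eX j) fun q => Φ q i) := fun i j =>
    contDiff_pd (contDiff_euclidean.1 hΦ i) _
  unfold jac
  simp only [Matrix.det_fin_three, Matrix.of_apply]
  fun_prop

namespace IsFlowMap

variable {Φ Ξ : ST → R3} {t : ℝ}

theorem contDiff_apply (h : IsFlowMap Φ Ξ t) (i : Fin 3) : ContDiff ℝ ∞ fun q => Φ q i :=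
  contDiff_euclidean.1 h.smooth i

theorem pd_apply (h : IsFlowMap Φ Ξ t) (i j : Fin 3) (y : R3) :
    pd (eX j) (fun q => Φ q i) (t, y) = if i = j then 1 else 0 := by
  have h1 := fderiv_slice (h.contDiff_apply i) t y (EuclideanSpace.single j 1)
  simp only [h.eq_self] at h1
  rw [← fderiv_apply_component (X := fun y => y) differentiableAt_id] at h1
  simpa [PiLp.single_apply] using h1.symm

theorem isSpacePeriodic_pd (h : IsFlowMap Φ Ξ t) (i : Fin 3) (v : ST) :
    IsSpacePeriodic (pd v fun q => Φ q i) := fun s x m =>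
  pd_translate (c := m i) (fun r y => by simp [h.periodic, latticeVec_apply]) v s x

theorem jac_eq_one (h : IsFlowMap Φ Ξ t) (y : R3) : jac Φ (t, y) = 1 := by
  simp [jac, h.pd_apply, Matrix.det_fin_three]

/-- The Jacobian never vanishes because the slices are diffeomorphisms, it equals 1 at time t, and
space-time is connected. This removes the absolute value in the change of variables. -/
theorem jac_pos (h : IsFlowMap Φ Ξ t) (p : ST) : 0 < jac Φ p := by
  have hne : ∀ q, jac Φ q ≠ 0 := by
    rintro ⟨s, y⟩
    rw [← det_fderiv_slice h.smooth]
    have hinj := injective_fderiv_of_leftInverse (contDiff_slice h.smooth s)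
      (contDiff_slice h.smooth_inv s) (h.left_inv s) y
    refine fun h0 => ?_
    have := LinearMap.bot_lt_ker_of_det_eq_zero (f := (fderiv ℝ (fun z => Φ (s, z)) y : R3 →ₗ[ℝ] R3)) h0
    rw [LinearMap.ker_eq_bot.2 hinj] at this
    exact lt_irrefl _ this
  by_contra! hle
  have hc := (contDiff_jac h.smooth).continuous
  obtain ⟨q, hq⟩ := mem_range_of_exists_le_of_exists_ge hc ⟨p, hle⟩
    ⟨(t, 0), by rw [h.jac_eq_one]; exact zero_le_one⟩
  exact hne q hq

/-- At time t the Jacobian matrix is the identity, where the derivative of the determinant is the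
trace. -/
theorem pd_jac (h : IsFlowMap Φ Ξ t) (y : R3) :
    pd eT (jac Φ) (t, y) = ∑ i, pd (eX i) (pd eT fun q => Φ q i) (t, y) := by
  have hc : ∀ i j, ContDiff ℝ ∞ (pd (eX j) fun q => Φ q i) := fun i j =>
    contDiff_pd (h.contDiff_apply i) _
  have e : jac Φ = fun p => ((((pd (eX 0) (fun q => Φ q 0) p * pd (eX 1) (fun q => Φ q 1) p) *
      pd (eX 2) (fun q => Φ q 2) p
      - (pd (eX 0) (fun q => Φ q 0) p * pd (eX 2) (fun q => Φ q 1) p) *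
      pd (eX 1) (fun q => Φ q 2) p)
      - (pd (eX 1) (fun q => Φ q 0) p * pd (eX 0) (fun q => Φ q 1) p) *
      pd (eX 2) (fun q => Φ q 2) p)
      + (pd (eX 1) (fun q => Φ q 0) p * pd (eX 2) (fun q => Φ q 1) p) *
      pd (eX 0) (fun q => Φ q 2) p)
      + (pd (eX 2) (fun q => Φ q 0) p * pd (eX 0) (fun q => Φ q 1) p) *
      pd (eX 1) (fun q => Φ q 2) p
      - (pd (eX 2) (fun q => Φ q 0) p * pd (eX 1) (fun q => Φ q 1) p) *
      pd (eX 0) (fun q => Φ q 2) p := by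
    funext p
    simp [jac, Matrix.det_fin_three]
  have hm : ∀ i j k l, ContDiff ℝ ∞ fun p => pd (eX i) (fun q => Φ q j) p *
      pd (eX k) (fun q => Φ q l) p := fun i j k l => (hc _ _).mul (hc _ _)
  have hm3 : ∀ i j k l a b, ContDiff ℝ ∞ fun p => pd (eX i) (fun q => Φ q j) p *
      pd (eX k) (fun q => Φ q l) p * pd (eX a) (fun q => Φ q b) p := fun i j k l a b =>
    (hm i j k l).mul (hc _ _)
  rw [e, pd_sub ?_ (hm3 _ _ _ _ _ _), pd_add ?_ (hm3 _ _ _ _ _ _), pd_add ?_ (hm3 _ _ _ _ _ _),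
    pd_sub ?_ (hm3 _ _ _ _ _ _), pd_sub (hm3 _ _ _ _ _ _) (hm3 _ _ _ _ _ _)]
  · simp only [pd_mul (hm _ _ _ _) (hc _ _), pd_mul (hc _ _) (hc _ _), h.pd_apply,
      pd_comm (h.contDiff_apply _) eT, Fin.sum_univ_three]
    simp
  all_goals fun_prop

/-! ### Change of variables -/

/-- Change of variables on the torus. -/
theorem setIntegral_image (h : IsFlowMap Φ Ξ t) {E : Set R3} (hE : IsSmoothSet E) {f : R3 → ℝ}
    (hf : IsPeriodic f) (s : ℝ) :
    ∫ x in ((fun y => Φ (s, y)) '' E) ∩ unitCell, f x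
      = ∫ y in E ∩ unitCell, jac Φ (s, y) * f (Φ (s, y)) := by
  have hψ := contDiff_slice h.smooth s
  have hχ := contDiff_slice h.smooth_inv s
  have hl : Function.LeftInverse (fun x => Ξ (s, x)) fun y => Φ (s, y) := h.left_inv s
  have hr : Function.RightInverse (fun x => Ξ (s, x)) fun y => Φ (s, y) := h.right_inv s
  have hinvper : ∀ x m, Ξ (s, x + latticeVec m) = Ξ (s, x) + latticeVec m := fun x m => by
    rw [← h.left_inv s (Ξ (s, x) + latticeVec m), h.periodic, h.right_inv]
  have hE' : IsSmoothSet ((fun y => Φ (s, y)) '' E) :=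
    hE.image hψ hχ hl hr fun x m => ⟨m, hinvper x m⟩
  have hcell : (fun y => Φ (s, y)) '' unitCell = (fun x => Ξ (s, x)) ⁻¹' unitCell :=
    congrFun (image_eq_preimage_of_inverse hl hr) _
  -- The slice commutes with lattice translations, so the image of the cell is again a fundamental
  -- domain and periodic functions have the same integral over it.
  have hD : IsAddFundamentalDomain lattice ((fun y => Φ (s, y)) '' unitCell) volume := by
    rw [hcell]
    refine isAddFundamentalDomain_of_existsUnique
      (hχ.continuous.measurable measurableSet_unitCell).nullMeasurableSet fun x => ?_
    simp only [mem_preimage, hinvper]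
    exact exists_unique_translate_mem_unitCell _
  set g : R3 → ℝ := ((fun y => Φ (s, y)) '' E).indicator f with hg
  have hgp : IsPeriodic g := fun x m => by
    by_cases hx : x ∈ (fun y => Φ (s, y)) '' E
    · rw [hg, indicator_of_mem hx, indicator_of_mem ((hE'.periodic x m).2 hx), hf]
    · rw [hg, indicator_of_notMem hx, indicator_of_notMem (mt (hE'.periodic x m).1 hx)]
  have h1 : ∫ x in ((fun y => Φ (s, y)) '' E) ∩ unitCell, f x = ∫ x in unitCell, g x := by
    rw [hg, integral_indicator₀ (hE'.nullMeasurableSet.mono_ac Measure.restrict_le_self.absolutelyContinuous),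
      Measure.restrict_restrict₀ (hE'.nullMeasurableSet.mono_ac Measure.restrict_le_self.absolutelyContinuous)]
  have h2 : ∫ x in unitCell, g x = ∫ x in (fun y => Φ (s, y)) '' unitCell, g x := by
    refine (isAddFundamentalDomain_unitCell volume).setIntegral_eq hD fun l x => ?_
    obtain ⟨m, rfl⟩ := latticeEquiv.surjective l
    rw [latticeEquiv_vadd, hgp]
  have h3 : ∫ x in (fun y => Φ (s, y)) '' unitCell, g x
      = ∫ y in unitCell, E.indicator (fun y => jac Φ (s, y) * f (Φ (s, y))) y := by
    rw [integral_image_eq_integral_abs_det_fderiv_smul volume measurableSet_unitCell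
      (fun y _ => (hψ.differentiable (by simp) y).hasFDerivAt.hasFDerivWithinAt)
      hl.injective.injOn]
    refine integral_congr_ae (Filter.Eventually.of_forall fun y => ?_)
    simp only [det_fderiv_slice h.smooth, abs_of_pos (h.jac_pos _), smul_eq_mul]
    by_cases hy : y ∈ E
    · rw [indicator_of_mem hy, hg, indicator_of_mem (mem_image_of_mem _ hy)]
    · rw [indicator_of_notMem hy, hg, indicator_of_notMem, mul_zero]
      rintro ⟨z, hz, hzy⟩
      exact hy (hl.injective hzy ▸ hz)
  rw [h1, h2, h3, integral_indicator₀ (hE.nullMeasurableSet.mono_ac Measure.restrict_le_self.absolutelyContinuous),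
    Measure.restrict_restrict₀ (hE.nullMeasurableSet.mono_ac Measure.restrict_le_self.absolutelyContinuous)]

end IsFlowMap

theorem hasDerivAt_setIntegral_slice {K : ST → ℝ} (hK : ContDiff ℝ ∞ K) {A : Set R3}
    (hA : NullMeasurableSet A) (hAc : A ⊆ closedCell) (t : ℝ) :
    HasDerivAt (fun s => ∫ y in A, K (s, y)) (∫ y in A, pd eT K (t, y)) t := by
  have hcomp : IsCompact (Metric.closedBall t 1 ×ˢ closedCell) :=
    (isCompact_closedBall t 1).prod isCompact_closedCell
  obtain ⟨C, hC⟩ := hcomp.exists_bound_of_continuousOn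
    (contDiff_pd hK eT).continuous.continuousOn
  have hfin : volume A < ⊤ := (measure_mono hAc).trans_lt isCompact_closedCell.measure_lt_top
  have : IsFiniteMeasure (volume.restrict A) := ⟨by simpa using hfin⟩
  have hsl : ∀ F : ST → ℝ, Continuous F → ∀ s, Continuous fun y => F (s, y) := fun F hF s =>
    hF.comp (Continuous.prodMk continuous_const continuous_id)
  have hcl : ∀ᵐ y ∂volume.restrict A, y ∈ closedCell :=
    (ae_restrict_mem₀ hA).mono fun y hy => hAc hy
  refine (hasDerivAt_integral_of_dominated_loc_of_deriv_le (F := fun s y => K (s, y))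
    (F' := fun s y => pd eT K (s, y)) (bound := fun _ => C)
    (Metric.closedBall_mem_nhds t one_pos) ?_ ?_ ?_ ?_ (integrable_const C) ?_).2
  · exact Filter.Eventually.of_forall fun s => (hsl K hK.continuous s).aestronglyMeasurable
  · have : IntegrableOn (fun y => K (t, y)) closedCell :=
      (hsl K hK.continuous t).continuousOn.integrableOn_compact isCompact_closedCell
    exact this.mono_set hAc
  · exact (hsl _ (contDiff_pd hK eT).continuous t).aestronglyMeasurable
  · filter_upwards [hcl] with y hy s hs using hC (s, y) ⟨hs, hy⟩
  · refine Filter.Eventually.of_forall fun y s _ => ?_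
    have h3 := (hK.differentiable (by simp) (s, y)).hasFDerivAt
    exact h3.comp_hasDerivAt s ((hasDerivAt_id s).prodMk (hasDerivAt_const s y))

theorem fderiv_apply_eq_pd {Φ : ST → R3} (hΦ : ContDiff ℝ ∞ Φ) (p v : ST) (i : Fin 3) :
    (fderiv ℝ Φ p v) i = pd v (fun q => Φ q i) p := by
  have := (EuclideanSpace.proj (𝕜 := ℝ) i : R3 →L[ℝ] ℝ).hasFDerivAt.comp p
    (hΦ.differentiable (by simp) p).hasFDerivAt
  have h : fderiv ℝ (fun q => Φ q i) p = _ := this.fderiv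
  rw [pd, h]
  rfl

theorem pd_time_comp_flow {Φ : ST → R3} (hΦ : ContDiff ℝ ∞ Φ) {G : ST → ℝ} (hG : ContDiff ℝ ∞ G)
    (p : ST) : pd eT (fun q => G (q.1, Φ q)) p
      = pd eT G (p.1, Φ p) + ∑ i, pd eT (fun q => Φ q i) p * pd (eX i) G (p.1, Φ p) := by
  have h1 : HasFDerivAt G (fderiv ℝ G (p.1, Φ p)) (p.1, Φ p) :=
    (hG.differentiable (by simp) _).hasFDerivAt
  have h2 := h1.comp p (hasFDerivAt_fst.prodMk (hΦ.differentiable (by simp) p).hasFDerivAt)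
  have h3 : fderiv ℝ (fun q => G (q.1, Φ q)) p = _ := h2.fderiv
  simp only [pd, h3]
  change fderiv ℝ G (p.1, Φ p) ((1 : ℝ), fderiv ℝ Φ p eT) = _
  have h4 : ((1 : ℝ), fderiv ℝ Φ p eT)
      = eT + ∑ i, fderiv ℝ (fun q => Φ q i) p eT • eX i := by
    refine Prod.ext (by simp [eX, eT, Prod.fst_sum]) ?_
    simp only [eX, eT, Prod.snd_add, Prod.snd_sum, Prod.smul_snd, zero_add]
    ext i
    simpa [Finset.sum_apply, Pi.single_apply, eT, pd] using fderiv_apply_eq_pd hΦ p eT i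
  rw [h4, map_add, map_sum]
  simp

/-- The Reynolds transport theorem. -/
theorem IsFlowMap.hasDerivAt_setIntegral {Φ Ξ : ST → R3} {t : ℝ} (h : IsFlowMap Φ Ξ t)
    {E : Set R3} (hE : IsSmoothSet E) {G : ST → ℝ} (hG : ContDiff ℝ ∞ G)
    (hGp : IsSpacePeriodic G) :
    HasDerivAt (fun s => ∫ x in ((fun y => Φ (s, y)) '' E) ∩ unitCell, G (s, x))
      (∫ x in E ∩ unitCell, (pd eT G (t, x)
        + ∑ i, pd (eX i) (fun q => G q * pd eT (fun r => Φ r i) q) (t, x))) t := by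
  have hGΦ : ContDiff ℝ ∞ fun q : ST => G (q.1, Φ q) := hG.comp (contDiff_fst.prodMk h.smooth)
  have hj := contDiff_jac h.smooth
  have hd := hasDerivAt_setIntegral_slice (hj.mul hGΦ)
    (hE.nullMeasurableSet.inter measurableSet_unitCell.nullMeasurableSet)
    (inter_subset_right.trans unitCell_subset_closedCell) t
  simp only [h.setIntegral_image hE (hGp _)]
  convert hd using 1
  refine integral_congr_ae (Filter.Eventually.of_forall fun y => ?_)
  have hX : ∀ i, ContDiff ℝ ∞ (pd eT fun r => Φ r i) := fun i => contDiff_pd (h.contDiff_apply i) _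
  simp only [pd_mul hj hGΦ, h.jac_eq_one, h.pd_jac, pd_time_comp_flow h.smooth hG, h.eq_self,
    pd_mul hG (hX _), Fin.sum_univ_three]
  ring

/-! ### The moving normal field -/

/-- A smooth function that agrees with `r ↦ 1 / √r` on `[c, ∞)`. -/
def cutInvSqrt (c r : ℝ) : ℝ := Real.smoothTransition ((2 * r - c) / c) / √r

/-- The numerator vanishes for r ≤ c / 2, which hides the singularity of the square root at 0. -/
theorem contDiff_cutInvSqrt {c : ℝ} (hc : 0 < c) : ContDiff ℝ ∞ (cutInvSqrt c) := by
  rw [contDiff_iff_contDiffAt]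
  intro r
  rcases lt_or_ge 0 r with hr | hr
  · have h1 : ContDiff ℝ ∞ fun r : ℝ => Real.smoothTransition ((2 * r - c) / c) :=
      Real.smoothTransition.contDiff.comp (by fun_prop)
    exact h1.contDiffAt.div (Real.contDiffAt_sqrt hr.ne') (Real.sqrt_ne_zero'.2 hr)
  · refine contDiffAt_const (c := (0 : ℝ)) |>.congr_of_eventuallyEq ?_
    have hr' : r < c / 2 := hr.trans_lt (by positivity)
    filter_upwards [Iio_mem_nhds hr'] with z hz
    rw [mem_Iio] at hz
    rw [cutInvSqrt, Real.smoothTransition.zero_of_nonpos, zero_div]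
    exact div_nonpos_of_nonpos_of_nonneg (by linarith) hc.le

theorem cutInvSqrt_of_le {c r : ℝ} (hc : 0 < c) (hr : c ≤ r) : cutInvSqrt c r = 1 / √r := by
  rw [cutInvSqrt, Real.smoothTransition.one_of_one_le]
  rw [le_div_iff₀ hc]
  linarith

/-- This keeps |N| ≤ 1 everywhere, also off the surface, so that N is an admissible test field for
the perimeter. -/
theorem cutInvSqrt_sq_mul_le {c r : ℝ} (hr : 0 ≤ r) : cutInvSqrt c r ^ 2 * r ≤ 1 := by
  rw [cutInvSqrt, div_pow, Real.sq_sqrt hr, div_mul_eq_mul_div]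
  have h1 := Real.smoothTransition.le_one ((2 * r - c) / c)
  have h0 := Real.smoothTransition.nonneg ((2 * r - c) / c)
  refine div_le_one_of_le₀ ?_ hr
  nlinarith [mul_nonneg h0 (sub_nonneg.2 h1)]

theorem gradient_slice {u : ST → ℝ} (hu : ContDiff ℝ ∞ u) (s : ℝ) (x : R3) :
    gradient (fun y => u (s, y)) x = vec (fun i => pd (eX i) u) s x := by
  refine ext_inner_left ℝ fun v => ?_
  rw [real_inner_comm, inner_gradient, fderiv_slice hu, inner_vec]

/-- The velocity field of a flow map. -/
def flowVelocity (Φ Ξ : ST → R3) (i : Fin 3) (p : ST) : ℝ :=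
  pd eT (fun q => Φ q i) (p.1, Ξ p)

namespace IsFlowMap

variable {Φ Ξ : ST → R3} {t : ℝ}

theorem periodic_inv (h : IsFlowMap Φ Ξ t) (s : ℝ) (x : R3) (m : Fin 3 → ℤ) :
    Ξ (s, x + latticeVec m) = Ξ (s, x) + latticeVec m := by
  rw [← h.left_inv s (Ξ (s, x) + latticeVec m), h.periodic, h.right_inv]

theorem inv_eq_self (h : IsFlowMap Φ Ξ t) (x : R3) : Ξ (t, x) = x := by
  conv_rhs => rw [← h.right_inv t x]
  rw [h.eq_self]

theorem isSmoothSet_image (h : IsFlowMap Φ Ξ t) {E : Set R3} (hE : IsSmoothSet E) (s : ℝ) :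
    IsSmoothSet ((fun y => Φ (s, y)) '' E) :=
  hE.image (χ := fun x => Ξ (s, x)) (contDiff_slice h.smooth s) (contDiff_slice h.smooth_inv s)
    (h.left_inv s) (h.right_inv s) fun x m => ⟨m, h.periodic_inv s x m⟩

theorem frontier_image (h : IsFlowMap Φ Ξ t) (E : Set R3) (s : ℝ) :
    frontier ((fun y => Φ (s, y)) '' E) = (fun y => Φ (s, y)) '' frontier E :=
  frontier_image_of_inverse (χ := fun x => Ξ (s, x)) (contDiff_slice h.smooth s).continuous
    (contDiff_slice h.smooth_inv s).continuous (h.left_inv s) (h.right_inv s)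

theorem contDiff_flowVelocity (h : IsFlowMap Φ Ξ t) (i : Fin 3) :
    ContDiff ℝ ∞ (flowVelocity Φ Ξ i) :=
  (contDiff_pd (h.contDiff_apply i) eT).comp (contDiff_fst.prodMk h.smooth_inv)

theorem isSpacePeriodic_flowVelocity (h : IsFlowMap Φ Ξ t) (i : Fin 3) :
    IsSpacePeriodic (flowVelocity Φ Ξ i) := fun s x m => by
  simp only [flowVelocity, h.periodic_inv]
  exact h.isSpacePeriodic_pd i eT s (Ξ (s, x)) m

/-- The function u₀ ∘ Ξ is constant along the trajectories of the flow. -/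
theorem transport (h : IsFlowMap Φ Ξ t) {u₀ : R3 → ℝ} (hu : ContDiff ℝ ∞ u₀) (p : ST) :
    pd eT (fun q => u₀ (Ξ q)) p
      = -∑ i, flowVelocity Φ Ξ i p * pd (eX i) (fun q => u₀ (Ξ q)) p := by
  have h1 := pd_time_comp_flow h.smooth (hu.comp h.smooth_inv) (p.1, Ξ p)
  have h2 : (fun q : ST => (u₀ ∘ Ξ) (q.1, Φ q)) = fun q => u₀ q.2 := by
    funext ⟨s, y⟩
    simp [h.left_inv]
  have h3 : pd eT (fun q : ST => u₀ q.2) (p.1, Ξ p) = 0 := by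
    have h4 := (hu.differentiable (by simp) (Ξ p)).hasFDerivAt.comp (p.1, Ξ p)
      (hasFDerivAt_snd (𝕜 := ℝ) (E := ℝ) (F := R3))
    have h5 : fderiv ℝ (fun q : ST => u₀ q.2) (p.1, Ξ p) = _ := h4.fderiv
    rw [pd, h5]
    simp [eT]
  rw [h2, h3] at h1
  have h6 : ((p.1, Ξ p).1, Φ (p.1, Ξ p)) = p := Prod.ext rfl (h.right_inv p.1 p.2)
  rw [h6] at h1
  simp only [flowVelocity]
  change 0 = pd eT (fun q => u₀ (Ξ q)) p + ∑ i, pd eT (fun q => Φ q i) (p.1, Ξ p) *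
    pd (eX i) (fun q => u₀ (Ξ q)) p at h1
  linarith

/-- A smooth set that is moved by a flow map has a smooth space-time field of normals. -/
theorem exists_normalFlow (h : IsFlowMap Φ Ξ t) {E : Set R3} (hE : IsSmoothSet E) :
    ∃ (N : Fin 3 → ST → ℝ) (V u g : ST → ℝ) (O : Set ST), IsNormalFlow N V u g O ∧
      (∀ i, IsSpacePeriodic (N i)) ∧ IsSpacePeriodic V ∧ (∀ p, ∑ i, N i p ^ 2 ≤ 1) ∧
      (∀ x, V (t, x) = ∑ i, pd eT (fun q => Φ q i) (t, x) * N i (t, x)) ∧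
      ∀ᶠ s in 𝓝 t, HasNormalField ((fun y => Φ (s, y)) '' E) N s ∧
        ∀ x ∈ frontier ((fun y => Φ (s, y)) '' E), (s, x) ∈ O := by
  obtain ⟨u₀, hu₀, hu₀p, hdef⟩ := hE.exists_definingFunction
  set u : ST → ℝ := fun p => u₀ (Ξ p) with hu
  have hus : ContDiff ℝ ∞ u := hu₀.comp h.smooth_inv
  have hup : IsSpacePeriodic u := fun s x m => by
    simp only [hu, h.periodic_inv, hu₀p (Ξ (s, x)) m]
  have hdefs : ∀ s, ∀ x ∈ frontier ((fun y => Φ (s, y)) '' E),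
      IsDefiningFunction ((fun y => Φ (s, y)) '' E) x fun y => u (s, y) := by
    intro s x hx
    rw [h.frontier_image] at hx
    obtain ⟨y, hy, rfl⟩ := hx
    exact IsDefiningFunction.image (χ := fun x => Ξ (s, x)) (contDiff_slice h.smooth s)
      (contDiff_slice h.smooth_inv s) (h.left_inv s) (h.right_inv s)
      (by simpa only [h.left_inv] using hdef y hy)
  set q : ST → ℝ := fun p => ∑ i, pd (eX i) u p ^ 2 with hq
  have hqs : ContDiff ℝ ∞ q := ContDiff.sum fun i _ => (contDiff_pd hus _).pow 2
  have hq0 : ∀ p, 0 ≤ q p := fun p => Finset.sum_nonneg fun i _ => sq_nonneg _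
  have hqp : IsSpacePeriodic q := fun s x m => by
    simp only [hq, hup.pd (eX _) s x m]
  have hqn : ∀ s x, ‖gradient (fun y => u (s, y)) x‖ ^ 2 = q (s, x) := fun s x => by
    rw [gradient_slice hus, norm_vec_sq]
  have hK : IsCompact (frontier E ∩ closedCell) := isCompact_closedCell.inter_left isClosed_frontier
  have hQ : Continuous fun p : ST => q (p.1, Φ p) :=
    hqs.continuous.comp (continuous_fst.prodMk h.smooth.continuous)
  have hE_t : (fun y => Φ (t, y)) '' E = E := by simp [h.eq_self]
  -- On the compact part of ∂E in the closed cell |∇u|² is at least some c > 0 at time t. By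
  -- compactness it exceeds c / 2 for nearby times, and by periodicity it does so on the whole
  -- moving boundary.
  obtain ⟨c, hc, hcK⟩ : ∃ c > 0, ∀ y ∈ frontier E ∩ closedCell, c ≤ q (t, Φ (t, y)) := by
    refine hK.exists_forall_le' (f := fun y => q (t, Φ (t, y)))
      (hQ.comp (Continuous.prodMk continuous_const continuous_id)).continuousOn fun y hy => ?_
    rw [h.eq_self, ← hqn]
    have := (hdefs t y (by rw [hE_t]; exact hy.1)).gradient_ne
    positivity
  have hnear : ∀ᶠ s in 𝓝 t, ∀ x ∈ frontier ((fun y => Φ (s, y)) '' E), c / 2 < q (s, x) := by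
    have h1 : ∀ᶠ s in 𝓝 t, ∀ y ∈ frontier E ∩ closedCell, c / 2 < q (s, Φ (s, y)) := by
      refine hK.eventually_forall_of_forall_eventually fun y hy => ?_
      exact hQ.continuousAt.eventually (lt_mem_nhds ((half_lt_self hc).trans_le (hcK y hy)))
    filter_upwards [h1] with s hs x hx
    rw [h.frontier_image] at hx
    obtain ⟨y, hy, rfl⟩ := hx
    obtain ⟨m, hm⟩ := exists_translate_mem_unitCell y
    have h2 := hs (y + latticeVec m)
      ⟨(hE.periodic.frontier y m).2 hy, unitCell_subset_closedCell hm⟩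
    have h3 : q (s, Φ (s, y) + latticeVec m) = q (s, Φ (s, y)) := hqp s (Φ (s, y)) m
    rwa [h.periodic, h3] at h2
  have hc2 : 0 < c / 2 := by positivity
  set k : ST → ℝ := fun p => cutInvSqrt (c / 2) (q p) with hk
  have hks : ContDiff ℝ ∞ k := (contDiff_cutInvSqrt hc2).comp hqs
  have hkp : IsSpacePeriodic k := fun s x m => by
    simp only [hk, hqp s x m]
  set N : Fin 3 → ST → ℝ := fun i p => pd (eX i) u p * k p with hN
  have hNs : ∀ i, ContDiff ℝ ∞ (N i) := fun i => (contDiff_pd hus _).mul hks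
  have hNp : ∀ i, IsSpacePeriodic (N i) := fun i => (hup.pd _).mul hkp
  have hNN : ∀ p, ∑ i, N i p ^ 2 = k p ^ 2 * q p := fun p => by
    simp only [hN, hq, mul_pow, ← Finset.sum_mul]
    ring
  have hg : ∀ p, ∑ i, N i p * pd (eX i) u p = k p * q p := fun p => by
    simp only [hN, hq, Finset.mul_sum]
    exact Finset.sum_congr rfl fun i _ => by ring
  have hkO : ∀ p, c / 2 < q p → k p = 1 / √(q p) := fun p hp => cutInvSqrt_of_le hc2 hp.le
  have hkq : ∀ p, c / 2 < q p → k p * q p = √(q p) := fun p hp => by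
    rw [hkO p hp, one_div, inv_mul_eq_div, Real.div_sqrt]
  have hkk : ∀ p, c / 2 < q p → √(q p) * k p = 1 := fun p hp => by
    rw [hkO p hp, mul_one_div_cancel (Real.sqrt_ne_zero'.2 (hc2.trans hp))]
  refine ⟨N, fun p => ∑ i, flowVelocity Φ Ξ i p * N i p, u,
    fun p => ∑ i, N i p * pd (eX i) u p, {p | c / 2 < q p}, ?_, hNp,
    IsSpacePeriodic.sum fun i => (h.isSpacePeriodic_flowVelocity i).mul (hNp i), fun p => ?_,
    fun x => ?_, ?_⟩
  · refine ⟨isOpen_lt continuous_const hqs.continuous, hNs,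
      ContDiff.sum fun i _ => (h.contDiff_flowVelocity i).mul (hNs i), hus,
      ContDiff.sum fun i _ => (hNs i).mul (contDiff_pd hus _), fun p hp => ?_, fun p hp => ?_,
      fun i p hp => ?_, fun p hp => ?_⟩
    · rw [hNN, sq, mul_assoc, hkq p hp, mul_comm, hkk p hp]
    · rw [hg, hkq p hp]
      exact Real.sqrt_ne_zero'.2 (hc2.trans hp)
    · rw [hg, hkq p hp]
      simp only [hN]
      linear_combination -pd (eX i) u p * hkk p hp
    · rw [hg, hkq p hp, h.transport hu₀]
      simp only [hN, ← mul_assoc, ← Finset.sum_mul]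
      linear_combination (∑ i, flowVelocity Φ Ξ i p * pd (eX i) u p) * hkk p hp
  · rw [hNN]
    exact cutInvSqrt_sq_mul_le (hq0 p)
  · simp only [flowVelocity, h.inv_eq_self]
  · filter_upwards [hnear] with s hs
    refine ⟨⟨h.isSmoothSet_image hE s, hNs, fun x hx => ?_⟩, hs⟩
    rw [(hdefs s x hx).normal_eq, ← Real.sqrt_sq (norm_nonneg (gradient (fun y => u (s, y)) x)), hqn,
      gradient_slice hus, ← one_div, ← hkO (s, x) (hs x hx)]
    ext i
    simp [vec_apply, hN, mul_comm]

end IsFlowMap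

/-! ### Boundary integrals along a flow -/

theorem IsSmoothSet.boundaryIntegral_add {E : Set R3} (hE : IsSmoothSet E) {f g : R3 → ℝ}
    (hf : Continuous f) (hg : Continuous g) :
    boundaryIntegral E (fun x => f x + g x) = boundaryIntegral E f + boundaryIntegral E g :=
  integral_add (hE.boundaryIntegrable hf.continuousOn) (hE.boundaryIntegrable hg.continuousOn)

theorem IsSmoothSet.boundaryIntegral_sub {E : Set R3} (hE : IsSmoothSet E) {f g : R3 → ℝ}
    (hf : Continuous f) (hg : Continuous g) :
    boundaryIntegral E (fun x => f x - g x) = boundaryIntegral E f - boundaryIntegral E g :=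
  integral_sub (hE.boundaryIntegrable hf.continuousOn) (hE.boundaryIntegrable hg.continuousOn)

theorem boundaryIntegral_const_mul (E : Set R3) (c : ℝ) (f : R3 → ℝ) :
    boundaryIntegral E (fun x => c * f x) = c * boundaryIntegral E f :=
  integral_const_mul c f

theorem tdiv_mul {N Y : Fin 3 → ST → ℝ} {f : ST → ℝ} (hf : ContDiff ℝ ∞ f)
    (hY : ∀ i, ContDiff ℝ ∞ (Y i)) (p : ST) :
    tdiv N (fun i q => f q * Y i q) p = ∑ i, tg N f i p * Y i p + f p * tdiv N Y p := by
  simp only [tdiv, tg, pd_mul hf (hY _), Fin.sum_univ_three]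
  ring

theorem sdiv_mul {N : Fin 3 → ST → ℝ} {f : ST → ℝ} (hf : ContDiff ℝ ∞ f)
    (hN : ∀ i, ContDiff ℝ ∞ (N i)) (p : ST) :
    sdiv (fun i q => f q * N i q) p = ∑ i, N i p * pd (eX i) f p + f p * sdiv N p := by
  simp only [sdiv, pd_mul hf (hN _), Fin.sum_univ_three]
  ring

/-- The first variation formula along a flow map. -/
theorem IsFlowMap.hasDerivAt_boundaryIntegral {Φ Ξ : ST → R3} {t : ℝ} (h : IsFlowMap Φ Ξ t)
    {E : Set R3} (hE : IsSmoothSet E) {N : Fin 3 → ST → ℝ} {V u g : ST → ℝ} {O : Set ST}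
    (hN : IsNormalFlow N V u g O) (hNp : ∀ i, IsSpacePeriodic (N i))
    (hV : ∀ x, V (t, x) = ∑ i, pd eT (fun q => Φ q i) (t, x) * N i (t, x))
    (hO : ∀ᶠ s in 𝓝 t, HasNormalField ((fun y => Φ (s, y)) '' E) N s ∧
      ∀ x ∈ frontier ((fun y => Φ (s, y)) '' E), (s, x) ∈ O)
    {f : ST → ℝ} (hf : ContDiff ℝ ∞ f) (hfp : IsSpacePeriodic f) :
    HasDerivAt (fun s => boundaryIntegral ((fun y => Φ (s, y)) '' E) fun x => f (s, x))
      (boundaryIntegral E fun x => nd N V f (t, x) + f (t, x) * sdiv N (t, x) * V (t, x)) t := by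
  -- On ∂E_s the function f is the normal component of Z = fN, so its boundary integral is the
  -- volume integral of div Z over the moving set, to which the transport theorem applies.
  set Z : Fin 3 → ST → ℝ := fun i q => f q * N i q with hZ
  have hZs : ∀ i, ContDiff ℝ ∞ (Z i) := fun i => hf.mul (hN.smoothN i)
  have hZp : ∀ i, IsSpacePeriodic (Z i) := fun i => hfp.mul (hNp i)
  have hG := contDiff_sdiv hZs
  have hGp := IsSpacePeriodic.sdiv hZp
  have hE_t : (fun y => Φ (t, y)) '' E = E := by simp [h.eq_self]
  obtain ⟨hNt, hOt⟩ := hO.self_of_nhds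
  rw [hE_t] at hNt hOt
  set X : Fin 3 → ST → ℝ := fun i => pd eT fun q => Φ q i with hX
  have hXs : ∀ i, ContDiff ℝ ∞ (X i) := fun i => contDiff_pd (h.contDiff_apply i) _
  -- The transported integrand is the divergence of W = ∂_t Z + (div Z) X. The normal component of W
  -- on ∂E is ∂_t f + V ∂_N f + f H V, because |N| = 1, N · ∂_t N = 0 and X · N = V.
  set W : Fin 3 → ST → ℝ := fun i q => pd eT (Z i) q + sdiv Z q * X i q with hW
  have hWs : ∀ i, ContDiff ℝ ∞ (W i) := fun i => (contDiff_pd (hZs i) _).add (hG.mul (hXs i))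
  have hWp : ∀ i, IsSpacePeriodic (W i) := fun i =>
    ((hZp i).pd _).add (hGp.mul (h.isSpacePeriodic_pd i eT))
  have hd := h.hasDerivAt_setIntegral hE hG hGp
  have hval : (∫ x in E ∩ unitCell, (pd eT (sdiv Z) (t, x)
        + ∑ i, pd (eX i) (fun q => sdiv Z q * pd eT (fun r => Φ r i) q) (t, x)))
      = boundaryIntegral E fun x => nd N V f (t, x) + f (t, x) * sdiv N (t, x) * V (t, x) := by
    have h1 : ∀ x, pd eT (sdiv Z) (t, x)
        + ∑ i, pd (eX i) (fun q => sdiv Z q * pd eT (fun r => Φ r i) q) (t, x)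
        = divergence (vec W t) x := by
      intro x
      have h2 : pd eT (sdiv Z) (t, x) = ∑ i, pd (eX i) (pd eT (Z i)) (t, x) := by
        simp only [← pd_comm (hZs _) eT]
        exact pd_sum (fun i => contDiff_pd (hZs i) _) _ _
      rw [divergence_vec hWs, sdiv, h2, ← Finset.sum_add_distrib]
      refine Finset.sum_congr rfl fun i _ => ?_
      exact (pd_add (contDiff_pd (hZs i) _) (hG.mul (hXs i)) _ _).symm
    simp only [h1]
    rw [hE.integral_divergence ((contDiff_vec hWs t).of_le (by exact_mod_cast le_top))
      (IsSpacePeriodic.vec hWp t)]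
    refine boundaryIntegral_congr fun x hx => ?_
    have h3 := hNt.sum_sq hx
    have h4 := hN.normal_pd (hOt x hx) eT
    simp only [hNt.normal_eq x hx, inner_vec, vec_apply, hW, hZ, sdiv_mul hf hN.smoothN,
      pd_mul hf (hN.smoothN _), nd, hV, Fin.sum_univ_three] at *
    linear_combination pd eT f (t, x) * h3 + f (t, x) * h4
  rw [hval] at hd
  refine hd.congr_of_eventuallyEq ?_
  filter_upwards [hO] with s hs
  have h1 : ∀ x, sdiv Z (s, x) = divergence (vec Z s) x := fun x => (divergence_vec hZs s x).symm
  simp only [h1]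
  rw [hs.1.smoothSet.integral_divergence ((contDiff_vec hZs s).of_le (by exact_mod_cast le_top))
      (IsSpacePeriodic.vec hZp s)]
  refine boundaryIntegral_congr fun x hx => ?_
  have h3 := hs.1.sum_sq hx
  simp only [hs.1.normal_eq x hx, inner_vec, vec_apply, hZ, Fin.sum_univ_three] at *
  linear_combination -f (s, x) * h3

/-- Integration by parts on a closed surface. -/
theorem HasNormalField.integral_mul_tdiv_tg {E : Set R3} {N : Fin 3 → ST → ℝ} {t : ℝ}
    (hNt : HasNormalField E N t) {V u g : ST → ℝ} {O : Set ST} (hN : IsNormalFlow N V u g O)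
    (hNp : ∀ i, IsSpacePeriodic (N i)) (hO : ∀ x ∈ frontier E, (t, x) ∈ O) {f k : ST → ℝ}
    (hf : ContDiff ℝ ∞ f) (hfp : IsSpacePeriodic f) (hk : ContDiff ℝ ∞ k)
    (hkp : IsSpacePeriodic k) :
    boundaryIntegral E (fun x => f (t, x) * tdiv N (tg N k) (t, x))
      = -boundaryIntegral E fun x => ∑ i, tg N f i (t, x) * tg N k i (t, x) := by
  have hs := contDiff_tg hN.smoothN hk
  -- The divergence theorem is applied to the tangential field f D_τ k.
  have h1 := hNt.boundaryIntegral_tdiv (IsSpacePeriodic.vec hNp t)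
    (Y := fun i q => f q * tg N k i q) (fun i => hf.mul (hs i))
    (IsSpacePeriodic.vec (fun i => hfp.mul (IsSpacePeriodic.tg hNp hkp i)) t)
    (fun x hx v => hN.normal_pd (hO x hx) v) fun x hx => by
      have := hN.sum_normal_tg (hO x hx) k
      calc _ = f (t, x) * ∑ i, N i (t, x) * tg N k i (t, x) := by
            rw [Finset.mul_sum]; exact Finset.sum_congr rfl fun i _ => by ring
        _ = 0 := by rw [this, mul_zero]
  simp only [tdiv_mul hf hs] at h1
  have hA : ContDiff ℝ ∞ fun p => ∑ i, tg N f i p * tg N k i p :=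
    ContDiff.sum fun i _ => (contDiff_tg hN.smoothN hf i).mul (hs i)
  have hB : ContDiff ℝ ∞ fun p => f p * tdiv N (tg N k) p := hf.mul (contDiff_tdiv hN.smoothN hs)
  rw [hNt.smoothSet.boundaryIntegral_add (contDiff_slice hA t).continuous
    (contDiff_slice hB t).continuous] at h1
  linarith

/-! ### Geometric quantities of a normal flow -/

theorem HasNormalField.isTestField {E : Set R3} {N : Fin 3 → ST → ℝ} {s : ℝ}
    (h : HasNormalField E N s) (hNp : ∀ i, IsSpacePeriodic (N i)) (hN : ∀ p, ∑ i, N i p ^ 2 ≤ 1) :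
    IsTestField (vec N s) :=
  ⟨(contDiff_vec h.smooth s).of_le (by exact_mod_cast le_top), IsSpacePeriodic.vec hNp s,
    fun x => by
      have := norm_vec_sq N s x ▸ hN (s, x)
      exact (sq_le_one_iff₀ (norm_nonneg _)).1 this⟩

namespace IsNormalFlow

variable {E : Set R3} {N : Fin 3 → ST → ℝ} {V u g : ST → ℝ} {O : Set ST} {s : ℝ} {x : R3}

theorem meanCurvature_eq (h : IsNormalFlow N V u g O) (hs : HasNormalField E N s)
    (hO : ∀ x ∈ frontier E, (s, x) ∈ O) (hx : x ∈ frontier E) :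
    meanCurvature E x = sdiv N (s, x) :=
  hs.meanCurvature_eq (fun v => h.normal_pd (hO x hx) v) hx

theorem DH_eq (h : IsNormalFlow N V u g O) (hs : HasNormalField E N s)
    (hO : ∀ x ∈ frontier E, (s, x) ∈ O) (hx : x ∈ frontier E) :
    DH E x = vec (tg N (sdiv N)) s x :=
  hs.tangentialGradient_eq (contDiff_sdiv h.smoothN)
    (fun _ hy => h.meanCurvature_eq hs hO hy) hx

theorem LH_eq (h : IsNormalFlow N V u g O) (hs : HasNormalField E N s)
    (hO : ∀ x ∈ frontier E, (s, x) ∈ O) (hx : x ∈ frontier E) :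
    LH E x = tdiv N (tg N (sdiv N)) (s, x) :=
  hs.laplaceBeltrami_eq (contDiff_sdiv h.smoothN)
    (fun _ hy => h.meanCurvature_eq hs hO hy) hx

/-- The rate of change of the energy of the mean curvature, for surface diffusion. -/
theorem integral_nd_half_sq_DH (h : IsNormalFlow N V u g O) (hs : HasNormalField E N s)
    (hO : ∀ x ∈ frontier E, (s, x) ∈ O) (hNp : ∀ i, IsSpacePeriodic (N i))
    (hVp : IsSpacePeriodic V) (hV : ∀ x ∈ frontier E, V (s, x) = LH E x) :
    boundaryIntegral E (fun x => nd N V (fun q => 1 / 2 * ∑ i, tg N (sdiv N) i q ^ 2) (s, x)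
        + 1 / 2 * (∑ i, tg N (sdiv N) i (s, x) ^ 2) * sdiv N (s, x) * V (s, x))
      = -secondVariation E (LH E)
        - boundaryIntegral E (fun x => secondFundamentalForm E x (DH E x) * LH E x)
        + 1 / 2 * boundaryIntegral E (fun x => meanCurvature E x * ‖DH E x‖ ^ 2 * LH E x) := by
  have hE := hs.smoothSet
  have hH := contDiff_sdiv h.smoothN
  have hHp := IsSpacePeriodic.sdiv hNp
  have hk := contDiff_nd h.smoothN h.smoothV hH
  have hkp := IsSpacePeriodic.nd hNp hVp hHp
  have htH := contDiff_tg h.smoothN hH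
  have htV := contDiff_tg h.smoothN h.smoothV
  have htk := contDiff_tg h.smoothN hk
  have cont : ∀ {f : ST → ℝ}, ContDiff ℝ ∞ f → Continuous fun x => f (s, x) := fun hf =>
    (contDiff_slice hf s).continuous
  have s1 : ContDiff ℝ ∞ fun p => ∑ i, tg N (sdiv N) i p * tg N (nd N V (sdiv N)) i p :=
    ContDiff.sum fun i _ => (htH i).mul (htk i)
  have s2 : ContDiff ℝ ∞ fun p => V p * ∑ i, ∑ j, pd (eX i) (N j) p * tg N (sdiv N) i p *
      tg N (sdiv N) j p :=
    h.smoothV.mul (ContDiff.sum fun i _ => ContDiff.sum fun j _ =>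
      ((contDiff_pd (h.smoothN j) _).mul (htH i)).mul (htH j))
  have s3 : ContDiff ℝ ∞ fun p => 1 / 2 * (sdiv N p * (∑ i, tg N (sdiv N) i p ^ 2) * V p) :=
    contDiff_const.mul ((hH.mul (ContDiff.sum fun i _ => (htH i).pow 2)).mul h.smoothV)
  have s4 : ContDiff ℝ ∞ fun p => V p * tdiv N (tg N V) p :=
    h.smoothV.mul (contDiff_tdiv h.smoothN htV)
  have s5 : ContDiff ℝ ∞ fun p => (∑ i, ∑ k, tg N (N k) i p ^ 2) * V p ^ 2 :=
    (ContDiff.sum fun i _ => ContDiff.sum fun k _ =>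
      (contDiff_tg h.smoothN (h.smoothN k) i).pow 2).mul (h.smoothV.pow 2)
  -- Integration by parts moves the gradient off ∂H and produces -∫ ∂H Δ_τ H. Inserting ∂H = -Δ_τ V
  -- - |B|² V and V = Δ_τ H, a second integration by parts of V Δ_τ V gives the second variation.
  have e1 : boundaryIntegral E (fun x => ∑ i, tg N (sdiv N) i (s, x) *
      tg N (nd N V (sdiv N)) i (s, x)) = -secondVariation E (LH E) := by
    have h1 := hs.integral_mul_tdiv_tg h hNp hO hk hkp hH hHp
    have h2 := hs.integral_mul_tdiv_tg h hNp hO h.smoothV hVp h.smoothV hVp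
    have h3 : boundaryIntegral E (fun x => nd N V (sdiv N) (s, x) * tdiv N (tg N (sdiv N)) (s, x))
        = -(boundaryIntegral E (fun x => V (s, x) * tdiv N (tg N V) (s, x))
          + boundaryIntegral E fun x => (∑ i, ∑ k, tg N (N k) i (s, x) ^ 2) * V (s, x) ^ 2) := by
      rw [← hE.boundaryIntegral_add (cont s4) (cont s5), ← neg_one_mul,
        ← boundaryIntegral_const_mul]
      refine boundaryIntegral_congr fun x hx => ?_
      simp only [← h.LH_eq hs hO hx, ← hV x hx, h.nd_sdiv (hO x hx), h.trace_sq (hO x hx)]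
      ring
    have h4 : boundaryIntegral E (fun x => ‖tangentialGradient E (LH E) x‖ ^ 2)
        = boundaryIntegral E fun x => ∑ i, tg N V i (s, x) * tg N V i (s, x) := by
      refine boundaryIntegral_congr fun x hx => ?_
      simp only [hs.tangentialGradient_eq h.smoothV (fun y hy => (hV y hy).symm) hx, norm_vec_sq]
      exact Finset.sum_congr rfl fun i _ => sq _
    have h5 : boundaryIntegral E (fun x => normSqB E x * LH E x ^ 2)
        = boundaryIntegral E fun x => (∑ i, ∑ k, tg N (N k) i (s, x) ^ 2) * V (s, x) ^ 2 := by
      refine boundaryIntegral_congr fun x hx => ?_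
      simp only [hs.normSqB_eq hx, hV x hx]
    have h6 : boundaryIntegral E (fun x => ∑ i, tg N (sdiv N) i (s, x) *
          tg N (nd N V (sdiv N)) i (s, x))
        = boundaryIntegral E fun x => ∑ i, tg N (nd N V (sdiv N)) i (s, x) *
          tg N (sdiv N) i (s, x) := by
      simp only [mul_comm]
    rw [secondVariation, h4, h5, h6]
    linarith
  have e2 : boundaryIntegral E (fun x => secondFundamentalForm E x (DH E x) * LH E x)
      = boundaryIntegral E fun x => V (s, x) * ∑ i, ∑ j, pd (eX i) (N j) (s, x) *
        tg N (sdiv N) i (s, x) * tg N (sdiv N) j (s, x) := by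
    refine boundaryIntegral_congr fun x hx => ?_
    simp only [h.DH_eq hs hO hx, ← hV x hx,
      hs.secondFundamentalForm_eq (h.sum_normal_tg (hO x hx) _) hx]
    ring
  have e3 : 1 / 2 * boundaryIntegral E (fun x => meanCurvature E x * ‖DH E x‖ ^ 2 * LH E x)
      = boundaryIntegral E fun x => 1 / 2 * (sdiv N (s, x) *
        (∑ i, tg N (sdiv N) i (s, x) ^ 2) * V (s, x)) := by
    rw [← boundaryIntegral_const_mul]
    refine boundaryIntegral_congr fun x hx => ?_
    simp only [h.DH_eq hs hO hx, ← hV x hx, h.meanCurvature_eq hs hO hx, norm_vec_sq]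
  rw [← e1, e2, e3, ← hE.boundaryIntegral_sub (cont s1) (cont s2),
    ← hE.boundaryIntegral_add (cont (s1.sub s2)) (cont s3)]
  refine boundaryIntegral_congr fun x hx => ?_
  simp only [h.nd_half_sq_tg (hO x hx) hH]
  ring

end IsNormalFlow

end SurfaceDiffusion

end

/-! ### The two evolution formulas -/

theorem lemma4p3 (E : ℝ → Set R3) (T : ℝ) (hE : IsSurfaceDiffusionFlow E T)
    (t : ℝ) (ht : t ∈ Set.Ioo 0 T) :
    (perimeter (E t) ≠ ⊤ ∧
      BoundaryIntegrable (E t) (fun x => ‖DH (E t) x‖ ^ 2) ∧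
      BoundaryIntegrable (E t) (fun x => ‖tangentialGradient (E t) (LH (E t)) x‖ ^ 2) ∧
      BoundaryIntegrable (E t) (fun x => normSqB (E t) x * LH (E t) x ^ 2) ∧
      BoundaryIntegrable (E t) (fun x =>
        secondFundamentalForm (E t) x (DH (E t) x) * LH (E t) x) ∧
      BoundaryIntegrable (E t) (fun x =>
        meanCurvature (E t) x * ‖DH (E t) x‖ ^ 2 * LH (E t) x)) ∧
    HasDerivAt (fun s => J (E s))
      (-boundaryIntegral (E t) (fun x => ‖DH (E t) x‖ ^ 2)) t ∧
    HasDerivAt (fun s => 1 / 2 * boundaryIntegral (E s) (fun x => ‖DH (E s) x‖ ^ 2))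
      (-secondVariation (E t) (LH (E t))
        - boundaryIntegral (E t) (fun x =>
            secondFundamentalForm (E t) x (DH (E t) x) * LH (E t) x)
        + 1 / 2 * boundaryIntegral (E t) (fun x =>
            meanCurvature (E t) x * ‖DH (E t) x‖ ^ 2 * LH (E t) x)) t := by
  obtain ⟨F, Ψ, hflow, hSD⟩ := hE
  obtain ⟨Φ, Ξ, hΦ, hEt, hev, hvel⟩ := hflow.exists_flowMap ht
  obtain ⟨N, V, u, g, O, hN, hNp, hVp, hN1, hV, hO⟩ := hΦ.exists_normalFlow hEt
  have hid : (fun y => Φ (t, y)) '' E t = E t := by simp [hΦ.eq_self]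
  obtain ⟨hNt, hOt⟩ := hO.self_of_nhds
  rw [hid] at hNt hOt
  -- The equation is used at the time t alone: both derivatives at t involve V only through its
  -- values and tangential derivatives on ∂E_t, and the values there determine the latter.
  have hVL : ∀ x ∈ frontier (E t), V (t, x) = LH (E t) x := by
    intro x hx
    rw [LH, ← hSD t ht x hx, normalVelocity, hNt.normal_eq x hx, hvel, inner_vec, hV]
    simp only [fderiv_apply_eq_pd hΦ.smooth]
  have hH := contDiff_sdiv hN.smoothN
  have hHp := IsSpacePeriodic.sdiv hNp
  have htH := contDiff_tg hN.smoothN hH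
  have htV := contDiff_tg hN.smoothN hN.smoothV
  have hint : ∀ {f : R3 → ℝ} {G : ST → ℝ}, ContDiff ℝ ∞ G →
      (∀ x ∈ frontier (E t), f x = G (t, x)) → BoundaryIntegrable (E t) f := fun hG hf =>
    hEt.boundaryIntegrable ((contDiff_slice hG t).continuous.continuousOn.congr hf)
  have sDH : ContDiff ℝ ∞ fun p => ∑ i, tg N (sdiv N) i p ^ 2 :=
    ContDiff.sum fun i _ => (htH i).pow 2
  have hDH : ∀ x ∈ frontier (E t), ‖DH (E t) x‖ ^ 2 = ∑ i, tg N (sdiv N) i (t, x) ^ 2 :=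
    fun x hx => by rw [hN.DH_eq hNt hOt hx, norm_vec_sq]
  refine ⟨⟨?_, hint sDH hDH, ?_, ?_, ?_, ?_⟩, ?_, ?_⟩
  · rw [hEt.perimeter_eq (hNt.isTestField hNp hN1) fun x hx => (hNt.normal_eq x hx).symm]
    exact ENNReal.ofReal_ne_top
  · refine hint (G := fun p => ∑ i, tg N V i p ^ 2) (ContDiff.sum fun i _ => (htV i).pow 2)
      fun x hx => ?_
    rw [hNt.tangentialGradient_eq hN.smoothV (fun y hy => (hVL y hy).symm) hx, norm_vec_sq]
  · refine hint (G := fun p => (∑ i, ∑ k, tg N (N k) i p ^ 2) * V p ^ 2)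
      ((ContDiff.sum fun i _ => ContDiff.sum fun k _ =>
        (contDiff_tg hN.smoothN (hN.smoothN k) i).pow 2).mul (hN.smoothV.pow 2)) fun x hx => ?_
    rw [hNt.normSqB_eq hx, hVL x hx]
  · refine hint (G := fun p => (∑ i, ∑ j, pd (eX i) (N j) p * tg N (sdiv N) i p *
      tg N (sdiv N) j p) * V p) ((ContDiff.sum fun i _ => ContDiff.sum fun j _ =>
        ((contDiff_pd (hN.smoothN j) _).mul (htH i)).mul (htH j)).mul hN.smoothV) fun x hx => ?_
    rw [hN.DH_eq hNt hOt hx, hVL x hx,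
      hNt.secondFundamentalForm_eq (hN.sum_normal_tg (hOt x hx) _) hx]
  · refine hint (G := fun p => sdiv N p * (∑ i, tg N (sdiv N) i p ^ 2) * V p)
      ((hH.mul sDH).mul hN.smoothV) fun x hx => ?_
    rw [hDH x hx, hN.meanCurvature_eq hNt hOt hx, hVL x hx]
  -- For f = 1 the first variation is ∫ H V. The perimeter agrees with the area for all s near t,
  -- which suffices for the derivative.
  · have hd := hΦ.hasDerivAt_boundaryIntegral hEt hN hNp hV hO (f := fun _ => 1) contDiff_const
      fun _ _ _ => rfl
    have hval : boundaryIntegral (E t) (fun x => nd N V (fun _ => 1) (t, x)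
        + 1 * sdiv N (t, x) * V (t, x)) = -boundaryIntegral (E t) fun x => ‖DH (E t) x‖ ^ 2 := by
      have h1 := hNt.integral_mul_tdiv_tg hN hNp hOt hH hHp hH hHp
      rw [boundaryIntegral_congr (f := fun x => ‖DH (E t) x‖ ^ 2)
        (g := fun x => ∑ i, tg N (sdiv N) i (t, x) * tg N (sdiv N) i (t, x))
        fun x hx => by simp only [hDH x hx, sq], ← h1]
      refine boundaryIntegral_congr fun x hx => ?_
      simp only [← hN.LH_eq hNt hOt hx, hVL x hx, nd, pd_const]
      simp
    rw [hval] at hd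
    refine hd.congr_of_eventuallyEq ?_
    filter_upwards [hev, hO] with s hs hOs
    rw [hs]
    exact hOs.1.smoothSet.J_eq (hOs.1.isTestField hNp hN1) fun x hx => (hOs.1.normal_eq x hx).symm
  -- Now f is the space-time extension of ½|D_τ H|², which agrees with the geometric quantity on
  -- ∂E_s for every s near t.
  · have hd := hΦ.hasDerivAt_boundaryIntegral hEt hN hNp hV hO
      (f := fun p => 1 / 2 * ∑ i, tg N (sdiv N) i p ^ 2) (contDiff_const.mul sDH)
      fun s x m => by simp only [fun i => IsSpacePeriodic.tg hNp hHp i s x m]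
    rw [hN.integral_nd_half_sq_DH hNt hOt hNp hVp hVL] at hd
    refine hd.congr_of_eventuallyEq ?_
    filter_upwards [hev, hO] with s hs hOs
    rw [hs, ← boundaryIntegral_const_mul]
    refine boundaryIntegral_congr fun x hx => ?_
    simp only [hN.DH_eq hOs.1 hOs.2 hx, norm_vec_sq]
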